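/- **Conventions.** Graphs are finite, simple and undirected, and $n$ denotes the number of vertices. A *cluster graph* is a disjoint union of cliques. For graph classes $A$ and $B$, $A\bowtie B$ is the class of graphs $G=(V,E)$ with $E=E_1\cup E_2$ for some $(V,E_1)\in A$ and $(V,E_2)\in B$; the pair $(V,E_1),(V,E_2)$ is a *decomposition* of $G$. A *maximum-weight colorful independent set* of a graph $G=(V,E)$ with vertex weights $w\colon V\to\mathbb N$ and a coloring $\mathrm{col}\colon V\to\{1,\dots,c\}$ is an independent set whose vertices have pairwise distinct colors and that has maximum total weight among all such sets. Algorithms are programs of a random access machine with uniform cost (one addition, truncated subtraction, copy, test, or access to a cell per step), graphs are given by adjacency lists, and algorithms output a vertex set of the required kind. **Lemma.** There is an absolute constant $K>0$ such that the following holds. Let $\mathcal C$ be a graph class and let $t\colon\mathbb N\times\mathbb N\to\mathbb N$ be a function such that a maximum-weight colorful independent set in graphs in $\mathcal C$, for given vertex weights and a given coloring with $c$ colors, is computable in $t(c,n)$ time, by one algorithm for all $c$ and $n$. Then there is an algorithm that, given an integer $\ell\ge 1$, the vertex weights $w\colon V\to\mathbb N$ of a graph $G$ in $\text{cluster}\bowtie\mathcal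 C$ and a decomposition of $G$ into a cluster graph and a graph of $\mathcal C$, computes an independent set of $G$ that has maximum weight among the independent sets of $G$ with at most $\ell$ vertices, in at most $$K\cdot e^{\ell}\cdot \ell^{K\log \ell}\cdot\log (n+2)\cdot t(\ell,n)$$ time, that is, in $e^{\ell}\,\ell^{O(\log\ell)}\log n\cdot t(\ell,n)$ time. -/

import Mathlib

/-! ### The machine model: a random access machine with uniform cost

The machine has registers, an unbounded random access memory and a random access read-only input;
registers, memory cells and input cells hold natural numbers.  In one step it performs a single
register operation (loading a constant, copying, addition, truncated subtraction), reads one input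
cell, reads or writes one memory cell (indirect addressing through registers), or tests a register
for zero.  Programs are finite and are written with structured control flow. -/

namespace RAM

/-- RAM programs.  Registers are numbered by natural numbers. -/
inductive Prog : Type
  | skip : Prog
  /-- `r := c` -/
  | const (r c : ℕ) : Prog
  /-- `r := a` -/
  | copy (r a : ℕ) : Prog
  /-- `r := a + b` -/
  | add (r a b : ℕ) : Prog
  /-- `r := max (a - b) 0` -/
  | sub (r a b : ℕ) : Prog
  /-- `r := input[a]` -/
  | read (r a : ℕ) : Prog
  /-- `r := memory[a]` -/
  | load (r a : ℕ) : Prog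
  /-- `memory[a] := b` -/
  | store (a b : ℕ) : Prog
  | seq (p q : Prog) : Prog
  /-- if register `a` is nonzero then `p`, else `q` -/
  | ite (a : ℕ) (p q : Prog) : Prog
  /-- while register `a` is nonzero do `p` -/
  | loop (a : ℕ) (p : Prog) : Prog

/-- The contents of the registers and of the memory. -/
structure State : Type where
  reg : ℕ → ℕ
  mem : ℕ → ℕ

/-- Initially all registers and memory cells hold `0`. -/
def State.init : State := ⟨fun _ => 0, fun _ => 0⟩

/-- Write the value `x` to register `r`. -/
def State.setReg (s : State) (r x : ℕ) : State := ⟨Function.update s.reg r x, s.mem⟩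

/-- Write the value `x` to memory cell `a`. -/
def State.setMem (s : State) (a x : ℕ) : State := ⟨s.reg, Function.update s.mem a x⟩

/-- `Exec inp p s k s'`: on the input `inp`, the program `p` started in the state `s` halts in the
state `s'` after exactly `k` steps. -/
inductive Exec (inp : ℕ → ℕ) : Prog → State → ℕ → State → Prop
  | skip (s : State) : Exec inp .skip s 1 s
  | const (r c : ℕ) (s : State) : Exec inp (.const r c) s 1 (s.setReg r c)
  | copy (r a : ℕ) (s : State) : Exec inp (.copy r a) s 1 (s.setReg r (s.reg a))
  | add (r a b : ℕ) (s : State) : Exec inp (.add r a b) s 1 (s.setReg r (s.reg a + s.reg b))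
  | sub (r a b : ℕ) (s : State) : Exec inp (.sub r a b) s 1 (s.setReg r (s.reg a - s.reg b))
  | read (r a : ℕ) (s : State) : Exec inp (.read r a) s 1 (s.setReg r (inp (s.reg a)))
  | load (r a : ℕ) (s : State) : Exec inp (.load r a) s 1 (s.setReg r (s.mem (s.reg a)))
  | store (a b : ℕ) (s : State) : Exec inp (.store a b) s 1 (s.setMem (s.reg a) (s.reg b))
  | seq {p q : Prog} {s s' s'' : State} {k l : ℕ} :
      Exec inp p s k s' → Exec inp q s' l s'' → Exec inp (.seq p q) s (k + l) s''
  | ite_true {a : ℕ} {p q : Prog} {s s' : State} {k : ℕ} :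
      s.reg a ≠ 0 → Exec inp p s k s' → Exec inp (.ite a p q) s (k + 1) s'
  | ite_false {a : ℕ} {p q : Prog} {s s' : State} {k : ℕ} :
      s.reg a = 0 → Exec inp q s k s' → Exec inp (.ite a p q) s (k + 1) s'
  | loop_done {a : ℕ} {p : Prog} {s : State} :
      s.reg a = 0 → Exec inp (.loop a p) s 1 s
  | loop_step {a : ℕ} {p : Prog} {s s' s'' : State} {k l : ℕ} :
      s.reg a ≠ 0 → Exec inp p s k s' → Exec inp (.loop a p) s' l s'' →
      Exec inp (.loop a p) s (k + l + 1) s''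

/-- A list of numbers as an input: cell `i` holds the `i`-th entry, all further cells hold `0`. -/
def inputOf (ws : List ℕ) : ℕ → ℕ := fun i => ws.getD i 0

/-- The final memory `mem` holds the vertex set `S`: cell `0` holds `|S|`, and the cells
`1, …, |S|` list the elements of `S`, each once, in some order. -/
def HoldsSet {n : ℕ} (mem : ℕ → ℕ) (S : Finset (Fin n)) : Prop :=
  mem 0 = S.card ∧ ∀ v : Fin n, v ∈ S ↔ ∃ i < S.card, mem (i + 1) = (v : ℕ)

/-- On the input word list `ws`, the program `p` halts after at most `T` steps and its output is a
vertex set with the property `Good`. -/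
def ComputesWithin {n : ℕ} (p : Prog) (ws : List ℕ) (T : ℝ) (Good : Finset (Fin n) → Prop) :
    Prop :=
  ∃ (k : ℕ) (s : State) (S : Finset (Fin n)),
    Exec (inputOf ws) p State.init k s ∧ (k : ℝ) ≤ T ∧ HoldsSet s.mem S ∧ Good S

end RAM

/-! ### Graphs, graph classes and their encoding -/

/-- A class of finite simple graphs, given by its members with vertex set `Fin n` for each `n`
(no closure property, not even under isomorphism, is required). -/
abbrev GraphClass : Type := (n : ℕ) → Set (SimpleGraph (Fin n))

/-- Cluster graphs: each connected component is a clique. -/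
def clusterGraphs : GraphClass := fun _ =>
  {G | ∀ u v, G.Reachable u v → u ≠ v → G.Adj u v}

/-- `G = (V, E₁ ∪ E₂)` with `G₁ = (V, E₁)` in `A` and `G₂ = (V, E₂)` in `B`. -/
def IsDecomposition (A B : GraphClass) {n : ℕ} (G G₁ G₂ : SimpleGraph (Fin n)) : Prop :=
  G₁ ∈ A n ∧ G₂ ∈ B n ∧ G = G₁ ⊔ G₂

/-- The class `A ⋈ B`. -/
def GraphClass.join (A B : GraphClass) : GraphClass := fun _ =>
  {G | ∃ G₁ G₂, IsDecomposition A B G G₁ G₂}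

/-- Adjacency lists of a graph; the neighbors of a vertex may be listed in any order. -/
structure AdjLists {n : ℕ} (G : SimpleGraph (Fin n)) : Type where
  nbrs : Fin n → List (Fin n)
  nodup : ∀ v, (nbrs v).Nodup
  mem_iff : ∀ v u, u ∈ nbrs v ↔ G.Adj v u

/-- Adjacency lists as a list of numbers: first `n + 1` offsets, where the `i`-th offset is the
total length of the lists of the vertices before `i`, then all the lists, one after the other. -/
def AdjLists.toWords {n : ℕ} {G : SimpleGraph (Fin n)} (L : AdjLists G) : List ℕ :=
  (List.range (n + 1)).map (fun i => ((List.ofFn L.nbrs).take i).flatten.length) ++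
    (List.ofFn L.nbrs).flatten.map (fun v => (v : ℕ))

/-! ### The two problems -/

/-- The weight of a vertex set. -/
def weight {n : ℕ} (w : Fin n → ℕ) (S : Finset (Fin n)) : ℕ := ∑ v ∈ S, w v

/-- `S` is an independent set of `G` whose vertices have pairwise distinct colors. -/
def IsColorfulIndepSet {n c : ℕ} (G : SimpleGraph (Fin n)) (col : Fin n → Fin c)
    (S : Finset (Fin n)) : Prop :=
  G.IsIndepSet (S : Set (Fin n)) ∧ Set.InjOn col (S : Set (Fin n))

/-- `S` is a maximum-weight colorful independent set of `G`. -/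
def IsMaxWeightColorfulIndepSet {n c : ℕ} (G : SimpleGraph (Fin n)) (w : Fin n → ℕ)
    (col : Fin n → Fin c) (S : Finset (Fin n)) : Prop :=
  IsColorfulIndepSet G col S ∧
    ∀ S' : Finset (Fin n), IsColorfulIndepSet G col S' → weight w S' ≤ weight w S

/-- `S` has maximum weight among the independent sets of `G` with at most `l` vertices. -/
def IsMaxWeightIndepSetOfSizeLE {n : ℕ} (G : SimpleGraph (Fin n)) (w : Fin n → ℕ) (l : ℕ)
    (S : Finset (Fin n)) : Prop :=
  (G.IsIndepSet (S : Set (Fin n)) ∧ S.card ≤ l) ∧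
    ∀ S' : Finset (Fin n), G.IsIndepSet (S' : Set (Fin n)) ∧ S'.card ≤ l →
      weight w S' ≤ weight w S

/-- The input for a graph with vertex weights and a coloring with `c` colors. -/
def encodeColored {n c : ℕ} {G : SimpleGraph (Fin n)} (L : AdjLists G) (w : Fin n → ℕ)
    (col : Fin n → Fin c) : List ℕ :=
  [n, c] ++ List.ofFn w ++ List.ofFn (fun v => (col v : ℕ)) ++ L.toWords

/-- The input for a graph `(V, E₁ ∪ E₂)` given by its decomposition into `(V, E₁)` and `(V, E₂)`,
with vertex weights and the size bound `l`. -/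
def encodeDecomposed {n : ℕ} {G₁ G₂ : SimpleGraph (Fin n)} (L₁ : AdjLists G₁) (L₂ : AdjLists G₂)
    (w : Fin n → ℕ) (l : ℕ) : List ℕ :=
  [n, l] ++ List.ofFn w ++ L₁.toWords ++ L₂.toWords

/-- In graphs of the class `C`, a maximum-weight colorful independent set is computable in
`t c n` time, where `n` is the number of vertices and `c` the number of colors. -/
def ColorfulIndepSetComputableInTime (C : GraphClass) (t : ℕ → ℕ → ℕ) : Prop :=
  ∃ P : RAM.Prog, ∀ (n c : ℕ) (G : SimpleGraph (Fin n)), G ∈ C n →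
    ∀ (L : AdjLists G) (w : Fin n → ℕ) (col : Fin n → Fin c),
      RAM.ComputesWithin P (encodeColored L w col) (t c n : ℝ)
        (IsMaxWeightColorfulIndepSet G w col)

/-- In graphs of the class `A ⋈ B`, given with a decomposition, a maximum-weight independent set of
size at most `l` is computable in `T l n` time for all `l ≥ 1`, where `n` is the number of
vertices. -/
def BoundedIndepSetComputableInTime (A B : GraphClass) (T : ℕ → ℕ → ℝ) : Prop :=
  ∃ Q : RAM.Prog, ∀ (n l : ℕ), 1 ≤ l → ∀ G ∈ (A.join B) n,
    ∀ G₁ G₂ : SimpleGraph (Fin n), IsDecomposition A B G G₁ G₂ →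
      ∀ (L₁ : AdjLists G₁) (L₂ : AdjLists G₂) (w : Fin n → ℕ),
        RAM.ComputesWithin Q (encodeDecomposed L₁ L₂ w l) (T l n)
          (IsMaxWeightIndepSetOfSizeLE G w l)

set_option linter.constructorNameAsVariable false
set_option linter.unusedSimpArgs false

/-! ### A while language with arrays, compiled to the random access machine -/


namespace While

/-! A set is independent in the union graph iff it is independent in the second graph and meets each
cluster at most once. Give the clusters `l` colors and every vertex the color of its cluster. A
colorful independent set of the second graph is then independent in the union and has at most `l`
vertices. Conversely, an independent set of the union with at most `l` vertices is colorful as soon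
as the coloring is injective on its clusters. So it suffices to run the given program for a family
of colorings that contains, for any `l` clusters, one that is injective on them, and to keep the
heaviest output (`Task.Best.isMax`). The substance is to build such a perfect hash family, of size
`e^l * l^O(log l) * log n`, deterministically and within the time bound.

A member of the family is a composition of two maps. (1) Write the numbers up to `n` as polynomials
over `ZMod q` in base `q` and evaluate them at a point `a`. Two polynomials of degree less than `d`
agree in fewer than `d` points. If `d = (q - 1) / (2 * l ^ 2)` suffices to write all the numbers, a
union bound over pairs gives an `a` that is injective on a given `l`-set
(`Good.exists_injOn_polyHash`). By Bertrand's postulate there is such a prime with `q * log q ≤ 48 *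
l ^ 4 * log (n + 2)` (`exists_goodField`). (2) Cut the field, as an ordered set, by `J` thresholds
into `s` blocks that contain `b = l / s` of the hashed elements each, and `l % s` blocks that
contain one. Inside a large block, use one of `M` functions into `b` colors from a `b`-perfect
family (`Good.exists_color_injOn`). Altogether there are `q * q ^ J * M ^ s` colorings.

The `b`-perfect family consists of polynomials of degree less than `b`, reduced modulo `b`, chosen
greedily. By interpolation a `b`-tuple of distinct points is separated by at least `b! * (q / b) ^
b` of the `q ^ b` polynomials (`numSeparating_le`), which is a fraction of at least `1 / (2 * e ^
b)` because `2 * b ^ 2 < q`. By averaging, some polynomial separates at least that fraction of the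
remaining tuples (`alive_mul_le`), so `M ≤ 2 * e ^ b * b * log q + 1` (`rows_le`), and `M ^ s`
contributes `e ^ (b * s) ≤ e ^ l` times lower order factors.

The greedy search costs about `q ^ (3 * b)`. If `q ^ (16 * l) ≤ n`, a single block is used, and the
search is paid for by `n ≤ t + 1`, which holds because a correct program must look at almost all
weights (`le_time_of_computes`). Otherwise `q` is polynomial in `l`, and `s = 16 * (Nat.log 2 q +
1)` blocks make the search cost at most `2 ^ l` up to powers of `q`, while the `s`-th powers of
quantities polynomial in `l` and `q` are `l ^ O(log l)` (`time_le_of_pow_le`, `time_le_of_lt_pow`).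

The algorithm itself is written in a small while language with a cost semantics, verified with
weakest preconditions, and compiled to the machine (`Cmd.compile_spec`). The given program is run by
an interpreter with constant overhead per step (`simulate_exec`). The adjacency lists may be much
longer than `t`, so they are never copied: the interpreter redirects reads of the second graph into
the original input, and only one list per cluster of the first graph is read. -/

/-- Scalar variables. -/
inductive Var : Type
  | n | l | off | q | s | b | r | Q | J | ll | pw | go | isP | x | y | z | e | acc | cnt | best
  | i | j | k | v | w | M | fb | t | ok | carry | a | e1 | e2 | N1 | N2 | gen | adr | bestW | bestC
  | hi | lo
  deriving DecidableEq

/-- Arrays. -/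
inductive Arr : Type
  | out | cid | red | zd | td | g | bg | ft | dead | mr | hx | th | ix | ycol | col
  | rv | rg | mv | mg
  deriving DecidableEq

/-- Expressions; `cond c t f` is `t` if `c` is nonzero and `f` otherwise. -/
inductive Expr : Type
  | lit (c : ℕ)
  | var (x : Var)
  | add (a b : Expr)
  | sub (a b : Expr)
  | inp (e : Expr)
  | get (A : Arr) (e : Expr)
  | cond (c t f : Expr)

instance : Add Expr := ⟨Expr.add⟩
instance : Sub Expr := ⟨Expr.sub⟩
instance : Coe Var Expr := ⟨Expr.var⟩
instance (n : ℕ) : OfNat Expr n := ⟨Expr.lit n⟩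

/-- Commands. -/
inductive Cmd : Type
  | skip
  | assign (x : Var) (e : Expr)
  | store (A : Arr) (i e : Expr)
  | seq (c d : Cmd)
  | ite (e : Expr) (c d : Cmd)
  | loop (e : Expr) (c : Cmd)

/-- Values of the variables and contents of the arrays. -/
structure St : Type where
  v : Var → ℕ
  a : Arr → ℕ → ℕ

namespace St

def init : St := ⟨fun _ => 0, fun _ _ => 0⟩

def setV (σ : St) (x : Var) (c : ℕ) : St := ⟨Function.update σ.v x c, σ.a⟩

def setA (σ : St) (A : Arr) (i c : ℕ) : St :=
  ⟨σ.v, Function.update σ.a A (Function.update (σ.a A) i c)⟩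

@[simp] theorem setV_v (σ : St) (x y : Var) (c : ℕ) :
    (σ.setV x c).v y = if y = x then c else σ.v y := by
  simp [setV, Function.update_apply]

@[simp] theorem setV_a (σ : St) (x : Var) (c : ℕ) : (σ.setV x c).a = σ.a := rfl

@[simp] theorem setA_v (σ : St) (A : Arr) (i c : ℕ) : (σ.setA A i c).v = σ.v := rfl

theorem setA_a (σ : St) (A B : Arr) (i j c : ℕ) :
    (σ.setA A i c).a B j = if B = A ∧ j = i then c else σ.a B j := by
  by_cases h : B = A
  · subst h; simp [setA, Function.update_apply]
  · simp [setA, Function.update_apply, h]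

@[simp] theorem setA_a_ne (σ : St) (A B : Arr) (i c : ℕ) (h : B ≠ A) :
    (σ.setA A i c).a B = σ.a B := by
  simp [setA, Function.update_apply, h]

@[simp] theorem setA_a_same (σ : St) (A : Arr) (i j c : ℕ) :
    (σ.setA A i c).a A j = if j = i then c else σ.a A j := by
  simp [setA, Function.update_apply]

end St

namespace Expr

def eval (inp : ℕ → ℕ) (σ : St) : Expr → ℕ
  | lit c => c
  | var x => σ.v x
  | add a b => a.eval inp σ + b.eval inp σ
  | sub a b => a.eval inp σ - b.eval inp σ
  | .inp e => inp (e.eval inp σ)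
  | get A e => σ.a A (e.eval inp σ)
  | cond c t f => if c.eval inp σ ≠ 0 then t.eval inp σ else f.eval inp σ

/-- An upper bound for the number of machine steps of the evaluation. -/
def cost : Expr → ℕ
  | lit _ => 1
  | var _ => 1
  | add a b => a.cost + b.cost + 1
  | sub a b => a.cost + b.cost + 1
  | .inp e => e.cost + 1
  | get _ e => e.cost + 8
  | cond c t f => c.cost + t.cost + f.cost + 1

/-- An expression that is nonzero iff `a ≠ b`. -/
def ne (a b : Expr) : Expr := (a - b) + (b - a)

/-- An expression that is nonzero iff `a < b`. -/
def lt (a b : Expr) : Expr := b - a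

variable (inp : ℕ → ℕ) (σ : St) (a b c : Expr)

@[simp] theorem eval_lit (k : ℕ) : (lit k).eval inp σ = k := rfl
@[simp] theorem eval_ofNat (k : ℕ) : (ofNat(k) : Expr).eval inp σ = OfNat.ofNat k := rfl
@[simp] theorem eval_var (x : Var) : (var x).eval inp σ = σ.v x := rfl
@[simp] theorem eval_add : (a + b).eval inp σ = a.eval inp σ + b.eval inp σ := rfl
@[simp] theorem eval_sub : (a - b).eval inp σ = a.eval inp σ - b.eval inp σ := rfl
@[simp] theorem eval_inp : (Expr.inp a).eval inp σ = inp (a.eval inp σ) := rfl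
@[simp] theorem eval_get (A : Arr) : (get A a).eval inp σ = σ.a A (a.eval inp σ) := rfl
@[simp] theorem eval_cond :
    (cond c a b).eval inp σ = if c.eval inp σ ≠ 0 then a.eval inp σ else b.eval inp σ := rfl
@[simp] theorem eval_ne : (ne a b).eval inp σ = 0 ↔ a.eval inp σ = b.eval inp σ := by
  simp only [ne, eval_add, eval_sub]; omega
@[simp] theorem eval_lt : (lt a b).eval inp σ = 0 ↔ b.eval inp σ ≤ a.eval inp σ := by
  simp only [lt, eval_sub]; omega

@[simp] theorem cost_lit (k : ℕ) : (lit k).cost = 1 := rfl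
@[simp] theorem cost_ofNat (k : ℕ) : (ofNat(k) : Expr).cost = 1 := rfl
@[simp] theorem cost_var (x : Var) : (var x).cost = 1 := rfl
@[simp] theorem cost_add : (a + b).cost = a.cost + b.cost + 1 := rfl
@[simp] theorem cost_sub : (a - b).cost = a.cost + b.cost + 1 := rfl
@[simp] theorem cost_inp : (Expr.inp a).cost = a.cost + 1 := rfl
@[simp] theorem cost_get (A : Arr) : (get A a).cost = a.cost + 8 := rfl
@[simp] theorem cost_cond : (cond c a b).cost = c.cost + a.cost + b.cost + 1 := rfl
@[simp] theorem cost_ne : (ne a b).cost = 2 * (a.cost + b.cost) + 3 := by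
  simp only [ne, cost_add, cost_sub]; ring
@[simp] theorem cost_lt : (lt a b).cost = b.cost + a.cost + 1 := rfl

/-- The variables of an expression. -/
def vars : Expr → List Var
  | lit _ => []
  | var x => [x]
  | add a b => a.vars ++ b.vars
  | sub a b => a.vars ++ b.vars
  | .inp e => e.vars
  | get _ e => e.vars
  | cond c t f => c.vars ++ t.vars ++ f.vars

/-- The arrays of an expression. -/
def arrs : Expr → List Arr
  | lit _ => []
  | var _ => []
  | add a b => a.arrs ++ b.arrs
  | sub a b => a.arrs ++ b.arrs
  | .inp e => e.arrs
  | get A e => A :: e.arrs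
  | cond c t f => c.arrs ++ t.arrs ++ f.arrs

theorem eval_congr {inp : ℕ → ℕ} {σ τ : St} {e : Expr} (hv : ∀ x ∈ e.vars, τ.v x = σ.v x)
    (ha : ∀ A ∈ e.arrs, τ.a A = σ.a A) : e.eval inp τ = e.eval inp σ := by
  induction e with
  | lit c => rfl
  | var x => exact hv x (by simp [vars])
  | add a b iha ihb | sub a b iha ihb =>
    simp only [vars, arrs, List.mem_append] at hv ha
    simp only [eval]
    rw [iha (fun x h => hv x (.inl h)) (fun x h => ha x (.inl h)),
      ihb (fun x h => hv x (.inr h)) (fun x h => ha x (.inr h))]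
  | inp e ih => simp only [eval]; rw [ih hv ha]
  | get A e ih =>
    simp only [vars, arrs, List.mem_cons] at hv ha
    simp only [eval]
    rw [ih hv (fun x h => ha x (.inr h)), ha A (.inl rfl)]
  | cond c t f ihc iht ihf =>
    simp only [vars, arrs, List.mem_append] at hv ha
    simp only [eval]
    rw [ihc (fun x h => hv x (.inl (.inl h))) (fun x h => ha x (.inl (.inl h))),
      iht (fun x h => hv x (.inl (.inr h))) (fun x h => ha x (.inl (.inr h))),
      ihf (fun x h => hv x (.inr h)) (fun x h => ha x (.inr h))]

end Expr

/-- `CExec inp c σ k σ'`: the command `c` started in `σ` halts in `σ'`, at cost `k`. -/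
inductive CExec (inp : ℕ → ℕ) : Cmd → St → ℕ → St → Prop
  | skip (σ : St) : CExec inp .skip σ 1 σ
  | assign (x : Var) (e : Expr) (σ : St) :
      CExec inp (.assign x e) σ (e.cost + 1) (σ.setV x (e.eval inp σ))
  | store (A : Arr) (i e : Expr) (σ : St) :
      CExec inp (.store A i e) σ (i.cost + e.cost + 8) (σ.setA A (i.eval inp σ) (e.eval inp σ))
  | seq {c d : Cmd} {σ σ' σ'' : St} {k m : ℕ} :
      CExec inp c σ k σ' → CExec inp d σ' m σ'' → CExec inp (.seq c d) σ (k + m) σ''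
  | ite_true {e : Expr} {c d : Cmd} {σ σ' : St} {k : ℕ} :
      e.eval inp σ ≠ 0 → CExec inp c σ k σ' → CExec inp (.ite e c d) σ (k + (e.cost + 1)) σ'
  | ite_false {e : Expr} {c d : Cmd} {σ σ' : St} {k : ℕ} :
      e.eval inp σ = 0 → CExec inp d σ k σ' → CExec inp (.ite e c d) σ (k + (e.cost + 1)) σ'
  | loop_done {e : Expr} {c : Cmd} {σ : St} :
      e.eval inp σ = 0 → CExec inp (.loop e c) σ (e.cost + 1) σ
  | loop_step {e : Expr} {c : Cmd} {σ σ' σ'' : St} {k m : ℕ} :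
      e.eval inp σ ≠ 0 → CExec inp c σ k σ' → CExec inp (.loop e c) σ' m σ'' →
      CExec inp (.loop e c) σ (k + m + (e.cost + 1)) σ''

/-! #### Compilation -/

/-- The code of a variable. -/
def Var.code (x : Var) : ℕ := x.ctorIdx

/-- The code of an array. -/
def Arr.code (A : Arr) : ℕ := A.ctorIdx + 1

theorem Var.code_injective : Function.Injective Var.code := by
  intro x y h
  cases x <;> cases y <;> first | rfl | exact absurd h (by decide)

theorem Arr.code_injective : Function.Injective Arr.code := by
  intro x y h
  cases x <;> cases y <;> first | rfl | exact absurd h (by decide)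

theorem Arr.code_lt (A : Arr) : A.code < 32 := by cases A <;> decide

/-- Even registers are for variables and odd ones for the evaluation stack, so that evaluating an
expression never disturbs a variable. -/
def vreg (x : Var) : ℕ := 2 * x.code
def treg (t : ℕ) : ℕ := 2 * t + 1

open RAM (Prog State Exec)

/-- `reg t := 32 * reg t + c`, with scratch register `t + 1`. -/
def addrProg (t c : ℕ) : Prog :=
  .seq (.add (treg t) (treg t) (treg t)) <| .seq (.add (treg t) (treg t) (treg t)) <|
  .seq (.add (treg t) (treg t) (treg t)) <| .seq (.add (treg t) (treg t) (treg t)) <|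
  .seq (.add (treg t) (treg t) (treg t)) <| .seq (.const (treg (t + 1)) c) <|
  .add (treg t) (treg t) (treg (t + 1))

def Expr.compile : Expr → ℕ → Prog
  | .lit c, t => .const (treg t) c
  | .var x, t => .copy (treg t) (vreg x)
  | .add a b, t => .seq (a.compile t) (.seq (b.compile (t + 1))
      (.add (treg t) (treg t) (treg (t + 1))))
  | .sub a b, t => .seq (a.compile t) (.seq (b.compile (t + 1))
      (.sub (treg t) (treg t) (treg (t + 1))))
  | .inp e, t => .seq (e.compile t) (.read (treg t) (treg t))
  | .get A e, t => .seq (e.compile t) (.seq (addrProg t A.code) (.load (treg t) (treg t)))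
  | .cond c e f, t => .seq (c.compile t) (.ite (treg t) (e.compile t) (f.compile t))

def Cmd.compile : Cmd → Prog
  | .skip => .skip
  | .assign x e => .seq (e.compile 0) (.copy (vreg x) (treg 0))
  | .store A i e => .seq (i.compile 0) (.seq (addrProg 0 A.code) (.seq (e.compile 1)
      (.store (treg 0) (treg 1))))
  | .seq c d => .seq c.compile d.compile
  | .ite e c d => .seq (e.compile 0) (.ite (treg 0) c.compile d.compile)
  | .loop e c => .seq (e.compile 0) (.loop (treg 0) (.seq c.compile (e.compile 0)))

/-- The machine state `s` represents `σ`. -/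
def Rep (σ : St) (s : State) : Prop :=
  (∀ x, s.reg (vreg x) = σ.v x) ∧ ∀ A i, s.mem (32 * i + A.code) = σ.a A i

theorem vreg_ne_treg (x : Var) (t : ℕ) : vreg x ≠ treg t := by
  simp only [vreg, treg]; omega

theorem Rep.setReg_treg {σ : St} {s : State} (h : Rep σ s) (t c : ℕ) :
    Rep σ (s.setReg (treg t) c) := by
  refine ⟨fun x => ?_, h.2⟩
  simp [State.setReg, vreg_ne_treg, h.1]

theorem addrProg_exec (inp : ℕ → ℕ) {σ : St} {s : State} (h : Rep σ s) (t c : ℕ) :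
    ∃ s', Exec inp (addrProg t c) s 7 s' ∧ Rep σ s' ∧
      s'.reg (treg t) = 32 * s.reg (treg t) + c ∧
      ∀ u < t, s'.reg (treg u) = s.reg (treg u) := by
  refine ⟨_, .seq (.add ..) <| .seq (.add ..) <| .seq (.add ..) <| .seq (.add ..) <|
    .seq (.add ..) <| .seq (.const ..) (.add ..), ?_, ?_, ?_⟩
  · exact ((((((h.setReg_treg _ _).setReg_treg _ _).setReg_treg _ _).setReg_treg _
      _).setReg_treg _ _).setReg_treg _ _).setReg_treg _ _
  · simp [State.setReg, Function.update_apply, treg]; ring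
  · intro u hu
    have h1 : u ≠ t := hu.ne
    have h2 : u ≠ t + 1 := by omega
    simp [State.setReg, Function.update_apply, treg, h1, h2]

/-- The last conjunct makes the induction work: the second operand is evaluated one stack level
higher and must leave the value of the first one intact. -/
theorem Expr.compile_spec (inp : ℕ → ℕ) (σ : St) (e : Expr) :
    ∀ (t : ℕ) (s : State), Rep σ s → ∃ k s', Exec inp (e.compile t) s k s' ∧ k ≤ e.cost ∧
      Rep σ s' ∧ s'.reg (treg t) = e.eval inp σ ∧ ∀ u < t, s'.reg (treg u) = s.reg (treg u) := by
  have key : ∀ {t u : ℕ}, u < t → treg u ≠ treg t := by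
    intro t u h; simp only [treg]; omega
  induction e with
  | lit c =>
    intro t s h
    refine ⟨1, _, .const .., le_rfl, h.setReg_treg _ _, by simp [State.setReg, eval],
      fun u hu => ?_⟩
    simp [State.setReg, key hu]
  | var x =>
    intro t s h
    refine ⟨1, _, .copy .., le_rfl, h.setReg_treg _ _, by simp [State.setReg, eval, h.1],
      fun u hu => ?_⟩
    simp [State.setReg, key hu]
  | add a b iha ihb =>
    intro t s h
    obtain ⟨k, s', h1, h2, h3, h4, h5⟩ := iha t s h
    obtain ⟨m, s'', g1, g2, g3, g4, g5⟩ := ihb (t + 1) s' h3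
    refine ⟨_, _, .seq h1 (.seq g1 (.add ..)), by simp only [cost]; omega,
      g3.setReg_treg _ _, ?_, fun u hu => ?_⟩
    · simp [State.setReg, eval, g4, g5 t (by omega), h4]
    · simp [State.setReg, key hu, g5 u (by omega), h5 u hu]
  | sub a b iha ihb =>
    intro t s h
    obtain ⟨k, s', h1, h2, h3, h4, h5⟩ := iha t s h
    obtain ⟨m, s'', g1, g2, g3, g4, g5⟩ := ihb (t + 1) s' h3
    refine ⟨_, _, .seq h1 (.seq g1 (.sub ..)), by simp only [cost]; omega,
      g3.setReg_treg _ _, ?_, fun u hu => ?_⟩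
    · simp [State.setReg, eval, g4, g5 t (by omega), h4]
    · simp [State.setReg, key hu, g5 u (by omega), h5 u hu]
  | inp e ih =>
    intro t s h
    obtain ⟨k, s', h1, h2, h3, h4, h5⟩ := ih t s h
    refine ⟨_, _, .seq h1 (.read ..), by simp only [cost]; omega,
      h3.setReg_treg _ _, ?_, fun u hu => ?_⟩
    · simp [State.setReg, eval, h4]
    · simp [State.setReg, key hu, h5 u hu]
  | get A e ih =>
    intro t s h
    obtain ⟨k, s', h1, h2, h3, h4, h5⟩ := ih t s h
    obtain ⟨s'', g1, g3, g4, g5⟩ := addrProg_exec inp h3 t A.code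
    refine ⟨_, _, .seq h1 (.seq g1 (.load ..)), by simp only [cost]; omega,
      g3.setReg_treg _ _, ?_, fun u hu => ?_⟩
    · simp [State.setReg, eval, g4, h4, g3.2]
    · simp [State.setReg, key hu, h5 u hu, g5 u hu]
  | cond c e f ihc ihe ihf =>
    intro t s h
    obtain ⟨k, s', h1, h2, h3, h4, h5⟩ := ihc t s h
    by_cases hc : c.eval inp σ = 0
    · obtain ⟨m, s'', g1, g2, g3, g4, g5⟩ := ihf t s' h3
      refine ⟨_, _, .seq h1 (.ite_false (h4.trans hc) g1), by simp only [cost]; omega, g3, ?_,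
        fun u hu => ?_⟩
      · simp [eval, g4, hc]
      · rw [g5 u hu, h5 u hu]
    · obtain ⟨m, s'', g1, g2, g3, g4, g5⟩ := ihe t s' h3
      refine ⟨_, _, .seq h1 (.ite_true (by rwa [h4]) g1), by simp only [cost]; omega, g3, ?_,
        fun u hu => ?_⟩
      · simp [eval, g4, hc]
      · rw [g5 u hu, h5 u hu]

theorem Rep.setReg_vreg {σ : St} {s : State} (h : Rep σ s) (x : Var) (c : ℕ) :
    Rep (σ.setV x c) (s.setReg (vreg x) c) := by
  refine ⟨fun y => ?_, h.2⟩
  by_cases hy : y = x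
  · subst hy; simp [State.setReg]
  · have : vreg y ≠ vreg x := fun e => hy (Var.code_injective (by simpa [vreg] using e))
    simp [State.setReg, hy, this, h.1]

theorem Rep.setMem {σ : St} {s : State} (h : Rep σ s) (A : Arr) (i c : ℕ) :
    Rep (σ.setA A i c) (s.setMem (32 * i + A.code) c) := by
  refine ⟨h.1, fun B j => ?_⟩
  have hA := A.code_lt
  have hB := B.code_lt
  by_cases hy : B = A ∧ j = i
  · obtain ⟨rfl, rfl⟩ := hy; simp [State.setMem]
  · have : 32 * j + B.code ≠ 32 * i + A.code := by
      intro e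
      have h1 : j = i := by omega
      exact hy ⟨Arr.code_injective (by omega), h1⟩
    simp [State.setMem, this, St.setA_a, hy, h.2]

/-- The costs of `CExec` are set so that each construct pays for its machine code; for array
accesses the constant 8 is made of seven steps of `addrProg` and the access itself. -/
theorem Cmd.compile_spec {inp : ℕ → ℕ} {c : Cmd} {σ σ' : St} {k : ℕ} (h : CExec inp c σ k σ') :
    ∀ s : State, Rep σ s → ∃ m s', Exec inp c.compile s m s' ∧ m ≤ k ∧ Rep σ' s' := by
  induction h with
  | skip σ => intro s hs; exact ⟨1, s, .skip _, le_rfl, hs⟩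
  | assign x e σ =>
    intro s hs
    obtain ⟨k, s', h1, h2, h3, h4, h5⟩ := e.compile_spec inp σ 0 s hs
    refine ⟨_, _, .seq h1 (.copy ..), by omega, ?_⟩
    rw [h4]; exact h3.setReg_vreg _ _
  | store A i e σ =>
    intro s hs
    obtain ⟨k, s', h1, h2, h3, h4, h5⟩ := i.compile_spec inp σ 0 s hs
    obtain ⟨s'', g1, g3, g4, g5⟩ := addrProg_exec inp h3 0 A.code
    obtain ⟨m, s₃, f1, f2, f3, f4, f5⟩ := e.compile_spec inp σ 1 s'' g3
    refine ⟨_, _, .seq h1 (.seq g1 (.seq f1 (.store ..))), by omega, ?_⟩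
    rw [f4, f5 0 (by omega), g4, h4]; exact f3.setMem _ _ _
  | seq _ _ ih1 ih2 =>
    intro s hs
    obtain ⟨k, s', h1, h2, h3⟩ := ih1 s hs
    obtain ⟨m, s'', g1, g2, g3⟩ := ih2 s' h3
    exact ⟨_, _, .seq h1 g1, by omega, g3⟩
  | @ite_true e c d σ σ' k he _ ih =>
    intro s hs
    obtain ⟨k, s', h1, h2, h3, h4, h5⟩ := e.compile_spec inp σ 0 s hs
    obtain ⟨m, s'', g1, g2, g3⟩ := ih s' h3
    exact ⟨_, _, .seq h1 (.ite_true (by rwa [h4]) g1), by omega, g3⟩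
  | @ite_false e c d σ σ' k he _ ih =>
    intro s hs
    obtain ⟨k, s', h1, h2, h3, h4, h5⟩ := e.compile_spec inp σ 0 s hs
    obtain ⟨m, s'', g1, g2, g3⟩ := ih s' h3
    exact ⟨_, _, .seq h1 (.ite_false (by rwa [h4]) g1), by omega, g3⟩
  | @loop_done e c σ he =>
    intro s hs
    obtain ⟨k, s', h1, h2, h3, h4, h5⟩ := e.compile_spec inp σ 0 s hs
    exact ⟨_, _, .seq h1 (.loop_done (by rwa [h4])), by omega, h3⟩
  | @loop_step e c σ σ' σ'' k m he _ _ ih1 ih2 =>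
    intro s hs
    obtain ⟨k₁, s₁, h1, h2, h3, h4, h5⟩ := e.compile_spec inp σ 0 s hs
    obtain ⟨k₂, s₂, g1, g2, g3⟩ := ih1 s₁ h3
    obtain ⟨k₃, s₃, f1, f2, f3⟩ := ih2 s₂ g3
    -- Machine loops test a register, so the guard is evaluated before the loop and again at the end
    -- of each body. The run of the remaining loop begins with an evaluation of the guard, and this
    -- evaluation is moved to the end of the present body.
    cases f1 with
    | seq f4 f5 =>
      exact ⟨_, _, .seq h1 (.loop_step (by rwa [h4]) (.seq g1 f4) f5), by omega, f3⟩

/-! #### Weakest preconditions -/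

/-- Started in `σ`, the command `c` halts, and its cost and its final state satisfy `Q`. -/
def wp (inp : ℕ → ℕ) (c : Cmd) (σ : St) (Q : ℕ → St → Prop) : Prop :=
  ∃ k σ', CExec inp c σ k σ' ∧ Q k σ'

section wp

variable {inp : ℕ → ℕ} {σ : St} {Q R : ℕ → St → Prop}

theorem wp.mono {c : Cmd} (h : wp inp c σ Q) (hQ : ∀ k σ', Q k σ' → R k σ') : wp inp c σ R := by
  obtain ⟨k, σ', h1, h2⟩ := h
  exact ⟨k, σ', h1, hQ _ _ h2⟩

@[simp] theorem wp_skip : wp inp .skip σ Q ↔ Q 1 σ := by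
  constructor
  · rintro ⟨k, σ', h, hQ⟩; cases h; exact hQ
  · exact fun h => ⟨_, _, .skip _, h⟩

@[simp] theorem wp_assign {x : Var} {e : Expr} :
    wp inp (.assign x e) σ Q ↔ Q (e.cost + 1) (σ.setV x (e.eval inp σ)) := by
  constructor
  · rintro ⟨k, σ', h, hQ⟩; cases h; exact hQ
  · exact fun h => ⟨_, _, .assign .., h⟩

@[simp] theorem wp_store {A : Arr} {i e : Expr} :
    wp inp (.store A i e) σ Q ↔
      Q (i.cost + e.cost + 8) (σ.setA A (i.eval inp σ) (e.eval inp σ)) := by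
  constructor
  · rintro ⟨k, σ', h, hQ⟩; cases h; exact hQ
  · exact fun h => ⟨_, _, .store .., h⟩

@[simp] theorem wp_seq {c d : Cmd} :
    wp inp (.seq c d) σ Q ↔ wp inp c σ fun k σ' => wp inp d σ' fun m σ'' => Q (k + m) σ'' := by
  constructor
  · rintro ⟨k, σ', h, hQ⟩
    cases h with
    | seq h1 h2 => exact ⟨_, _, h1, _, _, h2, hQ⟩
  · rintro ⟨_, _, h1, _, _, h2, hQ⟩
    exact ⟨_, _, .seq h1 h2, hQ⟩

theorem wp_ite {e : Expr} {c d : Cmd} :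
    wp inp (.ite e c d) σ Q ↔
      (e.eval inp σ ≠ 0 → wp inp c σ fun k => Q (k + (e.cost + 1))) ∧
      (e.eval inp σ = 0 → wp inp d σ fun k => Q (k + (e.cost + 1))) := by
  constructor
  · rintro ⟨k, σ', h, hQ⟩
    cases h with
    | ite_true h1 h2 => exact ⟨fun _ => ⟨_, _, h2, hQ⟩, fun h => absurd h h1⟩
    | ite_false h1 h2 => exact ⟨fun h => absurd h1 h, fun _ => ⟨_, _, h2, hQ⟩⟩
  · rintro ⟨h1, h2⟩
    by_cases h : e.eval inp σ = 0
    · obtain ⟨_, _, h3, h4⟩ := h2 h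
      exact ⟨_, _, .ite_false h h3, h4⟩
    · obtain ⟨_, _, h3, h4⟩ := h1 h
      exact ⟨_, _, .ite_true h h3, h4⟩

/-- Loops with an invariant and a potential that pays for the iterations. -/
theorem wp_loop {e : Expr} {c : Cmd} (I : ℕ → St → Prop) (B : ℕ) (hI : I B σ)
    (hstep : ∀ B σ', I B σ' → e.eval inp σ' ≠ 0 →
      wp inp c σ' fun k σ'' => ∃ B', k + (e.cost + 1) + B' ≤ B ∧ I B' σ'')
    (hQ : ∀ k B' σ', k + B' ≤ B + (e.cost + 1) → I B' σ' → e.eval inp σ' = 0 → Q k σ') :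
    wp inp (.loop e c) σ Q := by
  -- Every iteration lowers the potential by at least the positive cost of the guard, so the
  -- potential also proves termination.
  induction B using Nat.strong_induction_on generalizing σ Q with
  | _ B ih =>
    by_cases h : e.eval inp σ = 0
    · exact ⟨_, _, .loop_done h, hQ _ B _ (by omega) hI h⟩
    · obtain ⟨k, σ', h1, B', h2, h3⟩ := hstep B σ hI h
      obtain ⟨m, σ'', g1, g2⟩ := ih B' (by omega) (σ := σ')
        (Q := fun m σ'' => Q (k + m + (e.cost + 1)) σ'') h3
        (fun m B'' σ'' hm hI' he => hQ _ B'' _ (by omega) hI' he)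
      exact ⟨_, _, .loop_step h h1 g1, g2⟩

end wp

/-! #### Frames -/

/-- The variables that a command may change. -/
def Cmd.modV : Cmd → List Var
  | .skip => []
  | .assign x _ => [x]
  | .store _ _ _ => []
  | .seq c d => c.modV ++ d.modV
  | .ite _ c d => c.modV ++ d.modV
  | .loop _ c => c.modV

/-- The arrays that a command may change. -/
def Cmd.modA : Cmd → List Arr
  | .skip => []
  | .assign _ _ => []
  | .store A _ _ => [A]
  | .seq c d => c.modA ++ d.modA
  | .ite _ c d => c.modA ++ d.modA
  | .loop _ c => c.modA

/-- `σ'` agrees with `σ` but for the variables in `V` and the arrays in `A`. -/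
structure Frame (V : List Var) (A : List Arr) (σ σ' : St) : Prop where
  v : ∀ x, x ∉ V → σ'.v x = σ.v x
  a : ∀ B, B ∉ A → σ'.a B = σ.a B

theorem Frame.refl (V : List Var) (A : List Arr) (σ : St) : Frame V A σ σ :=
  ⟨fun _ _ => rfl, fun _ _ => rfl⟩

theorem Frame.trans {V : List Var} {A : List Arr} {σ σ' σ'' : St} (h : Frame V A σ σ')
    (h' : Frame V A σ' σ'') : Frame V A σ σ'' :=
  ⟨fun x hx => (h'.v x hx).trans (h.v x hx), fun x hx => (h'.a x hx).trans (h.a x hx)⟩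

theorem Frame.mono {V V' : List Var} {A A' : List Arr} {σ σ' : St} (h : Frame V A σ σ')
    (hV : V ⊆ V') (hA : A ⊆ A') : Frame V' A' σ σ' :=
  ⟨fun x hx => h.v x fun h => hx (hV h), fun x hx => h.a x fun h => hx (hA h)⟩

theorem Frame.setV {V : List Var} {A : List Arr} {σ σ' : St} (h : Frame V A σ σ') {x : Var}
    (hx : x ∈ V) (c : ℕ) : Frame V A σ (σ'.setV x c) := by
  refine ⟨fun y hy => ?_, h.a⟩
  have : y ≠ x := fun e => hy (e ▸ hx)
  simp [this, h.v y hy]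

theorem CExec.frame {inp : ℕ → ℕ} {c : Cmd} {σ σ' : St} {k : ℕ} (h : CExec inp c σ k σ') :
    Frame c.modV c.modA σ σ' := by
  induction h with
  | skip σ => exact .refl ..
  | assign x e σ =>
    refine ⟨fun y hy => ?_, fun _ _ => rfl⟩
    have : y ≠ x := by simpa [Cmd.modV] using hy
    simp [this]
  | store A i e σ =>
    refine ⟨fun y hy => rfl, fun B hB => ?_⟩
    have : B ≠ A := by simpa [Cmd.modA] using hB
    simp [this]
  | seq _ _ ih1 ih2 =>
    exact (ih1.mono (by simp [Cmd.modV]) (by simp [Cmd.modA])).trans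
      (ih2.mono (by simp [Cmd.modV]) (by simp [Cmd.modA]))
  | ite_true _ _ ih => exact ih.mono (by simp [Cmd.modV]) (by simp [Cmd.modA])
  | ite_false _ _ ih => exact ih.mono (by simp [Cmd.modV]) (by simp [Cmd.modA])
  | loop_done => exact .refl ..
  | loop_step _ _ _ ih1 ih2 => exact ih1.trans ih2

theorem wp.frame {inp : ℕ → ℕ} {c : Cmd} {σ : St} {Q : ℕ → St → Prop} (h : wp inp c σ Q) :
    wp inp c σ fun k σ' => Q k σ' ∧ Frame c.modV c.modA σ σ' := by
  obtain ⟨k, σ', h1, h2⟩ := h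
  exact ⟨k, σ', h1, h2, h1.frame⟩

/-! #### Bounded loops -/

/-- `for i < e do c`; the command `c` must change neither `i` nor the value of `e`. -/
def Cmd.for (i : Var) (e : Expr) (c : Cmd) : Cmd :=
  .seq (.assign i 0) (.loop (.lt i e) (.seq c (.assign i (i + 1))))

/-- `T j` is the budget for the first `j` bodies together, so single iterations may be expensive.
The overhead per iteration is `e.cost + 3` for the test and 4 for the increment; the last test and
the initialization give the final `e.cost + 5`. -/
theorem wp_for_amortized {inp : ℕ → ℕ} {i : Var} {e : Expr} {c : Cmd} {σ : St}
    {Q : ℕ → St → Prop} (N : ℕ) (V : List Var) (A : List Arr) (T : ℕ → ℕ) (I : ℕ → St → Prop)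
    (hV : c.modV ⊆ V) (hA : c.modA ⊆ A) (hi : i ∉ c.modV)
    (hev : ∀ x ∈ e.vars, x ∉ i :: V) (hea : ∀ x ∈ e.arrs, x ∉ A) (hN : e.eval inp σ = N)
    (h0 : I 0 (σ.setV i 0))
    (hstep : ∀ j < N, ∀ σ', Frame (i :: V) A σ σ' → σ'.v i = j → I j σ' →
      wp inp c σ' fun k σ'' => T j + k ≤ T (j + 1) ∧ I (j + 1) (σ''.setV i (j + 1)))
    (hQ : ∀ k σ', Frame (i :: V) A σ σ' → σ'.v i = N → I N σ' →
      k ≤ T N + N * (e.cost + 7) + e.cost + 5 → Q k σ') :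
    wp inp (.for i e c) σ Q := by
  have heval : ∀ σ', Frame (i :: V) A σ σ' → e.eval inp σ' = N := fun σ' h =>
    (Expr.eval_congr (fun x hx => h.v x (hev x hx)) (fun x hx => h.a x (hea x hx))).trans hN
  have mono : ∀ j ≤ N, ∀ σ', Frame (i :: V) A σ σ' → σ'.v i = j → I j σ' →
      ∃ T' : ℕ, T j + T' ≤ T N ∧ wp inp (.loop (.lt i e) (.seq c (.assign i (i + 1)))) σ'
        fun k σ'' => Frame (i :: V) A σ σ'' ∧ σ''.v i = N ∧ I N σ'' ∧
          k ≤ T' + (N - j) * (e.cost + 7) + e.cost + 3 := by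
    intro j hj
    induction hd : N - j generalizing j with
    | zero =>
      intro σ' hF hv hI
      obtain rfl : j = N := by omega
      refine ⟨0, by omega, _, _, .loop_done ?_, hF, hv, hI, ?_⟩
      · rw [Expr.eval_lt, heval σ' hF, Expr.eval_var, hv]
      · simp only [Expr.cost_lt, Expr.cost_var]; omega
    | succ d ih =>
      intro σ' hF hv hI
      obtain ⟨k, σ₁, h1, h2, h3⟩ := hstep j (by omega) σ' hF hv hI
      have hF1 : Frame (i :: V) A σ σ₁ :=
        hF.trans (h1.frame.mono (fun x hx => List.mem_cons_of_mem _ (hV hx)) hA)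
      have hv1 : σ₁.v i = j := (h1.frame.v i hi).trans hv
      obtain ⟨T', hT, m, σ₂, g1, g2, g3, g4, g5⟩ := ih (j + 1) (by omega) (by omega)
        (σ₁.setV i (j + 1)) (hF1.setV (by simp) _) (by simp) h3
      have g1' : CExec inp (.loop (.lt i e) (.seq c (.assign i (i + 1))))
          (σ₁.setV i ((i + 1 : Expr).eval inp σ₁)) m σ₂ := by simpa [hv1] using g1
      refine ⟨k + T', by omega, _, _, .loop_step ?_ (.seq h1 (.assign i (i + 1) σ₁)) g1',
        g2, g3, g4, ?_⟩
      · rw [ne_eq, Expr.eval_lt, heval σ' hF, Expr.eval_var, hv]; omega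
      · simp only [Expr.cost_lt, Expr.cost_var, Expr.cost_add, Expr.cost_ofNat, add_mul, one_mul]
        omega
  obtain ⟨T', hT, k, σ', h1, h2, h3, h4, h5⟩ :=
    mono 0 (Nat.zero_le _) (σ.setV i 0) ((Frame.refl ..).setV (by simp) _) (by simp) h0
  refine ⟨_, _, .seq (.assign i 0 σ) h1, hQ _ _ h2 h3 h4 ?_⟩
  simp only [Expr.cost_ofNat, Nat.sub_zero] at h5 ⊢
  omega

/-- The lists `V` and `A` need only contain what the body changes. This is required for bodies that
interpret an unknown program, whose set of changed variables is known only up to inclusion. -/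
theorem wp_for_frame {inp : ℕ → ℕ} {i : Var} {e : Expr} {c : Cmd} {σ : St}
    {Q : ℕ → St → Prop} (N : ℕ) (V : List Var) (A : List Arr) (T : ℕ) (I : ℕ → St → Prop)
    (hV : c.modV ⊆ V) (hA : c.modA ⊆ A) (hi : i ∉ c.modV)
    (hev : ∀ x ∈ e.vars, x ∉ i :: V) (hea : ∀ x ∈ e.arrs, x ∉ A) (hN : e.eval inp σ = N)
    (h0 : I 0 (σ.setV i 0))
    (hstep : ∀ j < N, ∀ σ', Frame (i :: V) A σ σ' → σ'.v i = j → I j σ' →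
      wp inp c σ' fun k σ'' => k ≤ T ∧ I (j + 1) (σ''.setV i (j + 1)))
    (hQ : ∀ k σ', Frame (i :: V) A σ σ' → σ'.v i = N → I N σ' →
      k ≤ N * (T + e.cost + 7) + e.cost + 5 → Q k σ') :
    wp inp (.for i e c) σ Q := by
  refine wp_for_amortized N V A (fun j => j * T) I hV hA hi hev hea hN h0
    (fun j hj σ' hF hv hI => (hstep j hj σ' hF hv hI).mono fun k σ'' h => ⟨?_, h.2⟩)
    (fun k σ' hF hv hI hk => hQ k σ' hF hv hI (hk.trans (le_of_eq ?_)))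
  · have := h.1; rw [add_mul, one_mul]; omega
  · ring

theorem wp_for {inp : ℕ → ℕ} {i : Var} {e : Expr} {c : Cmd} {σ : St}
    {Q : ℕ → St → Prop} (N : ℕ) (T : ℕ) (I : ℕ → St → Prop) (hi : i ∉ c.modV)
    (hev : ∀ x ∈ e.vars, x ∉ i :: c.modV) (hea : ∀ x ∈ e.arrs, x ∉ c.modA)
    (hN : e.eval inp σ = N) (h0 : I 0 (σ.setV i 0))
    (hstep : ∀ j < N, ∀ σ', Frame (i :: c.modV) c.modA σ σ' → σ'.v i = j → I j σ' →
      wp inp c σ' fun k σ'' => k ≤ T ∧ I (j + 1) (σ''.setV i (j + 1)))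
    (hQ : ∀ k σ', Frame (i :: c.modV) c.modA σ σ' → σ'.v i = N → I N σ' →
      k ≤ N * (T + e.cost + 7) + e.cost + 5 → Q k σ') :
    wp inp (.for i e c) σ Q :=
  wp_for_frame N _ _ T I (List.Subset.refl _) (List.Subset.refl _) hi hev hea hN h0 hstep hQ

end While

namespace While

infixr:50 " ;; " => Cmd.seq
infix:60 " ≔ " => Cmd.assign

open While.Expr (var lt ne get cond)

/-! ### Arithmetic subroutines -/

/-- A nested loop raises the degree of a polynomial time bound by one. -/
theorem for_time {N T c d X j : ℕ} (hN : N ≤ X) (hT : T ≤ c * X ^ j) (hX : 1 ≤ X) :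
    N * (T + d + 7) + d + 5 ≤ (c + 2 * d + 12) * X ^ (j + 1) := by
  have h1 : 1 ≤ X ^ j := Nat.one_le_pow _ _ hX
  have h2 : N * (T + d + 7) ≤ X * ((c + d + 7) * X ^ j) :=
    Nat.mul_le_mul hN (by rw [add_mul, add_mul]; nlinarith)
  have h3 : X * ((c + d + 7) * X ^ j) = (c + d + 7) * X ^ (j + 1) := by ring
  have h4 : 1 ≤ X ^ (j + 1) := Nat.one_le_pow _ _ hX
  have h5 : (c + 2 * d + 12) * X ^ (j + 1) = (c + d + 7) * X ^ (j + 1) + (d + 5) * X ^ (j + 1) := by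
    ring
  nlinarith

/-- `r := x * y` by repeated addition. -/
def mul (r i x y : Var) : Cmd := (r ≔ 0) ;; .for i (var y) (r ≔ var r + var x)

theorem mul_spec {inp : ℕ → ℕ} {σ : St} {r i x y : Var} (h : [r, i, x, y].Nodup) :
    wp inp (mul r i x y) σ fun k σ' => k ≤ 12 * σ.v y + 8 ∧ σ'.v r = σ.v x * σ.v y := by
  simp only [List.nodup_cons, List.mem_cons, List.not_mem_nil, or_false, not_or] at h
  obtain ⟨⟨h1, h2, h3⟩, ⟨h4, h5⟩, h6, -⟩ := h
  rw [mul, wp_seq, wp_assign]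
  refine wp_for (σ.v y) 4 (fun j σ' => σ'.v r = σ.v x * j) ?_ ?_ ?_ ?_ ?_ ?_ ?_
  · simpa [Cmd.modV] using Ne.symm h1
  · simpa [Cmd.modV, Expr.vars] using ⟨Ne.symm h5, Ne.symm h3⟩
  · simp [Expr.arrs]
  · simp [Ne.symm h3]
  · simp [h1]
  · intro j hj σ' hF hv hI
    have hx := hF.v x (by simpa [Cmd.modV] using ⟨Ne.symm h4, Ne.symm h2⟩)
    simp [h1, hI, hx, Ne.symm h2, mul_add]
  · intro k σ' hF hv hI hk
    refine ⟨?_, hI⟩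
    simp at hk ⊢
    omega

/-- `isP := 1` if `q` is prime, and `isP := 0` otherwise. -/
def primeTest : Cmd :=
  (.isP ≔ 1) ;; .for .i (var .q) (.for .j (var .q)
    (mul .x .k .i .j ;; .ite (ne (var .x) (var .q)) .skip (.isP ≔ 0)))

theorem prime_iff_forall_mul_ne {q : ℕ} (h : 2 ≤ q) :
    q.Prime ↔ ∀ i < q, ∀ j < q, i * j ≠ q := by
  constructor
  · intro hq i hi j hj e
    rcases (Nat.dvd_prime hq).1 (Dvd.intro _ e) with rfl | rfl
    · omega
    · exact lt_irrefl _ hi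
  · intro H
    by_contra hq
    obtain ⟨m, ⟨k, hk⟩, h2, h3⟩ := (Nat.not_prime_iff_exists_dvd_lt h).1 hq
    refine H m h3 k ?_ hk.symm
    rw [hk]
    have : 0 < k := by
      rcases Nat.eq_zero_or_pos k with rfl | h
      · omega
      · exact h
    nlinarith

theorem primeTest_spec {inp : ℕ → ℕ} {σ : St} (h2 : 2 ≤ σ.v .q) :
    wp inp primeTest σ fun k σ' => k ≤ 100 * (σ.v .q + 1) ^ 3 ∧
      (σ'.v .isP ≠ 0 ↔ (σ.v .q).Prime) := by
  rw [primeTest, wp_seq, wp_assign]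
  set X := σ.v .q + 1 with hX
  refine wp_for (σ.v .q) (46 * X ^ 2)
    (fun i σ' => (¬ σ'.v .isP = 0 ↔ ∀ i' < i, ∀ j < σ.v .q, ¬ i' * j = σ.v .q))
    (by decide) (by decide) (by decide) (by simp) (by simp) ?_ ?_
  · intro i hi σ' hF hv hI
    have hq := hF.v .q (by decide)
    simp at hq
    refine wp_for (σ.v .q) (32 * X ^ 1)
      (fun j σ'' => (¬ σ''.v .isP = 0 ↔ (∀ i' < i, ∀ j < σ.v .q, ¬ i' * j = σ.v .q) ∧
        ∀ j' < j, ¬ i * j' = σ.v .q))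
      (by decide) (by decide) (by decide) (by simp [hq]) (by simpa using hI)
      ?_ ?_
    · intro j hj σ₁ hF₁ hv₁ hI₁
      have hq₁ := hF₁.v .q (by decide)
      have hi₁ := hF₁.v .i (by decide)
      refine wp_seq.2 ((mul_spec (by decide)).frame.mono ?_)
      rintro k σ₂ ⟨⟨hk, hx⟩, hF₂⟩
      have hq₂ := hF₂.v .q (by decide)
      have hp₂ := hF₂.v .isP (by decide)
      simp only [wp_ite, wp_skip, wp_assign, ne_eq, Expr.eval_ne, Expr.eval_var, Expr.cost_ne,
        Expr.cost_var, Expr.cost_ofNat, Expr.eval_ofNat, hq₂, hq₁, hq, hx, hi₁, hv, hv₁, hp₂,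
        pow_one] at hk ⊢
      refine ⟨fun hne => ⟨by omega, ?_⟩, fun he => ⟨by omega, ?_⟩⟩
      · simp only [St.setV_v, reduceCtorEq, if_false, hp₂, hI₁]
        rw [Nat.forall_lt_succ_right]
        tauto
      · simp only [St.setV_v, reduceCtorEq, if_false, if_true]
        rw [Nat.forall_lt_succ_right]
        tauto
    · intro k σ₁ hF₁ hv₁ hI₁ hk
      refine ⟨hk.trans ((for_time (c := 32) (by omega) le_rfl (by omega)).trans (by simp)), ?_⟩
      simp only [St.setV_v, reduceCtorEq, if_false, hI₁]
      rw [Nat.forall_lt_succ_right]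
  · intro k σ' hF hv hI hk
    have := for_time (N := σ.v .q) (X := X) (c := 46) (d := 1) (j := 2) (by omega) le_rfl (by omega)
    have h1 : 1 ≤ X ^ 3 := Nat.one_le_pow _ _ (by omega)
    simp at hk this ⊢
    refine ⟨by omega, ?_⟩
    rw [prime_iff_forall_mul_ne h2]
    simpa using hI

/-- `r := x ^ e` by repeated multiplication. -/
def pow (r x e : Var) : Cmd := (r ≔ 1) ;; .for .i (var e) (mul .x .k r x ;; (r ≔ var .x))

theorem pow_spec {inp : ℕ → ℕ} {σ : St} {r x e : Var} (h : [r, x, e, .x, .i, .k].Nodup) :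
    wp inp (pow r x e) σ fun k σ' => k ≤ σ.v e * (12 * σ.v x + 20) + 10 ∧
      σ'.v r = σ.v x ^ σ.v e := by
  simp only [List.nodup_cons, List.mem_cons, List.not_mem_nil, or_false, not_or] at h
  obtain ⟨⟨h1, h2, h3, h4, h5⟩, ⟨h6, h7, h8, h9⟩, ⟨h10, h11, h12⟩, -⟩ := h
  rw [pow, wp_seq, wp_assign]
  refine wp_for (σ.v e) (12 * σ.v x + 12) (fun j σ' => σ'.v r = σ.v x ^ j) ?_ ?_ ?_ ?_ ?_ ?_ ?_
  · simp [Cmd.modV, mul, Cmd.for, Ne.symm h4]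
  · simp [Cmd.modV, mul, Cmd.for, Expr.vars, h11, h10, h12, Ne.symm h2]
  · simp [Expr.arrs]
  · simp [Ne.symm h2]
  · simp [h4]
  · intro j hj σ' hF hv hI
    have hx := hF.v x (by simp [Cmd.modV, mul, Cmd.for, h8, h7, h9, Ne.symm h1])
    have hx' : σ'.v x = σ.v x := by simpa [Ne.symm h1] using hx
    rw [wp_seq]
    refine (mul_spec ?_).mono ?_
    · simpa using ⟨⟨Ne.symm h3, Ne.symm h7⟩, ⟨Ne.symm h5, Ne.symm h9⟩, h1⟩
    · rintro k σ₂ ⟨hk, hr⟩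
      simp [h4, hI, hx', hr] at hk ⊢
      exact ⟨by omega, by rw [pow_succ]⟩
  · intro k σ' hF hv hI hk
    refine ⟨?_, hI⟩
    simp at hk ⊢
    have : 12 * σ.v x + 12 + 1 + 7 = 12 * σ.v x + 20 := by ring
    rw [this] at hk
    omega

/-! ### The size of the field -/

/-- The fields `ℤ/q` over which the numbers up to `n` are polynomials of low degree. -/
def GoodField (n m q : ℕ) : Prop := q.Prime ∧ n + 1 < q ^ ((q - 1) / m)

/-- `pw := q ^ ((q - 1) / ll)` -/
def powQuot : Cmd :=
  (.pw ≔ 1) ;; (.y ≔ var .ll) ;;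
  .for .i (var .q) (.ite (lt (var .y) (var .q))
    (mul .x .k .pw .q ;; (.pw ≔ var .x) ;; (.y ≔ var .y + var .ll)) .skip)

theorem powQuot_spec {inp : ℕ → ℕ} {σ : St} (hll : 0 < σ.v .ll) (hq : 0 < σ.v .q) :
    wp inp powQuot σ fun k σ' => k ≤ 80 * (σ.v .q + 1) ^ 2 ∧
      σ'.v .pw = σ.v .q ^ ((σ.v .q - 1) / σ.v .ll) := by
  set m := σ.v .ll with hm
  set q := σ.v .q with hq'
  set D := (q - 1) / m with hD
  have hDm : D * m ≤ q - 1 := Nat.div_mul_le_self _ _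
  have hDm' : q - 1 < (D + 1) * m := by
    rw [hD, add_mul, one_mul]; exact Nat.lt_div_mul_add hll
  rw [powQuot, wp_seq, wp_assign, wp_seq, wp_assign]
  refine wp_for q (32 * (q + 1) ^ 1)
    (fun i σ' => σ'.v .pw = q ^ min i D ∧ σ'.v .y = (min i D + 1) * m)
    (by decide) (by decide) (by decide) (by simp [hq']) (by simp [hm]) ?_ ?_
  · intro i hi σ' hF hv ⟨hI1, hI2⟩
    have e1 := hF.v .q (by decide)
    have e2 := hF.v .ll (by decide)
    simp only [St.setV_v, reduceCtorEq, if_false, ← hq', ← hm] at e1 e2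
    -- `y` runs through the multiples of `m`, and the next multiple is below `q` exactly `D` times,
    -- so the division needs no separate subroutine.
    have hlt : (min i D + 1) * m < q ↔ i < D := by
      constructor
      · intro h
        by_contra h'
        rw [min_eq_right (by omega)] at h
        omega
      · intro h
        rw [min_eq_left h.le]
        have : (i + 1) * m ≤ D * m := Nat.mul_le_mul_right _ h
        omega
    rw [wp_ite]
    simp only [ne_eq, Expr.eval_lt, Expr.eval_var, hI2, e1, not_le, hlt]
    refine ⟨fun h => ?_, fun h => ?_⟩
    · rw [wp_seq]
      refine (mul_spec (by decide)).frame.mono ?_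
      rintro k σ₂ ⟨⟨hk, hx⟩, hF₂⟩
      have e3 := hF₂.v .y (by decide)
      have e4 := hF₂.v .ll (by decide)
      simp only [wp_seq, wp_assign]
      rw [min_eq_left h.le] at hI1 hI2
      rw [min_eq_left (by omega : i + 1 ≤ D)]
      simp [hx, e3, e4, hI1, hI2, e1, e2] at hk ⊢
      exact ⟨by omega, by rw [pow_succ], by ring⟩
    · rw [wp_skip]
      have h' : D ≤ i := by
        by_contra h'
        have := hlt.2 (by omega)
        omega
      rw [min_eq_right h'] at hI1 hI2
      rw [min_eq_right (by omega : D ≤ i + 1)]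
      simp [hI1, hI2]
      omega
  · intro k σ' hF hv ⟨hI1, hI2⟩ hk
    have := for_time (N := q) (X := q + 1) (c := 32) (d := 1) (j := 1) (by omega) le_rfl (by omega)
    have h1 : 1 ≤ (q + 1) ^ 2 := Nat.one_le_pow _ _ (by omega)
    have h2 : D ≤ q := (Nat.div_le_self _ _).trans (by omega)
    rw [min_eq_right h2] at hI1
    simp at hk this ⊢
    exact ⟨by omega, hI1⟩

/-- `q` becomes the size of the smallest good field. -/
def findField : Cmd :=
  (.go ≔ 1) ;; (.q ≔ 1) ;; .loop (var .go) (
    (.q ≔ var .q + 1) ;; primeTest ;;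
    .ite (var .isP) (powQuot ;; .ite (lt (var .n + 1) (var .pw)) (.go ≔ 0) .skip) .skip)

theorem findField_spec {inp : ℕ → ℕ} {σ : St} {q₀ : ℕ} (hll : 0 < σ.v .ll)
    (hq₀ : GoodField (σ.v .n) (σ.v .ll) q₀)
    (hmin : ∀ p, GoodField (σ.v .n) (σ.v .ll) p → q₀ ≤ p) :
    wp inp findField σ fun k σ' => k ≤ 300 * (q₀ + 1) ^ 4 ∧ σ'.v .q = q₀ := by
  rw [findField, wp_seq, wp_assign, wp_seq, wp_assign]
  have h2 : 2 ≤ q₀ := hq₀.1.two_le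
  set X := q₀ + 1 with hX
  have hX3 : 1 ≤ X ^ 3 := Nat.one_le_pow _ _ (by omega)
  -- The potential is the number of candidates left below the least good field times the cost of
  -- testing one.
  refine wp_loop (fun B σ' => σ'.v .n = σ.v .n ∧ σ'.v .ll = σ.v .ll ∧
      ((σ'.v .go ≠ 0 ∧ 1 ≤ σ'.v .q ∧ σ'.v .q < q₀ ∧ B = (q₀ - σ'.v .q) * (250 * X ^ 3)) ∨
        (σ'.v .go = 0 ∧ σ'.v .q = q₀)))
    ((q₀ - 1) * (250 * X ^ 3)) ?_ ?_ ?_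
  · simp; omega
  · rintro B σ' ⟨hn, hm, h | h⟩ he
    · obtain ⟨hgo, hq1, hq2, hB⟩ := h
      rw [wp_seq, wp_assign, wp_seq]
      refine (primeTest_spec (by simp; omega)).frame.mono ?_
      rintro k₁ σ₁ ⟨⟨hk₁, hP⟩, hF₁⟩
      have e1 := hF₁.v .q (by decide)
      have e2 := hF₁.v .n (by decide)
      have e3 := hF₁.v .ll (by decide)
      have e4 := hF₁.v .go (by decide)
      simp at e1 e2 e3 e4 hk₁ hP
      have t1 : (σ'.v .q + 1 + 1) ^ 3 ≤ X ^ 3 := Nat.pow_le_pow_left (by omega) _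
      have t2 : (q₀ - σ'.v .q) * (250 * X ^ 3) =
          (q₀ - (σ'.v .q + 1)) * (250 * X ^ 3) + 250 * X ^ 3 := by
        rw [show q₀ - σ'.v .q = q₀ - (σ'.v .q + 1) + 1 by omega, add_mul, one_mul]
      have next : ∀ (τ : St) (T : ℕ), T ≤ 240 * X ^ 3 → τ.v .n = σ.v .n → τ.v .ll = σ.v .ll →
          τ.v .q = σ'.v .q + 1 → τ.v .go ≠ 0 → ¬ GoodField (σ.v .n) (σ.v .ll) (σ'.v .q + 1) →
          ∃ B', T + ((var .go).cost + 1) + B' ≤ B ∧ (τ.v .n = σ.v .n ∧ τ.v .ll = σ.v .ll ∧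
            ((τ.v .go ≠ 0 ∧ 1 ≤ τ.v .q ∧ τ.v .q < q₀ ∧ B' = (q₀ - τ.v .q) * (250 * X ^ 3)) ∨
            (τ.v .go = 0 ∧ τ.v .q = q₀))) := by
        intro τ T hT a1 a2 a3 a4 a5
        refine ⟨(q₀ - τ.v .q) * (250 * X ^ 3), ?_, a1, a2, .inl ⟨a4, by omega, ?_, rfl⟩⟩
        · simp only [Expr.cost_var]; rw [a3]; omega
        · refine lt_of_le_of_ne (by omega) fun e => a5 ?_
          rw [← a3, e]; exact hq₀
      rw [wp_ite]
      refine ⟨fun hp => ?_, fun hp => ?_⟩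
      · simp only [Expr.eval_var, hP, ne_eq] at hp
        rw [wp_seq]
        refine (powQuot_spec (by omega) (by omega)).frame.mono ?_
        rintro k₂ σ₂ ⟨⟨hk₂, hpw⟩, hF₂⟩
        have f1 := hF₂.v .q (by decide)
        have f2 := hF₂.v .n (by decide)
        have f3 := hF₂.v .ll (by decide)
        have f4 := hF₂.v .go (by decide)
        rw [e1, e3, hm] at hpw
        have t3 : (σ₁.v .q + 1) ^ 2 ≤ X ^ 3 := by
          rw [e1]
          exact (Nat.pow_le_pow_left (by omega) 2).trans
            (Nat.pow_le_pow_right (by omega) (by omega))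
        rw [wp_ite]
        refine ⟨fun hg => ?_, fun hg => ?_⟩ <;>
          simp only [ne_eq, Expr.eval_lt, Expr.eval_add, Expr.eval_var, Expr.eval_ofNat, hpw, f2,
            e2, hn, not_le] at hg
        · rw [wp_assign]
          refine ⟨0, ?_, ?_⟩
          · simp; omega
          have hgood : GoodField (σ.v .n) (σ.v .ll) (σ'.v .q + 1) := ⟨hp, hg⟩
          have := hmin _ hgood
          simp [f1, f2, f3, e1, e2, e3, hn, hm]
          omega
        · rw [wp_skip]
          refine next _ _ ?_ (f2.trans (e2.trans hn)) (f3.trans (e3.trans hm)) (f1.trans e1)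
            (by rwa [f4, e4]) ?_
          · simp; omega
          rintro ⟨-, hg'⟩
          omega
      · simp only [Expr.eval_var] at hp
        rw [wp_skip]
        refine next _ _ ?_ (e2.trans hn) (e3.trans hm) e1 (by rwa [e4]) ?_
        · simp; omega
        rintro ⟨hg', -⟩
        exact hP.2 hg' hp
    · exact absurd h.1 he
  · rintro k B' σ' hk ⟨-, -, h | h⟩ he
    · exact absurd he h.1
    · refine ⟨?_, h.2⟩
      have : (q₀ - 1) * (250 * X ^ 3) ≤ X * (250 * X ^ 3) := Nat.mul_le_mul_right _ (by omega)
      have h5 : X * (250 * X ^ 3) = 250 * X ^ 4 := by ring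
      have h6 : 1 ≤ X ^ 4 := Nat.one_le_pow _ _ (by omega)
      simp at hk ⊢
      omega

end While

/-! ### Clusters -/

section Cluster

variable {n : ℕ} {G : SimpleGraph (Fin n)}

theorem adj_trans_of_mem_clusterGraphs (hG : G ∈ clusterGraphs n) {u v w : Fin n}
    (h1 : u = v ∨ G.Adj u v) (h2 : v = w ∨ G.Adj v w) : u = w ∨ G.Adj u w := by
  rcases h1 with rfl | h1
  · exact h2
  rcases h2 with rfl | h2
  · exact .inr h1
  by_cases h : u = w
  · exact .inl h
  · exact .inr (hG u w (h1.reachable.trans h2.reachable) h)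

open Classical in
/-- The smallest vertex of the closed neighborhood of `u`. -/
noncomputable def clusterRep (G : SimpleGraph (Fin n)) (u : Fin n) : Fin n :=
  (Finset.univ.filter fun w => w = u ∨ G.Adj w u).min' ⟨u, by simp⟩

theorem clusterRep_adj (G : SimpleGraph (Fin n)) (u : Fin n) :
    clusterRep G u = u ∨ G.Adj (clusterRep G u) u := by
  classical
  exact (Finset.mem_filter.1
    (Finset.min'_mem (Finset.univ.filter fun w => w = u ∨ G.Adj w u) ⟨u, by simp⟩)).2

theorem clusterRep_le {u w : Fin n} (h : w = u ∨ G.Adj w u) : clusterRep G u ≤ w := by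
  classical
  exact Finset.min'_le _ _ (by simpa using h)

/-- In a cluster graph, being equal or adjacent is an equivalence relation, and the representative
is the least element of the class. -/
theorem clusterRep_eq_iff (hG : G ∈ clusterGraphs n) {u v : Fin n} :
    clusterRep G u = clusterRep G v ↔ u = v ∨ G.Adj u v := by
  have key : ∀ {a b : Fin n}, a = b ∨ G.Adj a b → clusterRep G b ≤ clusterRep G a := fun h =>
    clusterRep_le (adj_trans_of_mem_clusterGraphs hG (clusterRep_adj G _) h)
  have symm : ∀ {a b : Fin n}, a = b ∨ G.Adj a b → b = a ∨ G.Adj b a := fun h =>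
    h.imp Eq.symm SimpleGraph.Adj.symm
  constructor
  · intro h
    have h1 := clusterRep_adj G u
    rw [h] at h1
    exact adj_trans_of_mem_clusterGraphs hG (symm h1) (clusterRep_adj G v)
  · exact fun h => le_antisymm (key (symm h)) (key h)

theorem clusterRep_clusterRep (hG : G ∈ clusterGraphs n) (u : Fin n) :
    clusterRep G (clusterRep G u) = clusterRep G u :=
  (clusterRep_eq_iff hG).2 (clusterRep_adj G u)

end Cluster

namespace While

open While.Expr (var lt ne get cond)

/-- `cid[v]` becomes one plus the smallest vertex of the cluster of `v`. -/
def clusters : Cmd :=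
  .for .v (var .n) (.ite (get .cid (var .v)) .skip (
    (.x ≔ .inp (var .n + 2 + var .v)) ;; (.y ≔ .inp (var .n + 2 + var .v + 1) - var .x) ;;
    (.x ≔ var .x + var .n + var .n + 3) ;; .store .cid (var .v) (var .v + 1) ;;
    .for .j (var .y) (.store .cid (.inp (var .x + var .j)) (var .v + 1))))

/-- The time is linear in `n` and not in the length of the input: the only list read in a cluster is
that of its smallest vertex, since the other vertices are already marked when they are reached.
Adding one keeps the mark nonzero. -/
theorem clusters_spec {inp : ℕ → ℕ} {σ : St} {n : ℕ} {G : SimpleGraph (Fin n)} (L : AdjLists G)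
    (hG : G ∈ clusterGraphs n) (hn : σ.v .n = n) (h0 : ∀ i, σ.a .cid i = 0)
    (hlen : ∀ v : Fin n, inp (n + 2 + v + 1) - inp (n + 2 + v) = (L.nbrs v).length)
    (hnbr : ∀ v : Fin n, ∀ j (h : j < (L.nbrs v).length),
      inp (inp (n + 2 + v) + n + n + 3 + j) = (L.nbrs v)[j]) :
    wp inp clusters σ fun k σ' => k ≤ 300 * (n + 1) ∧
      ∀ u : Fin n, σ'.a .cid u = (clusterRep G u : ℕ) + 1 := by
  classical
  have hcard : ∀ i, (Finset.univ.filter fun u => (clusterRep G u : ℕ) < i).card ≤ n := fun i =>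
    (Finset.card_le_univ _).trans (by simp)
  refine wp_for_amortized n _ _
    -- Each vertex pays once for its own visit and once when the representative of its cluster is
    -- visited.
    (fun i => 100 * i + 100 * (Finset.univ.filter fun u => (clusterRep G u : ℕ) < i).card)
    (fun i σ' => ∀ u : Fin n,
      σ'.a .cid u = if (clusterRep G u : ℕ) < i then (clusterRep G u : ℕ) + 1 else 0)
    (List.Subset.refl _) (List.Subset.refl _) (by decide) (by decide) (by decide) (by simp [hn])
    (by simp [h0]) ?_ ?_
  · intro i hi σ' hF hv hI
    have en := hF.v .n (by decide)
    simp only [St.setV_v, reduceCtorEq, if_false, hn] at en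
    have hsplit : (Finset.univ.filter fun u => (clusterRep G u : ℕ) < i + 1).card =
        (Finset.univ.filter fun u => (clusterRep G u : ℕ) < i).card +
        (Finset.univ.filter fun u => (clusterRep G u : ℕ) = i).card := by
      rw [← Finset.card_union_of_disjoint]
      · congr 1; ext u; simp; omega
      · rw [Finset.disjoint_filter]; intro u _ h; omega
    set v : Fin n := ⟨i, hi⟩ with hvdef
    have hIv := hI v
    rw [wp_ite]
    simp only [Expr.eval_get, Expr.eval_var, hv]
    refine ⟨fun h => ?_, fun h => ?_⟩
    · have hlt : (clusterRep G v : ℕ) < i := by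
        by_contra h'
        rw [if_neg h'] at hIv
        exact h hIv
      have hne : ∀ u : Fin n, (clusterRep G u : ℕ) ≠ i := by
        intro u hu
        have hu' : clusterRep G u = v := Fin.ext hu
        have := clusterRep_clusterRep hG u
        rw [hu'] at this
        rw [this] at hlt
        exact lt_irrefl _ hlt
      rw [wp_skip]
      refine ⟨by rw [hsplit]; simp; omega, fun u => ?_⟩
      have := hne u
      simp only [St.setV_a, hI u]
      congr 1
      simp only [eq_iff_iff]; omega
    · have hge : clusterRep G v = v := by
        refine le_antisymm (clusterRep_le (.inl rfl)) ?_
        by_contra h'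
        have h' : (clusterRep G v : ℕ) < i := by simpa [hvdef, Fin.lt_def] using h'
        rw [if_pos h'] at hIv
        rw [show σ'.a .cid i = σ'.a .cid v from rfl] at h
        omega
      have hiff : ∀ u : Fin n, (clusterRep G u : ℕ) = i ↔ u = v ∨ u ∈ L.nbrs v := by
        intro u
        rw [L.mem_iff, show (clusterRep G u : ℕ) = i ↔ clusterRep G u = clusterRep G v by
          rw [hge, hvdef, Fin.ext_iff], clusterRep_eq_iff hG, G.adj_comm]
      have hfib : (Finset.univ.filter fun u => (clusterRep G u : ℕ) = i).card =
          (L.nbrs v).length + 1 := by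
        have : (Finset.univ.filter fun u => (clusterRep G u : ℕ) = i) =
            insert v (L.nbrs v).toFinset := by
          ext u; simp [hiff]
        rw [this, Finset.card_insert_of_notMem, List.toFinset_card_of_nodup (L.nodup v)]
        rw [List.mem_toFinset, L.mem_iff]
        exact G.irrefl
      have hl := hlen v
      have hb := hnbr v
      simp only [hvdef] at hl hb
      simp only [wp_seq, wp_assign, wp_store]
      refine wp_for (L.nbrs v).length 20
        (fun j σ'' => ∀ u : Fin n, σ''.a .cid u =
          if u = v ∨ u ∈ (L.nbrs v).take j then i + 1 else σ'.a .cid u)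
        (by decide) (by decide) (by decide) ?_ ?_ ?_ ?_
      · simpa [en, hv] using hl
      · intro u
        simp [hv, hvdef, Fin.ext_iff]
      · intro j hj σ₂ hF₂ hv₂ hI₂ 
        have f1 := hF₂.v .x (by decide)
        have f2 := hF₂.v .v (by decide)
        simp only [St.setV_v, St.setA_v, reduceCtorEq, if_false, if_true, hv, en, Expr.eval_add,
          Expr.eval_var, Expr.eval_ofNat, Expr.eval_inp] at f1 f2
        rw [wp_store]
        refine ⟨by simp, fun u => ?_⟩
        simp only [Expr.eval_add, Expr.eval_var, Expr.eval_ofNat, Expr.eval_inp, St.setV_a,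
          St.setA_a_same, f1, f2, hv₂]
        rw [hb j hj, hI₂ u, List.take_add_one, List.getElem?_eq_getElem hj]
        simp only [Option.toList_some, List.mem_append, List.mem_singleton, ← Fin.ext_iff]
        by_cases h1 : u = (L.nbrs ⟨i, hi⟩)[j] <;> by_cases h2 : u = ⟨i, hi⟩ ∨ u ∈ (L.nbrs ⟨i, hi⟩).take j
        all_goals simp only [h1, h2, if_true, if_false, or_true, ← or_assoc]
        all_goals simp_all
      · intro k σ₂ hF₂ hv₂ hI₂ hk
        refine ⟨?_, fun u => ?_⟩
        · rw [hsplit, hfib]; simp at hk ⊢; omega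
        · rw [List.take_length] at hI₂
          simp only [St.setV_a, hI₂ u, ← hiff, hI u]
          by_cases h1 : (clusterRep G u : ℕ) = i
          · rw [if_pos h1, if_pos (by omega), h1]
          · rw [if_neg h1]; congr 1; simp only [eq_iff_iff]; omega
  · intro k σ' hF hv hI hk
    have := hcard n
    simp at hk
    refine ⟨by omega, fun u => ?_⟩
    rw [hI u, if_pos (clusterRep G u).2]

end While

namespace While

open While.Expr (var lt ne get cond)

/-! ### The parameters of the hash family -/

/-- The number of vertices, the size bound, the size of the field and the number of large blocks
of colors. -/
structure Params where
  n : ℕ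
  l : ℕ
  q : ℕ
  s : ℕ

namespace Params

variable (p : Params)

/-- The number of colors of a large block. -/
def b : ℕ := p.l / p.s

/-- The number of blocks of one color. -/
def r : ℕ := p.l % p.s

/-- The number of thresholds that separate the blocks. -/
def J : ℕ := p.s + p.r - 1

/-- The number of polynomials of degree less than `b`. -/
def Q : ℕ := p.q ^ p.b

/-- The number of large blocks that is chosen for given `n`, `l` and `q`. -/
def numBlocks (n l q : ℕ) : ℕ := if q ^ (16 * l) ≤ n then 1 else 16 * (Nat.log 2 q + 1)

end Params

/-- The variables and arrays of the state hold the parameters. -/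
structure Holds (p : Params) (σ : St) : Prop where
  n : σ.v .n = p.n
  l : σ.v .l = p.l
  q : σ.v .q = p.q
  s : σ.v .s = p.s
  b : σ.v .b = p.b
  r : σ.v .r = p.r
  J : σ.v .J = p.J
  Q : σ.v .Q = p.Q
  red : ∀ y < p.q, σ.a .red y = y % p.b

theorem Holds.frame {p : Params} {σ σ' : St} (h : Holds p σ) {V : List Var} {A : List Arr}
    (hF : Frame V A σ σ') (hV : ∀ x ∈ [Var.n, .l, .q, .s, .b, .r, .J, .Q], x ∉ V)
    (hA : Arr.red ∉ A) : Holds p σ' := by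
  simp only [List.forall_mem_cons, List.not_mem_nil, false_imp_iff, implies_true, and_true] at hV
  obtain ⟨h1, h2, h3, h4, h5, h6, h7, h8⟩ := hV
  exact ⟨(hF.v _ h1).trans h.n, (hF.v _ h2).trans h.l, (hF.v _ h3).trans h.q,
    (hF.v _ h4).trans h.s, (hF.v _ h5).trans h.b, (hF.v _ h6).trans h.r, (hF.v _ h7).trans h.J,
    (hF.v _ h8).trans h.Q, fun y hy => by rw [hF.a _ hA]; exact h.red y hy⟩

theorem Holds.setV {p : Params} {σ : St} (h : Holds p σ) {x : Var}
    (hx : ∀ y ∈ [Var.n, .l, .q, .s, .b, .r, .J, .Q], y ∉ [x]) (c : ℕ) : Holds p (σ.setV x c) :=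
  h.frame ((Frame.refl [x] [] σ).setV (by simp) c) hx (by simp)

theorem Holds.setA {p : Params} {σ : St} (h : Holds p σ) {A : Arr} (hA : Arr.red ≠ A) (i c : ℕ) :
    Holds p (σ.setA A i c) :=
  ⟨h.n, h.l, h.q, h.s, h.b, h.r, h.J, h.Q, fun y hy => by
    rw [St.setA_a_ne _ _ _ _ _ hA]; exact h.red y hy⟩

/-- `s` becomes the number of large blocks. -/
def findBlocks : Cmd :=
  (.y ≔ var .l + var .l) ;; (.y ≔ var .y + var .y) ;; (.y ≔ var .y + var .y) ;;
  (.y ≔ var .y + var .y) ;; pow .pw .q .y ;;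
  .ite (lt (var .n) (var .pw))
    ((.x ≔ 1) ;; (.s ≔ 16) ;; .for .i (var .q)
      ((.x ≔ var .x + var .x) ;; .ite (lt (var .q) (var .x)) .skip (.s ≔ var .s + 16)))
    (.s ≔ 1)

theorem findBlocks_spec {inp : ℕ → ℕ} {σ : St} (hq : 0 < σ.v .q) :
    wp inp findBlocks σ fun k σ' => k ≤ 1000 * (σ.v .l + 1) * (σ.v .q + 1) ∧
      σ'.v .s = Params.numBlocks (σ.v .n) (σ.v .l) (σ.v .q) := by
  set q := σ.v .q with hq'
  set l := σ.v .l with hl'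
  simp only [findBlocks, wp_seq, wp_assign]
  refine (pow_spec (by decide)).frame.mono ?_
  rintro k₁ σ₁ ⟨⟨hk₁, hpw⟩, hF₁⟩
  have e1 := hF₁.v .q (by decide)
  have e2 := hF₁.v .n (by decide)
  simp only [St.setV_v, reduceCtorEq, if_false, if_true, ← hq', ← hl', Expr.eval_add,
    Expr.eval_var] at e1 e2 hpw hk₁
  rw [show l + l + (l + l) + (l + l + (l + l)) + (l + l + (l + l) + (l + l + (l + l))) = 16 * l by
    ring] at hpw hk₁
  have hk₁' : k₁ ≤ 192 * (l * q) + 320 * l + 10 := hk₁.trans (le_of_eq (by ring))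
  have hbound : 1000 * (l + 1) * (q + 1) = 1000 * (l * q) + 1000 * l + 1000 * q + 1000 := by ring
  rw [hbound]
  clear hk₁
  rw [wp_ite]
  simp only [ne_eq, Expr.eval_lt, Expr.eval_var, e2, hpw, not_le]
  refine ⟨fun h => ?_, fun h => ?_⟩
  · have hlog : Nat.log 2 q ≤ q := (Nat.log_lt_self 2 hq.ne').le
    simp only [wp_seq, wp_assign]
    refine wp_for q 20
      (fun i σ' => σ'.v .x = 2 ^ i ∧ σ'.v .s = 16 * (min i (Nat.log 2 q) + 1))
      (by decide) (by decide) (by decide) (by simp [e1]) (by simp) ?_ ?_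
    · intro i hi σ' hF hv ⟨hI1, hI2⟩
      have f1 := hF.v .q (by decide)
      simp only [St.setV_v, reduceCtorEq, if_false, e1] at f1
      have hiff : 2 ^ (i + 1) ≤ q ↔ i + 1 ≤ Nat.log 2 q :=
        (Nat.le_log_iff_pow_le (by norm_num) hq.ne').symm
      have h2 : 2 ^ i + 2 ^ i = 2 ^ (i + 1) := by ring
      simp only [wp_seq, wp_assign, wp_ite, wp_skip]
      refine ⟨fun h => ?_, fun h => ?_⟩
      · simp [f1, hI1, hI2, h2] at h ⊢
        have := mt hiff.2 (by omega)
        omega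
      · simp [f1, hI1, hI2, h2] at h ⊢
        have := hiff.1 (by omega)
        omega
    · intro k σ' hF hv ⟨hI1, hI2⟩ hk
      simp at hk ⊢
      refine ⟨by omega, ?_⟩
      rw [hI2, Params.numBlocks, if_neg (by omega), min_eq_right hlog]
  · rw [wp_assign]
    refine ⟨by simp; omega, ?_⟩
    simp [Params.numBlocks, h]

/-- The remaining parameters and the table of the residues modulo `b`. -/
def findParams : Cmd :=
  (.b ≔ 0) ;; (.r ≔ var .l) ;;
  .for .i (var .l) (.ite (lt (var .r) (var .s)) .skip
    ((.r ≔ var .r - var .s) ;; (.b ≔ var .b + 1))) ;;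
  pow .Q .q .b ;; (.J ≔ var .s + var .r - 1) ;; (.x ≔ 0) ;;
  .for .i (var .q) (.store .red (var .i) (var .x) ;; (.x ≔ var .x + 1) ;;
    .ite (ne (var .x) (var .b)) .skip (.x ≔ 0))

theorem findParams_spec {inp : ℕ → ℕ} {σ : St} {p : Params} (hn : σ.v .n = p.n)
    (hl : σ.v .l = p.l) (hq : σ.v .q = p.q) (hs : σ.v .s = p.s) (hs0 : 0 < p.s) :
    wp inp findParams σ fun k σ' => k ≤ 200 * (p.l + 1) * (p.q + 1) ∧ Holds p σ' := by
  have hb : p.b ≤ p.l := Nat.div_le_self _ _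
  have hbs : p.b * p.s ≤ p.l := Nat.div_mul_le_self _ _
  have hbs' : p.l < (p.b + 1) * p.s := by
    rw [Params.b, add_mul, one_mul]; exact Nat.lt_div_mul_add hs0
  simp only [findParams, wp_seq, wp_assign]
  refine wp_for p.l 20 (fun i σ' => σ'.v .b = min i p.b ∧ σ'.v .r = p.l - min i p.b * p.s)
    (by decide) (by decide) (by decide) (by simp [hl]) (by simp [hl]) ?_ ?_
  · intro i hi σ' hF hv ⟨hI1, hI2⟩
    have e1 := hF.v .s (by decide)
    simp only [St.setV_v, reduceCtorEq, if_false, hs] at e1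
    rw [wp_ite]
    simp only [ne_eq, Expr.eval_lt, Expr.eval_var, e1, hI2, not_le]
    have h3 : ∀ j ≤ p.b, j * p.s ≤ p.l := fun j hj => (Nat.mul_le_mul_right _ hj).trans hbs
    refine ⟨fun h => ?_, fun h => ?_⟩
    · have h' : p.b ≤ i := by
        by_contra h'
        rw [min_eq_left (by omega)] at h
        have := h3 (i + 1) (by omega)
        rw [add_mul, one_mul] at this
        omega
      rw [wp_skip]
      simp [hI1, hI2, min_eq_right h', min_eq_right (h'.trans (Nat.le_succ i))]
    · have h' : i < p.b := by
        by_contra h'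
        rw [min_eq_right (by omega)] at h
        rw [add_mul, one_mul] at hbs'
        omega
      rw [min_eq_left h'.le] at hI1 hI2 h
      simp only [wp_seq, wp_assign]
      simp [hI1, hI2, e1, min_eq_left (Nat.succ_le_of_lt h'), add_mul]
      omega
  · intro k₁ σ₁ hF₁ hv₁ ⟨hb₁, hr₁⟩ hk₁
    rw [min_eq_right hb] at hb₁ hr₁
    have e1 := hF₁.v .n (by decide)
    have e2 := hF₁.v .l (by decide)
    have e3 := hF₁.v .q (by decide)
    have e4 := hF₁.v .s (by decide)
    simp only [St.setV_v, reduceCtorEq, if_false, hn, hl, hq, hs] at e1 e2 e3 e4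
    have hr₁' : σ₁.v .r = p.r := by
      rw [hr₁, Params.r]
      have := Nat.div_add_mod p.l p.s
      rw [Params.b, mul_comm]; omega
    refine (pow_spec (by decide)).frame.mono ?_
    rintro k₂ σ₂ ⟨⟨hk₂, hQ⟩, hF₂⟩
    have f1 := (hF₂.v .n (by decide)).trans e1
    have f2 := (hF₂.v .l (by decide)).trans e2
    have f3 := (hF₂.v .q (by decide)).trans e3
    have f4 := (hF₂.v .s (by decide)).trans e4
    have f5 := (hF₂.v .b (by decide)).trans hb₁
    have f6 := (hF₂.v .r (by decide)).trans hr₁'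
    rw [e3, hb₁] at hk₂ hQ
    -- For `b = 0` the running value is never reset, since it is positive after each increment; this
    -- agrees with `i % 0 = i`.
    refine wp_for p.q 50 (fun i σ' => σ'.v .x = (if p.b = 0 then i else i % p.b) ∧
        ∀ y < i, σ'.a .red y = y % p.b)
      (by decide) (by decide) (by decide) (by simp [f3]) (by simp) ?_ ?_
    · intro i hi σ' hF hv ⟨hI1, hI2⟩
      have g1 := hF.v .b (by decide)
      simp only [St.setV_v, reduceCtorEq, if_false, f5] at g1
      have hred : (if p.b = 0 then i else i % p.b) = i % p.b := by
        split_ifs with h0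
        · simp [h0]
        · rfl
      have hA : ∀ τ : St, τ.a .red = (σ'.setA .red i (i % p.b)).a .red →
          ∀ y < i + 1, τ.a .red y = y % p.b := by
        intro τ hτ y hy
        rw [hτ, St.setA_a_same]
        split_ifs with h
        · rw [h]
        · exact hI2 y (by omega)
      simp only [wp_seq, wp_assign, wp_ite, wp_store, wp_skip]
      simp only [hred] at hI1
      refine ⟨fun h => ⟨by simp, ?_, hA _ (by simp [hI1, hv])⟩,
        fun h => ⟨by simp, ?_, hA _ (by simp [hI1, hv])⟩⟩
      · simp [hI1, g1] at h ⊢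
        split_ifs with h0
        · simp [h0]
        · rw [Nat.add_mod, Nat.mod_eq_of_lt (a := i % p.b + 1 % p.b)]
          · rcases Nat.lt_or_ge 1 p.b with h1 | h1
            · rw [Nat.mod_eq_of_lt h1]
            · obtain h2 : p.b = 1 := by omega
              simp [h2, Nat.mod_one] at h
          · have := Nat.mod_lt i (Nat.pos_of_ne_zero h0)
            rcases Nat.lt_or_ge 1 p.b with h1 | h1
            · rw [Nat.mod_eq_of_lt h1]; omega
            · obtain h2 : p.b = 1 := by omega
              simp [h2, Nat.mod_one] at h
      · simp [hI1, g1] at h ⊢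
        split_ifs with h0
        · omega
        · have h1 := Nat.div_add_mod i p.b
          have h2 : i + 1 = p.b * (i / p.b + 1) := by rw [mul_add, mul_one]; omega
          rw [h2, Nat.mul_mod_right]
    · intro k₃ σ₃ hF₃ hv₃ ⟨_, hI⟩ hk₃
      have g : ∀ x : Var, x ≠ .i → x ≠ .x → x ≠ .J → σ₃.v x = σ₂.v x := by
        intro x h1 h2 h3
        have := hF₃.v x (by simp [Cmd.modV, h1, h2])
        simpa [h1, h2, h3] using this
      have gJ := hF₃.v .J (by decide)
      simp [f4, f6] at gJ
      refine ⟨?_, ⟨(g _ (by decide) (by decide) (by decide)).trans f1,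
        (g _ (by decide) (by decide) (by decide)).trans f2,
        (g _ (by decide) (by decide) (by decide)).trans f3,
        (g _ (by decide) (by decide) (by decide)).trans f4,
        (g _ (by decide) (by decide) (by decide)).trans f5,
        (g _ (by decide) (by decide) (by decide)).trans f6, gJ,
        (g _ (by decide) (by decide) (by decide)).trans hQ, hI⟩⟩
      have h1 : p.b * (12 * p.q + 20) ≤ p.l * (12 * p.q + 20) := Nat.mul_le_mul_right _ hb
      have h2 : p.l * (12 * p.q + 20) = 12 * (p.l * p.q) + 20 * p.l := by ring
      have h3 : 200 * (p.l + 1) * (p.q + 1) =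
        200 * (p.l * p.q) + 200 * p.l + 200 * p.q + 200 := by ring
      rw [h3]
      simp at hk₁ hk₃ ⊢
      omega

end While

/-! ### Digits and polynomial hashing -/

/-- The `j`-th digit of `E` in base `R`. -/
def dig (R E j : ℕ) : ℕ := E / R ^ j % R

theorem dig_lt {R : ℕ} (hR : 0 < R) (E j : ℕ) : dig R E j < R := Nat.mod_lt _ hR

theorem dig_zero_right (R E : ℕ) : dig R E 0 = E % R := by simp [dig]

theorem dig_succ (R E j : ℕ) : dig R E (j + 1) = dig R (E / R) j := by
  rw [dig, dig, pow_succ', Nat.div_div_eq_div_mul]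

/-- Thus a single counter up to `R ^ k` enumerates all choices of `k` thresholds or rows. -/
theorem exists_dig_eq (R k : ℕ) (f : ℕ → ℕ) (hf : ∀ j < k, f j < R) :
    ∃ E < R ^ k, ∀ j < k, dig R E j = f j := by
  induction k generalizing f with
  | zero => exact ⟨0, by simp, by simp⟩
  | succ k ih =>
    obtain ⟨E, hE, h⟩ := ih (fun j => f (j + 1)) fun j hj => hf _ (by omega)
    have h0 := hf 0 (by omega)
    refine ⟨f 0 + R * E, ?_, fun j hj => ?_⟩
    · rw [pow_succ']
      have : R * (E + 1) ≤ R * R ^ k := Nat.mul_le_mul_left _ hE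
      rw [mul_add, mul_one] at this
      omega
    · cases j with
      | zero => rw [dig_zero_right, Nat.add_mul_mod_self_left, Nat.mod_eq_of_lt h0]
      | succ j =>
        rw [dig_succ, Nat.add_mul_div_left _ _ (by omega), Nat.div_eq_of_lt h0, zero_add,
          h j (by omega)]

/-- The polynomial whose coefficients are the digits of `x` in base `q`, evaluated at `a` modulo
`q`. -/
def polyHash (q a x : ℕ) : ℕ := Nat.ofDigits a (Nat.digits q x) % q

theorem polyHash_lt {q : ℕ} (hq : 0 < q) (a x : ℕ) : polyHash q a x < q := Nat.mod_lt _ hq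

@[simp] theorem polyHash_zero (q a : ℕ) : polyHash q a 0 = 0 := by simp [polyHash]

theorem polyHash_rec {q : ℕ} (hq : 2 ≤ q) (a x : ℕ) :
    polyHash q a x = (x % q + a * polyHash q a (x / q)) % q := by
  rcases Nat.eq_zero_or_pos x with rfl | hx
  · simp
  · rw [polyHash, Nat.digits_def' (by omega) hx, Nat.ofDigits_cons, polyHash]
    simp [Nat.add_mod, Nat.mul_mod]

theorem cast_polyHash {q : ℕ} (hq : 2 ≤ q) (a d x : ℕ) (hx : x < q ^ d) :
    (polyHash q a x : ZMod q) = ∑ j ∈ Finset.range d, (dig q x j : ZMod q) * (a : ZMod q) ^ j := by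
  induction d generalizing x with
  | zero =>
    have : x = 0 := by simpa using hx
    simp [this]
  | succ d ih =>
    have h := ih (x / q) (Nat.div_lt_of_lt_mul (by rwa [pow_succ'] at hx))
    rw [polyHash_rec hq, Finset.sum_range_succ', ZMod.natCast_mod]
    push_cast
    rw [h, Finset.mul_sum, add_comm]
    congr 1
    · refine Finset.sum_congr rfl fun j _ => ?_
      rw [dig_succ]; ring
    · rw [dig_zero_right]; simp

theorem eq_of_dig_eq {q d x x' : ℕ} (hx : x < q ^ d) (hx' : x' < q ^ d)
    (h : ∀ j < d, dig q x j = dig q x' j) : x = x' := by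
  induction d generalizing x x' with
  | zero =>
    have h1 : x = 0 := by simpa using hx
    have h2 : x' = 0 := by simpa using hx'
    rw [h1, h2]
  | succ d ih =>
    rw [pow_succ'] at hx hx'
    have h1 := ih (Nat.div_lt_of_lt_mul hx) (Nat.div_lt_of_lt_mul hx') fun j hj => by
      rw [← dig_succ, ← dig_succ]; exact h _ (by omega)
    have h2 := h 0 (by omega)
    rw [dig_zero_right, dig_zero_right] at h2
    rw [← Nat.div_add_mod x q, ← Nat.div_add_mod x' q, h1, h2]

/-- Two polynomials of degree less than `d` agree in less than `d` points. -/
theorem card_collisions_lt {q : ℕ} (hq : q.Prime) {d x x' : ℕ} (hx : x < q ^ d) (hx' : x' < q ^ d)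
    (hne : x ≠ x') :
    ((Finset.range q).filter fun a => polyHash q a x = polyHash q a x').card < d := by
  classical
  have := Fact.mk hq
  obtain ⟨j, hj, hdig⟩ : ∃ j < d, dig q x j ≠ dig q x' j := by
    by_contra h
    push Not at h
    exact hne (eq_of_dig_eq hx hx' h)
  let P : Polynomial (ZMod q) := ∑ j ∈ Finset.range d,
    Polynomial.C ((dig q x j : ZMod q) - dig q x' j) * Polynomial.X ^ j
  have hcoeff : P.coeff j = (dig q x j : ZMod q) - dig q x' j := by
    simp only [P, Polynomial.finsetSum_coeff, Polynomial.coeff_C_mul_X_pow]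
    simp [hj]
  have hP : P ≠ 0 := by
    intro h
    rw [h, Polynomial.coeff_zero, eq_comm, sub_eq_zero, ZMod.natCast_eq_natCast_iff'] at hcoeff
    rw [Nat.mod_eq_of_lt (dig_lt hq.pos _ _), Nat.mod_eq_of_lt (dig_lt hq.pos _ _)] at hcoeff
    exact hdig hcoeff
  have hdeg : P.degree < d := by
    rw [Polynomial.degree_lt_iff_coeff_zero]
    intro m hm
    simp only [P, Polynomial.finsetSum_coeff, Polynomial.coeff_C_mul_X_pow]
    refine Finset.sum_eq_zero fun i hi => if_neg ?_
    have := Finset.mem_range.1 hi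
    omega
  have hroots : (((Finset.range q).filter fun a => polyHash q a x = polyHash q a x').image
      (fun a : ℕ => (a : ZMod q))) ⊆ P.roots.toFinset := by
    intro α hα
    obtain ⟨a, ha, rfl⟩ := Finset.mem_image.1 hα
    have h2 := (Finset.mem_filter.1 ha).2
    rw [Multiset.mem_toFinset, Polynomial.mem_roots hP, Polynomial.IsRoot.def]
    have h3 : (polyHash q a x : ZMod q) = polyHash q a x' := by rw [h2]
    rw [cast_polyHash hq.two_le a d x hx, cast_polyHash hq.two_le a d x' hx'] at h3
    simp only [P, Polynomial.eval_finsetSum, Polynomial.eval_mul, Polynomial.eval_C,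
      Polynomial.eval_pow, Polynomial.eval_X, sub_mul, Finset.sum_sub_distrib, h3, sub_self]
  have hinj : Set.InjOn (fun a : ℕ => (a : ZMod q))
      ((Finset.range q).filter fun a => polyHash q a x = polyHash q a x' : Finset ℕ) := by
    intro a ha a' ha' h
    have h1 := (Finset.mem_filter.1 ha).1
    have h2 := (Finset.mem_filter.1 ha').1
    rw [Finset.mem_range] at h1 h2
    have h : (a : ZMod q) = a' := h
    rwa [ZMod.natCast_eq_natCast_iff', Nat.mod_eq_of_lt h1, Nat.mod_eq_of_lt h2] at h
  rw [← Finset.card_image_of_injOn hinj]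
  refine (Finset.card_le_card hroots).trans_lt ?_
  refine (Multiset.toFinset_card_le _).trans_lt ?_
  have := (Polynomial.card_roots hP).trans_lt hdeg
  exact_mod_cast this

/-- `g` is injective on the tuple `y 0, …, y (b - 1)`. -/
def Separates (g : ℕ → ℕ) (b : ℕ) (y : ℕ → ℕ) : Prop := ∀ i < b, ∀ j < i, g (y i) ≠ g (y j)

theorem Separates.ne {g y : ℕ → ℕ} {b : ℕ} (h : Separates g b y) {i j : ℕ} (hi : i < b)
    (hj : j < b) (hij : i ≠ j) : g (y i) ≠ g (y j) := by
  rcases lt_or_gt_of_ne hij with h' | h'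
  · exact (h j hj i h').symm
  · exact h i hi j h'

theorem separates_congr {g g' y y' : ℕ → ℕ} {b : ℕ} (h : ∀ i < b, g (y i) = g' (y' i)) :
    Separates g b y ↔ Separates g' b y' := by
  refine forall_congr' fun i => forall_congr' fun hi => forall_congr' fun j =>
    forall_congr' fun hj => ?_
  rw [h i hi, h j (hj.trans hi)]

/-- The number of polynomials of degree less than `b` that separate a given `b`-tuple modulo `b`
is at least this number. -/
def numSeparating (q b : ℕ) : ℕ := b.factorial * (q / b) ^ b

theorem numSeparating_pos {q b : ℕ} (h : b ≤ q) : 0 < numSeparating q b := by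
  rcases Nat.eq_zero_or_pos b with rfl | hb
  · simp [numSeparating]
  · exact Nat.mul_pos (Nat.factorial_pos _) (Nat.pow_pos (Nat.div_pos h hb))

open Classical in
-- By interpolation, the polynomials of degree less than `b` take every `b`-tuple of values at the
-- points `y` exactly once, so it suffices to count value tuples whose residues modulo `b` are
-- distinct.
theorem numSeparating_le {q : ℕ} (hq : q.Prime) {b : ℕ} {y : ℕ → ℕ} (hy : ∀ i < b, y i < q)
    (hy' : Separates id b y) :
    numSeparating q b ≤ ((Finset.range (q ^ b)).filter fun z =>
      Separates (fun y => polyHash q y z % b) b y).card := by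
  -- The values of a polynomial at the `b` points. Two polynomials that agree at all of them agree
  -- in `b` points and hence coincide.
  let Φ : Fin (q ^ b) → (Fin b → Fin q) := fun z i => ⟨polyHash q (y i) z, polyHash_lt hq.pos _ _⟩
  have hΦ : Function.Injective Φ := by
    intro z z' h
    by_contra hne
    have hlt := card_collisions_lt hq z.2 z'.2 (fun e => hne (Fin.ext e))
    have hsub : (Finset.range b).image y ⊆ (Finset.range q).filter fun a =>
        polyHash q a z = polyHash q a z' := by
      intro a ha
      obtain ⟨i, hi, rfl⟩ := Finset.mem_image.1 ha
      have hi := Finset.mem_range.1 hi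
      have := congrFun h ⟨i, hi⟩
      exact Finset.mem_filter.2 ⟨Finset.mem_range.2 (hy i hi), by simpa [Φ] using this⟩
    have hcard := Finset.card_le_card hsub
    rw [Finset.card_image_of_injOn, Finset.card_range] at hcard
    · omega
    · intro i hi j hj e
      by_contra hij
      exact hy'.ne (by simpa using hi) (by simpa using hj) hij e
  have hbij : Function.Bijective Φ := by
    rw [Fintype.bijective_iff_injective_and_card]
    exact ⟨hΦ, by simp⟩
  let e := Equiv.ofBijective Φ hbij
  -- The permutation prescribes the residues modulo `b` and the function prescribes the quotients;
  -- the values stay below `q` because `q / b * b ≤ q`.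
  let Ψ : Equiv.Perm (Fin b) × (Fin b → Fin (q / b)) → (Fin b → Fin q) := fun x i =>
    ⟨x.2 i * b + x.1 i, by
      have h1 := (x.2 i).2
      have h2 := (x.1 i).2
      have h3 : ((x.2 i : ℕ) + 1) * b ≤ q / b * b := Nat.mul_le_mul_right _ h1
      have h4 := Nat.div_mul_le_self q b
      rw [add_mul, one_mul] at h3
      omega⟩
  have hmod : ∀ x i, (Ψ x i : ℕ) % b = x.1 i := fun x i => by
    simp only [Ψ, mul_comm _ b]
    rw [Nat.mul_add_mod, Nat.mod_eq_of_lt (x.1 i).2]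
  have hdiv : ∀ x i, (Ψ x i : ℕ) / b = x.2 i := fun x i => by
    have := (x.1 i).2
    simp only [Ψ, mul_comm _ b]
    rw [Nat.mul_add_div (by omega), Nat.div_eq_of_lt this, add_zero]
  have hΨ : Function.Injective Ψ := by
    intro x x' h
    refine Prod.ext (Equiv.ext fun i => Fin.ext ?_) (funext fun i => Fin.ext ?_)
    · rw [← hmod, ← hmod, h]
    · rw [← hdiv, ← hdiv, h]
  have hcard : Fintype.card (Equiv.Perm (Fin b) × (Fin b → Fin (q / b))) = numSeparating q b := by
    simp [numSeparating, Fintype.card_perm]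
  rw [← hcard, ← Finset.card_univ]
  refine Finset.card_le_card_of_injOn (fun x => (e.symm (Ψ x) : ℕ)) ?_ ?_
  · intro x _
    refine Finset.mem_filter.2 ⟨Finset.mem_range.2 (e.symm (Ψ x)).2, ?_⟩
    have hv : ∀ i (hi : i < b), polyHash q (y i) (e.symm (Ψ x)) = Ψ x ⟨i, hi⟩ := fun i hi => by
      have : Φ (e.symm (Ψ x)) = Ψ x := e.apply_symm_apply _
      exact congrArg Fin.val (congrFun this ⟨i, hi⟩)
    intro i hi j hj h
    simp only [hv i hi, hv j (hj.trans hi), hmod] at h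
    have := x.1.injective (Fin.ext h)
    simp at this
    omega
  · intro x _ x' _ h
    exact hΨ (e.symm.injective (Fin.ext h))

namespace While

/-! ### The hash family -/

/-- The number of thresholds up to `y`. -/
def blockOf (J : ℕ) (th : ℕ → ℕ) (y : ℕ) : ℕ := ((Finset.range J).filter fun g => th g ≤ y).card

namespace Params

variable (p : Params)

/-- The color of `y` under the hash function that is given by the thresholds `th` and by the rows
`ix 0, …, ix (s - 1)` of the table `F`. -/
def color (F : ℕ → ℕ → ℕ) (th ix : ℕ → ℕ) (y : ℕ) : ℕ :=
  let k := blockOf p.J th y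
  let c := if k < p.s then k * p.b + F (ix k) y else p.s * p.b + (k - p.s)
  if c < p.l then c else 0

/-- The first `M` rows of the table `F` separate all tuples of `b` field elements. -/
structure IsPerfect (M : ℕ) (F : ℕ → ℕ → ℕ) : Prop where
  lt : 0 < p.b → ∀ i < M, ∀ y < p.q, F i y < p.b
  sep : ∀ y : ℕ → ℕ, (∀ i < p.b, y i < p.q) → Separates id p.b y → ∃ i < M, Separates (F i) p.b y

/-- The field is large enough for the given numbers `n` and `l`. -/
structure Good : Prop where
  l_pos : 0 < p.l
  s_pos : 0 < p.s
  field : GoodField p.n (2 * (p.l * p.l)) p.q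

variable {p}

/-- Otherwise the exponent in `GoodField` would be 0, although the power exceeds `n + 1`. -/
theorem Good.lt_q (hp : p.Good) : 2 * (p.l * p.l) < p.q := by
  have h1 : (p.q - 1) / (2 * (p.l * p.l)) ≠ 0 := by
    intro h
    have := hp.field.2
    rw [h, pow_zero] at this
    omega
  have h2 := hp.field.1.two_le
  rw [Ne, Nat.div_eq_zero_iff] at h1
  omega

theorem Good.l_lt_q (hp : p.Good) : p.l < p.q := by
  have := hp.lt_q
  have := hp.l_pos
  nlinarith

theorem b_le : p.b ≤ p.l := Nat.div_le_self _ _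

theorem s_mul_b_add_r : p.s * p.b + p.r = p.l := Nat.div_add_mod _ _

/-- Union bound: there are at most `l ^ 2` ordered pairs and each excludes at most `d` points, in
total at most `(q - 1) / 2`, which is less than `q`. -/
theorem Good.exists_injOn_polyHash (hp : p.Good) (U : Finset ℕ) (hU : ∀ x ∈ U, x ≤ p.n)
    (hcard : U.card ≤ p.l) : ∃ a < p.q, Set.InjOn (polyHash p.q a) U := by
  classical
  set d := (p.q - 1) / (2 * (p.l * p.l)) with hd
  by_contra h
  push Not at h
  have hsub : Finset.range p.q ⊆ U.offDiag.biUnion fun x =>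
      (Finset.range p.q).filter fun a => polyHash p.q a x.1 = polyHash p.q a x.2 := by
    intro a ha
    have := h a (Finset.mem_range.1 ha)
    simp only [Set.InjOn, not_forall] at this
    obtain ⟨x, hx, x', hx', he, hne⟩ := this
    exact Finset.mem_biUnion.2 ⟨(x, x'), Finset.mem_offDiag.2 ⟨hx, hx', hne⟩,
      Finset.mem_filter.2 ⟨ha, he⟩⟩
  have h1 := Finset.card_le_card hsub
  rw [Finset.card_range] at h1
  have h2 : ∀ x ∈ U.offDiag, ((Finset.range p.q).filter fun a =>
      polyHash p.q a x.1 = polyHash p.q a x.2).card ≤ d := by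
    intro x hx
    obtain ⟨hx1, hx2, hne⟩ := Finset.mem_offDiag.1 hx
    have g := hp.field.2
    exact (card_collisions_lt hp.field.1 ((Nat.lt_succ_of_le (hU _ hx1)).trans g)
      ((Nat.lt_succ_of_le (hU _ hx2)).trans g) hne).le
  have h3 := Finset.card_biUnion_le_card_mul _ _ _ h2
  have h4 : U.offDiag.card ≤ p.l * p.l := by
    rw [Finset.offDiag_card]
    exact (Nat.sub_le _ _).trans (Nat.mul_le_mul hcard hcard)
  have h5 : d * (2 * (p.l * p.l)) ≤ p.q - 1 := Nat.div_mul_le_self _ _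
  have h6 : U.offDiag.card * d ≤ p.l * p.l * d := Nat.mul_le_mul_right _ h4
  have h7 : d * (2 * (p.l * p.l)) = 2 * (p.l * p.l * d) := by ring
  have := hp.field.1.two_le
  omega

/-- The index of the first element of a block. -/
def start (p : Params) (g : ℕ) : ℕ := if g ≤ p.s then g * p.b else p.s * p.b + (g - p.s)

/-- This makes every threshold one of the `l` elements. If `r = 0`, the last threshold opens the
last large block, which is nonempty because then `b > 0`; otherwise a block of one element remains
behind the large ones. -/
theorem Good.start_lt (hp : p.Good) {g : ℕ} (hg : g < p.J) : p.start (g + 1) < p.l := by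
  have h1 := p.s_mul_b_add_r
  have h2 := hp.s_pos
  have h3 := hp.l_pos
  simp only [J] at hg
  rw [start]
  split_ifs with h
  · rcases Nat.eq_zero_or_pos p.r with h0 | h0
    · have h4 : (g + 1 + 1) * p.b ≤ p.s * p.b := Nat.mul_le_mul_right _ (by omega)
      have h5 : 0 < p.b := by
        rcases Nat.eq_zero_or_pos p.b with hb | hb
        · rw [hb] at h1; omega
        · exact hb
      rw [add_mul _ 1, one_mul] at h4
      omega
    · have h4 : (g + 1) * p.b ≤ p.s * p.b := Nat.mul_le_mul_right _ h
      omega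
  · omega

/-- The number of block starts up to an index, not counting the start of block 0, is the number of
the block that contains the index; for `b = 0` all large blocks are skipped. -/
theorem Good.card_start_le (hp : p.Good) {i : ℕ} (hi : i < p.l) :
    ((Finset.range p.J).filter fun g => p.start (g + 1) ≤ i).card =
      if i < p.s * p.b then i / p.b else p.s + (i - p.s * p.b) := by
  have h1 := p.s_mul_b_add_r
  have h2 := hp.s_pos
  split_ifs with h
  · have hb : 0 < p.b := by
      rcases Nat.eq_zero_or_pos p.b with hb | hb
      · rw [hb] at h; omega
      · exact hb
    have h3 : i / p.b < p.s := Nat.div_lt_of_lt_mul (by rwa [mul_comm])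
    have : ((Finset.range p.J).filter fun g => p.start (g + 1) ≤ i) = Finset.range (i / p.b) := by
      ext g
      rw [Finset.mem_filter, Finset.mem_range, Finset.mem_range]
      simp only [start, J]
      split_ifs with h4
      · rw [← Nat.le_div_iff_mul_le hb]; omega
      · omega
    rw [this, Finset.card_range]
  · have : ((Finset.range p.J).filter fun g => p.start (g + 1) ≤ i) =
        Finset.range (p.s + (i - p.s * p.b)) := by
      ext g
      rw [Finset.mem_filter, Finset.mem_range, Finset.mem_range]
      simp only [start, J]
      split_ifs with h4
      · have h5 : (g + 1) * p.b ≤ p.s * p.b := Nat.mul_le_mul_right _ h4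
        omega
      · omega
    rw [this, Finset.card_range]

/-- Hash the set injectively into the field, sort the values, take the first elements of the blocks
as thresholds, and choose for each large block a row that separates its `b` elements. Different
blocks use disjoint ranges of colors. -/
theorem Good.exists_color_injOn (hp : p.Good) {M : ℕ} {F : ℕ → ℕ → ℕ} (hF : p.IsPerfect M F)
    (U : Finset ℕ) (hU : ∀ x ∈ U, x ≤ p.n) (hcard : U.card ≤ p.l) :
    ∃ a < p.q, ∃ E₁ < p.q ^ p.J, ∃ E₂ < M ^ p.s,
      Set.InjOn (fun x => p.color F (dig p.q E₁) (dig M E₂) (polyHash p.q a x)) U := by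
  classical
  obtain ⟨a, ha, hinj⟩ := hp.exists_injOn_polyHash U hU hcard
  have hq0 := hp.field.1.pos
  -- The image is padded to exactly `l` field elements, so that the block sizes are always the same;
  -- this is possible because `l < q`.
  obtain ⟨Y, hUY, hYq, hY⟩ := Finset.exists_subsuperset_card_eq (n := p.l)
    (s := U.image (polyHash p.q a)) (t := Finset.range p.q)
    (by
      intro y hy
      obtain ⟨x, -, rfl⟩ := Finset.mem_image.1 hy
      exact Finset.mem_range.2 (polyHash_lt hq0 _ _))
    (Finset.card_image_le.trans hcard) (by rw [Finset.card_range]; exact hp.l_lt_q.le)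
  let y : ℕ → ℕ := fun i => if h : i < p.l then Y.orderEmbOfFin hY ⟨i, h⟩ else 0
  have hy_eq : ∀ i (h : i < p.l), y i = Y.orderEmbOfFin hY ⟨i, h⟩ := fun i h => dif_pos h
  have hyq : ∀ i, y i < p.q := by
    intro i
    by_cases h : i < p.l
    · rw [hy_eq i h]
      exact Finset.mem_range.1 (hYq (Finset.orderEmbOfFin_mem _ _ _))
    · simp only [y, dif_neg h]; exact hq0
  have hyle : ∀ i < p.l, ∀ j < p.l, (y i ≤ y j ↔ i ≤ j) := by
    intro i hi j hj
    rw [hy_eq i hi, hy_eq j hj, OrderEmbedding.le_iff_le, Fin.mk_le_mk]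
  have hysurj : ∀ z ∈ Y, ∃ i < p.l, y i = z := by
    intro z hz
    have : z ∈ Set.range (Y.orderEmbOfFin hY) := by rw [Finset.range_orderEmbOfFin]; exact hz
    obtain ⟨i, rfl⟩ := this
    exact ⟨i, i.2, hy_eq i i.2⟩
  have hsb := p.s_mul_b_add_r
  have hix : ∀ k, ∃ i, k < p.s → i < M ∧ Separates (F i) p.b fun j => y (k * p.b + j) := by
    intro k
    by_cases hk : k < p.s
    · have hlt : ∀ j < p.b, k * p.b + j < p.l := by
        intro j hj
        have : (k + 1) * p.b ≤ p.s * p.b := Nat.mul_le_mul_right _ hk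
        rw [add_mul, one_mul] at this
        omega
      obtain ⟨i, hi, h⟩ := hF.sep (fun j => y (k * p.b + j)) (fun j _ => hyq _) (by
        intro i hi j hj h
        have h1 := (hyle _ (hlt i hi) _ (hlt j (hj.trans hi))).1 (le_of_eq h)
        omega)
      exact ⟨i, fun _ => ⟨hi, h⟩⟩
    · exact ⟨0, fun h => absurd h hk⟩
  choose ix hix using hix
  obtain ⟨E₁, hE₁, hth⟩ := exists_dig_eq p.q p.J (fun g => y (p.start (g + 1))) fun g _ => hyq _
  obtain ⟨E₂, hE₂, hdig⟩ := exists_dig_eq M p.s ix fun k hk => (hix k hk).1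
  refine ⟨a, ha, E₁, hE₁, E₂, hE₂, ?_⟩
  have hblock : ∀ i < p.l, blockOf p.J (dig p.q E₁) (y i) =
      if i < p.s * p.b then i / p.b else p.s + (i - p.s * p.b) := by
    intro i hi
    rw [← hp.card_start_le hi, blockOf]
    congr 1
    refine Finset.filter_congr fun g hg => ?_
    have hg := Finset.mem_range.1 hg
    rw [hth g hg, hyle _ (hp.start_lt hg) _ hi]
  have hcolor₁ : ∀ i < p.s * p.b, 0 < p.b ∧ i / p.b < p.s ∧ F (ix (i / p.b)) (y i) < p.b ∧
      p.color F (dig p.q E₁) (dig M E₂) (y i) = i / p.b * p.b + F (ix (i / p.b)) (y i) := by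
    intro i hi
    have hb : 0 < p.b := by
      rcases Nat.eq_zero_or_pos p.b with hb | hb
      · rw [hb] at hi; omega
      · exact hb
    have h3 : i / p.b < p.s := Nat.div_lt_of_lt_mul (by rwa [mul_comm])
    have h4 := hF.lt hb _ (hix _ h3).1 _ (hyq i)
    refine ⟨hb, h3, h4, ?_⟩
    have h5 : (i / p.b + 1) * p.b ≤ p.s * p.b := Nat.mul_le_mul_right _ h3
    rw [add_mul, one_mul] at h5
    have hk := hblock i (by omega)
    rw [if_pos hi] at hk
    rw [color, hk]
    simp only [if_pos h3]
    rw [hdig _ h3, if_pos (by omega)]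
  -- Behind the large blocks every element is a block of its own, and its color is its rank.
  have hcolor₂ : ∀ i < p.l, p.s * p.b ≤ i → p.color F (dig p.q E₁) (dig M E₂) (y i) = i := by
    intro i hi hi'
    have hk := hblock i hi
    rw [if_neg (by omega)] at hk
    rw [color, hk]
    rw [if_neg (by omega : ¬ p.s + (i - p.s * p.b) < p.s), if_pos (by omega)]
    omega
  have hcolor : ∀ i < p.l, ∀ j < p.l, p.color F (dig p.q E₁) (dig M E₂) (y i) =
      p.color F (dig p.q E₁) (dig M E₂) (y j) → i = j := by
    intro i hi j hj h
    have key : ∀ i < p.s * p.b, p.color F (dig p.q E₁) (dig M E₂) (y i) < p.s * p.b := by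
      intro i hi
      obtain ⟨hb, h3, h4, h5⟩ := hcolor₁ i hi
      have h5 : (i / p.b + 1) * p.b ≤ p.s * p.b := Nat.mul_le_mul_right _ h3
      rw [add_mul, one_mul] at h5
      omega
    rcases Nat.lt_or_ge i (p.s * p.b) with h1 | h1 <;> rcases Nat.lt_or_ge j (p.s * p.b) with h2 | h2
    · obtain ⟨hb, h3, h4, h5⟩ := hcolor₁ i h1
      obtain ⟨-, h3', h4', h5'⟩ := hcolor₁ j h2
      rw [h5, h5'] at h
      have hdiv : i / p.b = j / p.b := by
        have g1 : (i / p.b * p.b + F (ix (i / p.b)) (y i)) / p.b = i / p.b := by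
          rw [mul_comm, Nat.mul_add_div hb, Nat.div_eq_of_lt h4, add_zero]
        have g2 : (j / p.b * p.b + F (ix (j / p.b)) (y j)) / p.b = j / p.b := by
          rw [mul_comm, Nat.mul_add_div hb, Nat.div_eq_of_lt h4', add_zero]
        rw [← g1, ← g2, h]
      rw [hdiv] at h
      have h := Nat.add_left_cancel h
      have hi_eq : j / p.b * p.b + i % p.b = i := by rw [← hdiv, Nat.div_add_mod']
      have hj_eq : j / p.b * p.b + j % p.b = j := Nat.div_add_mod' _ _
      by_contra hne
      refine (hix _ h3').2.ne (Nat.mod_lt i hb) (Nat.mod_lt j hb) (by omega) ?_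
      simp only [hi_eq, hj_eq]
      exact h
    · have := key i h1
      rw [h, hcolor₂ j hj h2] at this
      omega
    · have := key j h2
      rw [← h, hcolor₂ i hi h1] at this
      omega
    · rwa [hcolor₂ i hi h1, hcolor₂ j hj h2] at h
  intro x hx x' hx' h
  obtain ⟨i, hi, hi'⟩ := hysurj _ (hUY (Finset.mem_image_of_mem _ hx))
  obtain ⟨j, hj, hj'⟩ := hysurj _ (hUY (Finset.mem_image_of_mem _ hx'))
  simp only [← hi', ← hj'] at h
  refine hinj hx hx' ?_
  rw [← hi', ← hj', hcolor i hi j hj h]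

theorem color_lt (hl : 0 < p.l) (F : ℕ → ℕ → ℕ) (th ix : ℕ → ℕ) (y : ℕ) :
    p.color F th ix y < p.l := by
  simp only [color]
  split_ifs <;> assumption

end Params

end While

namespace While

open While.Expr (var lt ne get cond)

/-! ### Counting in base `R` -/

/-- Add one to the number whose digits in base `R` are stored in the array `A`. -/
def inc (A : Arr) (R len : Var) : Cmd :=
  (.carry ≔ 1) ;; .for .i (var len) (.ite (var .carry)
    (.store A (var .i) (get A (var .i) + 1) ;;
      .ite (ne (get A (var .i)) (var R)) (.carry ≔ 0) (.store A (var .i) 0)) .skip)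

/-- There is no test for overflow: the final carry is dropped, so a counter that reaches `R ^ len`
shows only zeros. -/
theorem inc_spec {inp : ℕ → ℕ} {σ : St} {A : Arr} {R len : Var} {E : ℕ}
    (h : [R, len, .carry, .i].Nodup) (hR : 0 < σ.v R)
    (hA : ∀ j < σ.v len, σ.a A j = dig (σ.v R) E j) :
    wp inp (inc A R len) σ fun k σ' => k ≤ 80 * σ.v len + 10 ∧
      ∀ j < σ.v len, σ'.a A j = dig (σ.v R) (E + 1) j := by
  simp only [List.nodup_cons, List.mem_cons, List.not_mem_nil, or_false, not_or] at h
  obtain ⟨⟨h1, h2, h3⟩, ⟨h4, h5⟩, h6, -⟩ := h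
  set N := σ.v len with hN
  set r := σ.v R with hr
  rw [inc, wp_seq, wp_assign]
  -- A carry reaches position `j` iff all digits of `E` below it are maximal, that is, iff `r ^ j`
  -- divides `E + 1`.
  refine wp_for N 65 (fun j σ' => (σ'.v .carry = 0 ↔ ¬ r ^ j ∣ E + 1) ∧
    ∀ i < N, σ'.a A i = if i < j then dig r (E + 1) i else dig r E i) ?_ ?_ ?_ ?_ ?_ ?_ ?_
  · simp [Cmd.modV]
  · simp [Cmd.modV, Expr.vars, h4, h5]
  · simp [Expr.arrs]
  · simp [h4, ← hN]
  · simpa using hA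
  · intro j hj σ' hF hv ⟨hI1, hI2⟩
    have e1 := hF.v R (by simp [Cmd.modV, h2, h3])
    simp only [St.setV_v, if_neg h2, ← hr] at e1
    have hdig : dig r (E + 1) j = (E / r ^ j + if r ^ j ∣ E + 1 then 1 else 0) % r := by
      rw [dig, Nat.succ_div]
    have hpow : r ^ (j + 1) ∣ E + 1 ↔ r ^ j ∣ E + 1 ∧ r ∣ (E + 1) / r ^ j := by
      constructor
      · intro hd
        have hd' : r ^ j ∣ E + 1 := (pow_dvd_pow r (Nat.le_succ j)).trans hd
        refine ⟨hd', ?_⟩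
        rw [pow_succ] at hd
        exact (Nat.dvd_div_iff_mul_dvd hd').2 hd
      · rintro ⟨hd, hd'⟩
        rw [pow_succ]
        exact (Nat.dvd_div_iff_mul_dvd hd).1 hd'
    have hold := hI2 j hj
    rw [if_neg (lt_irrefl _)] at hold
    have hlt : dig r E j < r := dig_lt hR _ _
    have harr : ∀ τ : St, (∀ i, i ≠ j → τ.a A i = σ'.a A i) → τ.a A j = dig r (E + 1) j →
        ∀ i < N, τ.a A i = if i < j + 1 then dig r (E + 1) i else dig r E i := by
      intro τ g1 g2 i hi
      by_cases hij : i = j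
      · rw [hij, g2, if_pos (by omega)]
      · rw [g1 i hij, hI2 i hi]; congr 1; simp only [eq_iff_iff]; omega
    rw [wp_ite]
    refine ⟨fun hc => ?_, fun hc => ?_⟩
    · have hd : r ^ j ∣ E + 1 := by
        by_contra hd
        exact hc (hI1.2 hd)
      rw [if_pos hd] at hdig
      have hsucc : (E + 1) / r ^ j = E / r ^ j + 1 := by rw [Nat.succ_div, if_pos hd]
      rw [wp_seq, wp_store, wp_ite]
      simp only [ne_eq, Expr.eval_ne, Expr.eval_get, Expr.eval_var, Expr.eval_add,
        Expr.eval_ofNat, St.setA_v, St.setA_a_same, if_true, hv, hold, e1]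
      refine ⟨fun hne => ?_, fun he => ?_⟩
      · have hval : dig r (E + 1) j = dig r E j + 1 := by
          rw [hdig, dig, Nat.add_mod, Nat.mod_eq_of_lt (a := E / r ^ j % r + 1 % r)]
          · rw [Nat.mod_eq_of_lt (a := 1)]
            omega
          · rw [Nat.mod_eq_of_lt (a := 1)]
            · simp only [dig] at hlt hne; omega
            · omega
        rw [wp_assign]
        refine ⟨by simp, ?_, ?_⟩
        · simp only [St.setV_v, reduceCtorEq, if_false, if_true, Expr.eval_ofNat, true_iff, hpow,
            not_and]
          intro _ hd'
          have h0 : dig r (E + 1) j = 0 := by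
            rw [dig]; exact Nat.mod_eq_zero_of_dvd hd'
          omega
        · refine harr _ (fun i hi => by simp [hi]) (by simp [hval])
      · have hval : dig r (E + 1) j = 0 := by
          have h0 : (E / r ^ j + 1) % r = (dig r E j + 1) % r := by
            rw [dig, Nat.mod_add_mod]
          rw [hdig, h0, he, Nat.mod_self]
        rw [wp_store]
        refine ⟨by simp, ?_, ?_⟩
        · simp only [St.setV_v, St.setA_v, reduceCtorEq, if_false]
          refine ⟨fun h0 => absurd h0 hc, fun h0 => absurd (hpow.2 ⟨hd, ?_⟩) h0⟩
          exact Nat.dvd_of_mod_eq_zero hval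
        · refine harr _ (fun i hi => by simp [hi, hv]) (by simp [hval, hv])
    · have hd : ¬ r ^ j ∣ E + 1 := hI1.1 hc
      rw [if_neg hd, add_zero] at hdig
      have hdig' : dig r (E + 1) j = dig r E j := hdig
      rw [wp_skip]
      refine ⟨by simp, ?_, harr _ (fun i _ => by simp) (by simp [hold, hdig'])⟩
      simp only [St.setV_v, reduceCtorEq, if_false]
      simp only [Expr.eval_var] at hc
      simp [hc, hpow, hd]
  · intro k σ' hF hv ⟨_, hI⟩ hk
    simp at hk ⊢
    refine ⟨by omega, fun j hj => ?_⟩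
    rw [hI j hj, if_pos hj]

/-! ### Polynomial evaluation -/

/-- Reduce the number `x`, which is less than `2 * q`, modulo `q`. -/
def reduce (x : Var) : Cmd := .ite (lt (var x) (var .q)) .skip (x ≔ var x - var .q)

theorem reduce_spec {inp : ℕ → ℕ} {σ : St} {x : Var} {m : ℕ} (h : σ.v x < 2 * σ.v .q)
    (hm : σ.v x % σ.v .q = m) :
    wp inp (reduce x) σ fun k σ' => k ≤ 8 ∧ σ'.v x = m := by
  rw [reduce, wp_ite]
  simp only [ne_eq, Expr.eval_lt, Expr.eval_var, not_le]
  refine ⟨fun h' => ?_, fun h' => ?_⟩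
  · rw [wp_skip]
    exact ⟨by simp, by rw [← hm, Nat.mod_eq_of_lt h']⟩
  · rw [wp_assign]
    refine ⟨by simp, ?_⟩
    rw [Nat.mod_eq_sub_mod h', Nat.mod_eq_of_lt (by omega)] at hm
    simpa using hm

/-- Evaluate the polynomial whose coefficients are stored in `zd` at all points of the field. -/
def evalPoly : Cmd :=
  .for .y (var .q) (
    (.acc ≔ 0) ;; .for .i (var .b) (
      (.x ≔ 0) ;; .for .k (var .y) ((.x ≔ var .x + var .acc) ;; reduce .x) ;;
      (.acc ≔ var .x + get .zd (var .b - 1 - var .i)) ;; reduce .acc) ;;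
    .store .g (var .y) (get .red (var .acc)))

/-- Horner's rule at every point of the field; each multiplication modulo `q` is a repeated addition
with a reduction after every step. The final reduction modulo `b` is a lookup in `red`. -/
theorem evalPoly_spec {inp : ℕ → ℕ} {σ : St} {p : Params} (hp : p.Good) (hH : Holds p σ) {z : ℕ}
    (hz : z < p.Q) (hzd : ∀ j < p.b, σ.a .zd j = dig p.q z j) :
    wp inp evalPoly σ fun k σ' => k ≤ 200 * (p.q + 1) ^ 3 ∧
      ∀ y < p.q, σ'.a .g y = polyHash p.q y z % p.b := by
  have hq := hp.field.1.two_le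
  have hb : p.b ≤ p.q := p.b_le.trans hp.l_lt_q.le
  set X := p.q + 1 with hX
  have hX2 : 1 ≤ X ^ 2 := Nat.one_le_pow _ _ (by omega)
  refine wp_for p.q (120 * X ^ 2) (fun y σ' => ∀ y' < y, σ'.a .g y' = polyHash p.q y' z % p.b)
    (by decide) (by decide) (by decide) (by simp [hH.q]) (by simp) ?_ ?_
  · intro y hy σ₁ hF₁ hv₁ hI₁
    have hH₁ := hH.frame hF₁ (by decide) (by decide)
    have hzd₁ := hF₁.a .zd (by decide)
    rw [wp_seq, wp_assign, wp_seq]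
    refine wp_for p.b (65 * X ^ 1)
      -- After `i` rounds the leading `i` coefficients have been used, and `z / q ^ (b - i)` is the
      -- polynomial that they form.
      (fun i σ' => σ'.v .acc = polyHash p.q y (z / p.q ^ (p.b - i)))
      (by decide) (by decide) (by decide) (by simp [hH₁.b]) ?_ ?_ ?_
    · rw [Nat.sub_zero, ← Params.Q, Nat.div_eq_of_lt hz]
      simp
    · intro i hi σ₂ hF₂ hv₂ hI₂
      have hH₂ := (hH₁.setV (by decide) _).frame hF₂ (by decide) (by decide)
      have hzd₂ := hF₂.a .zd (by decide)
      have hy₂ := hF₂.v .y (by decide)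
      simp only [St.setV_a, St.setV_v, reduceCtorEq, if_false] at hzd₂ hy₂
      have haccq : σ₂.v .acc < p.q := by rw [hI₂]; exact polyHash_lt (by omega) _ _
      rw [wp_seq, wp_assign, wp_seq]
      refine wp_for y 20 (fun k σ' => σ'.v .x = (k * σ₂.v .acc) % p.q)
        (by decide) (by decide) (by decide) (by simp [hy₂, hv₁]) (by simp) ?_ ?_
      · intro k hk σ₃ hF₃ hv₃ hI₃
        have hacc₃ := hF₃.v .acc (by decide)
        have hq₃ := hF₃.v .q (by decide)
        simp only [St.setV_v, reduceCtorEq, if_false, hH₂.q] at hacc₃ hq₃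
        rw [wp_seq, wp_assign]
        refine (reduce_spec (m := ((k + 1) * σ₂.v .acc) % p.q) ?_ ?_).mono ?_
        · simp [hI₃, hacc₃, hq₃]
          have := Nat.mod_lt (k * σ₂.v .acc) (by omega : 0 < p.q)
          omega
        · simp [hI₃, hacc₃, hq₃, add_mul]
        · rintro k' σ₄ ⟨hk', hx⟩
          simp [hx]
          omega
      · intro k₃ σ₃ hF₃ hv₃ hI₃ hk₃
        have hH₃ := (hH₂.setV (by decide) _).frame hF₃ (by decide) (by decide)
        have hzd₃ := hF₃.a .zd (by decide)
        have hi₃ := hF₃.v .i (by decide)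
        simp only [St.setV_a, St.setV_v, reduceCtorEq, if_false, hv₂] at hzd₃ hi₃
        have hm : p.b - 1 - i < p.b := by omega
        have hstep : p.q ^ (p.b - i) = p.q ^ (p.b - 1 - i) * p.q := by
          rw [← pow_succ]; congr 1; omega
        have hdig : σ₃.a .zd (p.b - 1 - i) = dig p.q z (p.b - 1 - i) := by
          rw [hzd₃, hzd₂, hzd₁, hzd _ hm]
        rw [wp_seq, wp_assign]
        refine (reduce_spec (m := polyHash p.q y (z / p.q ^ (p.b - (i + 1)))) ?_ ?_).mono ?_
        · have h1 := Nat.mod_lt (y * σ₂.v .acc) (by omega : 0 < p.q)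
          have h2 := dig_lt (by omega : 0 < p.q) z (p.b - 1 - i)
          simp [hH₃.q, hH₃.b, hi₃, hI₃, hdig]
          omega
        · simp [hH₃.q, hH₃.b, hi₃, hI₃, hdig]
          rw [show p.b - (i + 1) = p.b - 1 - i by omega, polyHash_rec hq y (z / p.q ^ (p.b - 1 - i)),
            Nat.div_div_eq_div_mul, ← hstep, ← hI₂, dig, add_comm]
        · rintro k' σ₄ ⟨hk', hx⟩
          simp [hx] at hk₃ ⊢
          omega
    · intro k₂ σ₂ hF₂ hv₂ hI₂ hk₂
      rw [Nat.sub_self, pow_zero, Nat.div_one] at hI₂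
      have hH₂ := (hH₁.setV (by decide) _).frame hF₂ (by decide) (by decide)
      have hy₂ := hF₂.v .y (by decide)
      have hg₂ := hF₂.a .g (by decide)
      simp only [St.setV_a, St.setV_v, reduceCtorEq, if_false] at hg₂ hy₂
      have := for_time (N := p.b) (X := X) (c := 65) (d := 1) (j := 1) (by omega) le_rfl (by omega)
      rw [wp_store]
      simp at hk₂ this ⊢
      refine ⟨by omega, fun y' hy' => ?_⟩
      rw [hy₂, hv₁, hI₂, hg₂, hH₂.red _ (polyHash_lt (by omega) _ _)]
      split_ifs with h
      · rw [h]
      · exact hI₁ y' (by omega)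
  · intro k σ' hF hv hI hk
    have := for_time (N := p.q) (X := X) (c := 120) (d := 1) (j := 2) (by omega) le_rfl (by omega)
    have h1 : 1 ≤ X ^ 3 := Nat.one_le_pow _ _ (by omega)
    simp at hk this ⊢
    exact ⟨by omega, hI⟩

/-! ### Counting separated tuples -/

/-- `ok := 1` if the function stored in `g` separates the tuple stored in `td`, and `ok := 0`
otherwise. -/
def separated : Cmd :=
  (.ok ≔ 1) ;; .for .i (var .b) (.for .j (var .i)
    (.ite (ne (get .g (get .td (var .i))) (get .g (get .td (var .j)))) .skip (.ok ≔ 0)))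

open Classical in
theorem separated_spec {inp : ℕ → ℕ} {σ : St} :
    wp inp separated σ fun k σ' => k ≤ 200 * (σ.v .b + 1) ^ 2 ∧
      σ'.v .ok = if Separates (σ.a .g) (σ.v .b) (σ.a .td) then 1 else 0 := by
  rw [separated, wp_seq, wp_assign]
  set b := σ.v .b with hb
  set X := b + 1 with hX
  have hX1 : 1 ≤ X ^ 2 := Nat.one_le_pow _ _ (by omega)
  refine wp_for b (120 * X ^ 1) (fun i σ' => σ'.v .ok =
      if Separates (σ.a .g) i (σ.a .td) then 1 else 0)
    (by decide) (by decide) (by decide) (by simp [hb]) (by simp [Separates]) ?_ ?_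
  · intro i hi σ₁ hF₁ hv₁ hI₁
    have hg₁ := hF₁.a .g (by decide)
    have ht₁ := hF₁.a .td (by decide)
    simp only [St.setV_a] at hg₁ ht₁
    refine wp_for i 80 (fun j σ' => σ'.v .ok = if Separates (σ.a .g) i (σ.a .td) ∧
        ∀ j' < j, σ.a .g (σ.a .td i) ≠ σ.a .g (σ.a .td j') then 1 else 0)
      (by decide) (by decide) (by decide) (by simp [hv₁]) (by simp [hI₁]) ?_ ?_
    · intro j hj σ₂ hF₂ hv₂ hI₂
      have hg₂ := hF₂.a .g (by decide)
      have ht₂ := hF₂.a .td (by decide)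
      have hi₂ := hF₂.v .i (by decide)
      simp only [St.setV_a, St.setV_v, reduceCtorEq, if_false, hg₁, ht₁, hv₁] at hg₂ ht₂ hi₂
      rw [wp_ite]
      simp only [ne_eq, Expr.eval_ne, Expr.eval_get, Expr.eval_var, hg₂, ht₂, hi₂, hv₂]
      refine ⟨fun h => ?_, fun h => ?_⟩
      · rw [wp_skip]
        refine ⟨by simp, ?_⟩
        simp only [St.setV_v, reduceCtorEq, if_false, hI₂, ne_eq, Nat.forall_lt_succ_right]
        simp [h]
      · rw [wp_assign]
        refine ⟨by simp, ?_⟩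
        simp only [St.setV_v, reduceCtorEq, if_false, if_true, ne_eq, Nat.forall_lt_succ_right]
        simp [h]
    · intro k σ₂ hF₂ hv₂ hI₂ hk
      simp at hk ⊢
      refine ⟨by omega, ?_⟩
      rw [hI₂]
      congr 1
      rw [Separates, Separates, Nat.forall_lt_succ_right]
  · intro k σ' hF hv hI hk
    have := for_time (N := b) (X := X) (c := 120) (d := 1) (j := 1) (by omega) le_rfl (by omega)
    simp at hk this ⊢
    exact ⟨by omega, hI⟩

end While

namespace While

open While.Expr (var lt ne get cond)

/-! ### The greedy construction of a perfect hash family -/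

/-- The number of tuples outside `dead` that `g` separates. -/
noncomputable def numSep (p : Params) (dead g : ℕ → ℕ) : ℕ := by
  classical exact ((Finset.range p.Q).filter fun t =>
    dead t = 0 ∧ Separates g p.b (dig p.q t)).card

/-- `cnt` becomes the number of tuples that are not dead and that `g` separates. -/
def countSep : Cmd :=
  (.cnt ≔ 0) ;; .for .t (var .Q)
    (.ite (get .dead (var .t)) .skip (separated ;; (.cnt ≔ var .cnt + var .ok)) ;; inc .td .q .b)

/-- At the end of a scan over all tuples the digit counter has wrapped around to zero, so the next
scan needs no initialization. -/
theorem dig_Q {p : Params} (hq : 0 < p.q) {j : ℕ} (hj : j < p.b) : dig p.q p.Q j = 0 := by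
  rw [dig, Params.Q, Nat.pow_div hj.le hq]
  have : p.q ∣ p.q ^ (p.b - j) := dvd_pow_self _ (by omega)
  exact Nat.mod_eq_zero_of_dvd this

theorem dig_zero_left (R j : ℕ) : dig R 0 j = 0 := by simp [dig]

theorem countSep_spec {inp : ℕ → ℕ} {σ : St} {p : Params} (hp : p.Good) (hH : Holds p σ)
    (htd : ∀ j < p.b, σ.a .td j = 0) :
    wp inp countSep σ fun k σ' => k ≤ 400 * (p.Q + 1) * (p.q + 1) ^ 2 ∧
      σ'.v .cnt = numSep p (σ.a .dead) (σ.a .g) ∧ ∀ j < p.b, σ'.a .td j = 0 := by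
  classical
  have hq := hp.field.1.two_le
  have hb : p.b ≤ p.q := p.b_le.trans hp.l_lt_q.le
  set X := p.q + 1 with hX
  have hX1 : X ≤ X ^ 2 := Nat.le_self_pow (by norm_num) _
  rw [countSep, wp_seq, wp_assign]
  refine wp_for p.Q (350 * X ^ 2) (fun t σ' => (∀ j < p.b, σ'.a .td j = dig p.q t j) ∧
      σ'.v .cnt = ((Finset.range t).filter fun t =>
        σ.a .dead t = 0 ∧ Separates (σ.a .g) p.b (dig p.q t)).card)
    (by decide) (by decide) (by decide) (by simp [hH.Q]) ?_ ?_ ?_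
  · simpa [dig_zero_left] using htd
  · intro t ht σ₁ hF₁ hv₁ ⟨hI₁, hI₂⟩
    have hH₁ := (hH.setV (by decide) _).frame hF₁ (by decide) (by decide)
    have hg₁ := hF₁.a .g (by decide)
    have hd₁ := hF₁.a .dead (by decide)
    simp only [St.setV_a] at hg₁ hd₁
    have hX2 : 80 * p.b + 10 ≤ 80 * X ^ 2 := by omega
    have hX3 : 200 * (p.b + 1) ^ 2 ≤ 200 * X ^ 2 :=
      Nat.mul_le_mul_left _ (Nat.pow_le_pow_left (by omega) _)
    have hstep : ((Finset.range (t + 1)).filter fun t =>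
        σ.a .dead t = 0 ∧ Separates (σ.a .g) p.b (dig p.q t)).card =
        ((Finset.range t).filter fun t =>
        σ.a .dead t = 0 ∧ Separates (σ.a .g) p.b (dig p.q t)).card +
        if σ.a .dead t = 0 ∧ Separates (σ.a .g) p.b (dig p.q t) then 1 else 0 := by
      rw [Finset.range_add_one, Finset.filter_insert]
      split_ifs with h
      · rw [Finset.card_insert_of_notMem (by simp)]
      · rfl
    rw [wp_seq, wp_ite]
    refine ⟨fun h => ?_, fun h => ?_⟩
    · simp only [Expr.eval_get, Expr.eval_var, hv₁, hd₁] at h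
      rw [wp_skip]
      refine (inc_spec (E := t) (by decide) (by rw [hH₁.q]; omega) (by
        rw [hH₁.b, hH₁.q]; exact hI₁)).frame.mono ?_
      rintro k σ₂ ⟨⟨hk, hI⟩, hF₂⟩
      have hc := hF₂.v .cnt (by decide)
      rw [hH₁.b] at hk hI
      rw [hH₁.q] at hI
      refine ⟨?_, by simpa using hI, ?_⟩
      · simp; omega
      · simp only [St.setV_v, reduceCtorEq, if_false, hc, hI₂]
        rw [hstep, if_neg (fun h' => h h'.1), add_zero]
    · simp only [Expr.eval_get, Expr.eval_var, hv₁, hd₁] at h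
      rw [wp_seq]
      refine separated_spec.frame.mono ?_
      rintro k₂ σ₂ ⟨⟨hk₂, hok₂⟩, hF₂⟩
      rw [wp_assign]
      have hc := hF₂.v .cnt (by decide)
      have hH₂ := hH₁.frame hF₂ (by decide) (by decide)
      have hH₃ := hH₂.setV (x := .cnt) (by decide) ((var .cnt + var .ok : Expr).eval inp σ₂)
      have htd₂ := hF₂.a .td (by decide)
      refine (inc_spec (E := t) (by decide) (by rw [hH₃.q]; omega) (by
        rw [hH₃.b, hH₃.q, St.setV_a, htd₂]; exact hI₁)).frame.mono ?_
      rintro k σ₃ ⟨⟨hk, hI⟩, hF₃⟩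
      have hc₃ := hF₃.v .cnt (by decide)
      rw [hH₃.b] at hk hI
      rw [hH₃.q] at hI
      rw [hH₁.b] at hk₂ hok₂
      have hsep : Separates (σ₁.a .g) p.b (σ₁.a .td) ↔
          (σ.a .dead t = 0 ∧ Separates (σ.a .g) p.b (dig p.q t)) := by
        rw [and_iff_right h, hg₁]
        exact separates_congr fun i hi => by rw [hI₁ i hi]
      refine ⟨?_, by simpa using hI, ?_⟩
      · simp; omega
      · simp [hc₃, hc, hI₂, hok₂]
        rw [hstep]
        congr 1
        simp only [hsep]
  · intro k σ' hF hv ⟨hI₁, hI₂⟩ hk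
    refine ⟨?_, ?_, fun j hj => ?_⟩
    · simp at hk ⊢
      have h1 : p.Q * (350 * X ^ 2 + 1 + 7) ≤ p.Q * (360 * X ^ 2) :=
        Nat.mul_le_mul_left _ (by omega)
      have h2 : 400 * (p.Q + 1) * X ^ 2 = 400 * (p.Q * X ^ 2) + 400 * X ^ 2 := by ring
      have h3 : p.Q * (360 * X ^ 2) = 360 * (p.Q * X ^ 2) := by ring
      omega
    · rw [hI₂, numSep]
    · rw [hI₁ j hj, dig_Q (by omega) hj]

/-- Find the polynomial that separates the largest number of tuples. -/
def findBest : Cmd :=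
  (.best ≔ 0) ;; .for .z (var .Q) (evalPoly ;; countSep ;;
    .ite (lt (var .best) (var .cnt))
      ((.best ≔ var .cnt) ;; .for .y (var .q) (.store .bg (var .y) (get .g (var .y)))) .skip ;;
    inc .zd .q .b)

theorem numSep_congr {p : Params} (hq : 0 < p.q) {dead g g' : ℕ → ℕ}
    (h : ∀ y < p.q, g y = g' y) : numSep p dead g = numSep p dead g' := by
  classical
  rw [numSep, numSep]
  congr 1
  refine Finset.filter_congr fun t _ => and_congr_right fun _ => separates_congr fun i _ => ?_
  exact h _ (dig_lt hq _ _)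

/-- The hash function of the polynomial with the number `z`. -/
def Params.row (p : Params) (z y : ℕ) : ℕ := polyHash p.q y z % p.b

/-- The contents of `bg` are described only if `best` is nonzero: a first maximum of 0 is never
stored. The value 0 serves as the stopping signal of the greedy loop. -/
theorem findBest_spec {inp : ℕ → ℕ} {σ : St} {p : Params} (hp : p.Good) (hH : Holds p σ)
    (htd : ∀ j < p.b, σ.a .td j = 0) (hzd : ∀ j < p.b, σ.a .zd j = 0) :
    wp inp findBest σ fun k σ' => k ≤ 1000 * (p.Q + 1) ^ 2 * (p.q + 1) ^ 3 ∧
      (∀ j < p.b, σ'.a .td j = 0) ∧ (∀ j < p.b, σ'.a .zd j = 0) ∧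
      (∀ z < p.Q, numSep p (σ.a .dead) (p.row z) ≤ σ'.v .best) ∧
      (σ'.v .best ≠ 0 → ∃ z < p.Q, σ'.v .best = numSep p (σ.a .dead) (p.row z) ∧
        ∀ y < p.q, σ'.a .bg y = p.row z y) := by
  have hq := hp.field.1.two_le
  have hb : p.b ≤ p.q := p.b_le.trans hp.l_lt_q.le
  set X := p.q + 1 with hX
  have hX1 : X ≤ X ^ 3 := Nat.le_self_pow (by norm_num) _
  have hX2 : X ^ 2 ≤ X ^ 3 := Nat.pow_le_pow_right (by omega) (by norm_num)
  rw [findBest, wp_seq, wp_assign]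
  refine wp_for p.Q (800 * (p.Q + 1) * X ^ 3) (fun z σ' => (∀ j < p.b, σ'.a .td j = 0) ∧
      (∀ j < p.b, σ'.a .zd j = dig p.q z j) ∧
      (∀ z' < z, numSep p (σ.a .dead) (p.row z') ≤ σ'.v .best) ∧
      (σ'.v .best ≠ 0 → ∃ z < p.Q, σ'.v .best = numSep p (σ.a .dead) (p.row z) ∧
        ∀ y < p.q, σ'.a .bg y = p.row z y))
    (by decide) (by decide) (by decide) (by simp [hH.Q]) ?_ ?_ ?_
  · simpa [dig_zero_left] using ⟨htd, hzd⟩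
  · intro z hz σ₁ hF₁ hv₁ ⟨hI1, hI2, hI3, hI4⟩
    have hH₁ := (hH.setV (by decide) _).frame hF₁ (by decide) (by decide)
    have hd₁ := hF₁.a .dead (by decide)
    simp only [St.setV_a] at hd₁
    rw [wp_seq]
    refine (evalPoly_spec hp hH₁ hz hI2).frame.mono ?_
    rintro k₂ σ₂ ⟨⟨hk₂, hg₂⟩, hF₂⟩
    rw [← hX] at hk₂
    have hH₂ := hH₁.frame hF₂ (by decide) (by decide)
    have htd₂ := hF₂.a .td (by decide)
    have hd₂ := (hF₂.a .dead (by decide)).trans hd₁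
    rw [wp_seq]
    refine (countSep_spec hp hH₂ (by rw [htd₂]; exact hI1)).frame.mono ?_
    rintro k₃ σ₃ ⟨⟨hk₃, hcnt₃, htd₃⟩, hF₃⟩
    have hH₃ := hH₂.frame hF₃ (by decide) (by decide)
    have hcnt : σ₃.v .cnt = numSep p (σ.a .dead) (p.row z) := by
      rw [hcnt₃, hd₂]; exact numSep_congr (by omega) hg₂
    have hbest : σ₃.v .best = σ₁.v .best :=
      (hF₃.v .best (by decide)).trans (hF₂.v .best (by decide))
    have hbg : σ₃.a .bg = σ₁.a .bg :=
      (hF₃.a .bg (by decide)).trans (hF₂.a .bg (by decide))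
    have hzd : σ₃.a .zd = σ₁.a .zd :=
      (hF₃.a .zd (by decide)).trans (hF₂.a .zd (by decide))
    have hg : σ₃.a .g = σ₂.a .g := hF₃.a .g (by decide)
    have hk₃' : k₃ ≤ 400 * (p.Q + 1) * X ^ 3 := hk₃.trans (Nat.mul_le_mul_left _ hX2)
    have hQX : X ^ 3 ≤ (p.Q + 1) * X ^ 3 := Nat.le_mul_of_pos_left _ (by omega)
    have hassoc1 : 400 * (p.Q + 1) * X ^ 3 = 400 * ((p.Q + 1) * X ^ 3) := by ring
    have hassoc2 : 800 * (p.Q + 1) * X ^ 3 = 800 * ((p.Q + 1) * X ^ 3) := by ring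
    rw [hassoc1] at hk₃'
    rw [hassoc2]
    have finish : ∀ τ : St, Holds p τ →
        (∀ j < p.b, τ.a .td j = 0) → (∀ j < p.b, τ.a .zd j = dig p.q z j) →
        (∀ z' < z + 1, numSep p (σ.a .dead) (p.row z') ≤ τ.v .best) →
        (τ.v .best ≠ 0 → ∃ z < p.Q, τ.v .best = numSep p (σ.a .dead) (p.row z) ∧
          ∀ y < p.q, τ.a .bg y = p.row z y) →
        wp inp (inc .zd .q .b) τ fun k σ'' => k ≤ 80 * p.b + 10 ∧
          (∀ j < p.b, (σ''.setV .z (z + 1)).a .td j = 0) ∧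
          (∀ j < p.b, (σ''.setV .z (z + 1)).a .zd j = dig p.q (z + 1) j) ∧
          (∀ z' < z + 1, numSep p (σ.a .dead) (p.row z') ≤ (σ''.setV .z (z + 1)).v .best) ∧
          ((σ''.setV .z (z + 1)).v .best ≠ 0 → ∃ z' < p.Q, (σ''.setV .z (z + 1)).v .best =
            numSep p (σ.a .dead) (p.row z') ∧
            ∀ y < p.q, (σ''.setV .z (z + 1)).a .bg y = p.row z' y) := by
      intro τ hHτ h1 h2 h3 h4
      refine (inc_spec (E := z) (by decide) (by rw [hHτ.q]; omega) (by
        rw [hHτ.b, hHτ.q]; exact h2)).frame.mono ?_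
      rintro k τ' ⟨⟨hk, hI⟩, hF⟩
      rw [hHτ.b] at hk hI
      rw [hHτ.q] at hI
      have g1 := hF.a .td (by decide)
      have g2 := hF.a .bg (by decide)
      have g3 := hF.v .best (by decide)
      refine ⟨hk, ?_⟩
      simp only [St.setV_a, St.setV_v, reduceCtorEq, if_false, g1, g2, g3]
      exact ⟨h1, hI, h3, h4⟩
    rw [wp_seq, wp_ite]
    refine ⟨fun h => ?_, fun h => ?_⟩
    · simp only [ne_eq, Expr.eval_lt, Expr.eval_var, not_le, hbest, hcnt] at h
      rw [wp_seq, wp_assign]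
      refine wp_for p.q 20 (fun y σ' => ∀ y' < y, σ'.a .bg y' = p.row z y')
        (by decide) (by decide) (by decide) (by simp [hH₃.q]) (by simp) ?_ ?_
      · intro y hy σ₄ hF₄ hv₄ hI₄
        have hg₄ := hF₄.a .g (by decide)
        simp only [St.setV_a] at hg₄
        rw [wp_store]
        refine ⟨by simp, fun y' hy' => ?_⟩
        simp [hv₄, hg₄, hg]
        split_ifs with he
        · rw [he, hg₂ y hy]; rfl
        · exact hI₄ y' (by omega)
      · intro k₄ σ₄ hF₄ hv₄ hI₄ hk₄
        have hH₄ := (hH₃.setV (by decide) _).frame hF₄ (by decide) (by decide)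
        have hb₄ := hF₄.v .best (by decide)
        have htd₄ := hF₄.a .td (by decide)
        have hzd₄ := hF₄.a .zd (by decide)
        simp only [St.setV_a, St.setV_v, if_true, Expr.eval_var, hcnt] at hb₄ htd₄ hzd₄
        refine (finish σ₄ hH₄ (by rw [htd₄]; exact htd₃) (by rw [hzd₄, hzd]; exact hI2)
          (fun z' hz' => ?_) (fun _ => ⟨z, hz, hb₄, hI₄⟩)).mono fun k σ'' h => ⟨?_, h.2⟩
        rotate_left
        · have := h.1
          simp at hk₄ ⊢
          omega
        · rw [hb₄]
          rcases Nat.lt_succ_iff_lt_or_eq.1 hz' with h' | h'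
          · exact (hI3 z' h').trans h.le
          · rw [h']
    · simp only [Expr.eval_lt, Expr.eval_var, hbest, hcnt] at h
      rw [wp_skip]
      refine (finish σ₃ hH₃ htd₃ (by rw [hzd]; exact hI2) (fun z' hz' => ?_)
        (by rw [hbest, hbg]; exact hI4)).mono fun k σ'' h => ⟨?_, h.2⟩
      rotate_left
      · have := h.1
        simp
        omega
      · rw [hbest]
        rcases Nat.lt_succ_iff_lt_or_eq.1 hz' with h' | h'
        · exact hI3 z' h'
        · rw [h']; exact h
  · intro k σ' hF hv ⟨hI1, hI2, hI3, hI4⟩ hk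
    refine ⟨?_, hI1, fun j hj => ?_, hI3, hI4⟩
    · have h1 : p.Q * (800 * (p.Q + 1) * X ^ 3 + 1 + 7) ≤ p.Q * (900 * ((p.Q + 1) * X ^ 3)) := by
        refine Nat.mul_le_mul_left _ ?_
        have : X ^ 3 ≤ (p.Q + 1) * X ^ 3 := Nat.le_mul_of_pos_left _ (by omega)
        have : 800 * (p.Q + 1) * X ^ 3 = 800 * ((p.Q + 1) * X ^ 3) := by ring
        omega
      have h2 : 1000 * (p.Q + 1) ^ 2 * X ^ 3 = p.Q * (900 * ((p.Q + 1) * X ^ 3)) +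
        100 * p.Q * ((p.Q + 1) * X ^ 3) + 1000 * ((p.Q + 1) * X ^ 3) := by ring
      have h3 : X ^ 3 ≤ (p.Q + 1) * X ^ 3 := Nat.le_mul_of_pos_left _ (by omega)
      simp at hk ⊢
      omega
    · rw [hI2 j hj, dig_Q (by omega) hj]

/-- Mark the tuples that `g` separates as dead. -/
def kill : Cmd :=
  .for .t (var .Q) (separated ;; .ite (var .ok) (.store .dead (var .t) 1) .skip ;; inc .td .q .b)

theorem kill_spec {inp : ℕ → ℕ} {σ : St} {p : Params} (hp : p.Good) (hH : Holds p σ)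
    (htd : ∀ j < p.b, σ.a .td j = 0) :
    wp inp kill σ fun k σ' => k ≤ 400 * (p.Q + 1) * (p.q + 1) ^ 2 ∧
      (∀ t < p.Q, σ'.a .dead t = 0 ↔
        σ.a .dead t = 0 ∧ ¬ Separates (σ.a .g) p.b (dig p.q t)) ∧
      ∀ j < p.b, σ'.a .td j = 0 := by
  classical
  have hq := hp.field.1.two_le
  have hb : p.b ≤ p.q := p.b_le.trans hp.l_lt_q.le
  set X := p.q + 1 with hX
  have hX1 : X ≤ X ^ 2 := Nat.le_self_pow (by norm_num) _
  refine wp_for p.Q (350 * X ^ 2) (fun t σ' => (∀ j < p.b, σ'.a .td j = dig p.q t j) ∧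
      ∀ t', (σ'.a .dead t' = 0 ↔
        σ.a .dead t' = 0 ∧ (t' < t → ¬ Separates (σ.a .g) p.b (dig p.q t'))))
    (by decide) (by decide) (by decide) (by simp [hH.Q]) ?_ ?_ ?_
  · simpa [dig_zero_left] using htd
  · intro t ht σ₁ hF₁ hv₁ ⟨hI₁, hI₂⟩
    have hH₁ := hH.frame hF₁ (by decide) (by decide)
    have hg₁ := hF₁.a .g (by decide)
    have hX2 : 80 * p.b + 10 ≤ 80 * X ^ 2 := by omega
    have hX3 : 200 * (p.b + 1) ^ 2 ≤ 200 * X ^ 2 :=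
      Nat.mul_le_mul_left _ (Nat.pow_le_pow_left (by omega) _)
    rw [wp_seq]
    refine separated_spec.frame.mono ?_
    rintro k₂ σ₂ ⟨⟨hk₂, hok₂⟩, hF₂⟩
    have hH₂ := hH₁.frame hF₂ (by decide) (by decide)
    have htd₂ := hF₂.a .td (by decide)
    have hd₂ := hF₂.a .dead (by decide)
    have ht₂ := hF₂.v .t (by decide)
    rw [hH₁.b] at hk₂ hok₂
    have hsep : Separates (σ₁.a .g) p.b (σ₁.a .td) ↔ Separates (σ.a .g) p.b (dig p.q t) := by
      rw [hg₁]
      exact separates_congr fun i hi => by rw [hI₁ i hi]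
    have finish : ∀ τ : St, Holds p τ →
        (∀ j < p.b, τ.a .td j = dig p.q t j) →
        (∀ t', (τ.a .dead t' = 0 ↔
          σ.a .dead t' = 0 ∧ (t' < t + 1 → ¬ Separates (σ.a .g) p.b (dig p.q t')))) →
        wp inp (inc .td .q .b) τ fun k σ'' => k ≤ 80 * p.b + 10 ∧
          (∀ j < p.b, (σ''.setV .t (t + 1)).a .td j = dig p.q (t + 1) j) ∧
          (∀ t', ((σ''.setV .t (t + 1)).a .dead t' = 0 ↔
          σ.a .dead t' = 0 ∧ (t' < t + 1 → ¬ Separates (σ.a .g) p.b (dig p.q t')))) := by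
      intro τ hHτ h1 h2
      refine (inc_spec (E := t) (by decide) (by rw [hHτ.q]; omega) (by
        rw [hHτ.b, hHτ.q]; exact h1)).frame.mono ?_
      rintro k τ' ⟨⟨hk, hI⟩, hF⟩
      rw [hHτ.b] at hk hI
      rw [hHτ.q] at hI
      have g1 := hF.a .dead (by decide)
      refine ⟨hk, by simpa using hI, ?_⟩
      rw [St.setV_a, g1]
      exact h2
    rw [wp_seq, wp_ite]
    refine ⟨fun h => ?_, fun h => ?_⟩
    · simp only [Expr.eval_var, hok₂, hsep, ne_eq, ite_eq_right_iff, one_ne_zero, imp_false,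
        not_not] at h
      rw [wp_store]
      refine (finish _ (hH₂.setA (A := .dead) (by decide) _ _) ?_ fun t' => ?_).mono
        fun k σ'' h => ⟨?_, h.2⟩
      rotate_right
      · have := h.1
        simp
        omega
      · simpa [htd₂] using hI₁
      · simp only [St.setA_a_same, Expr.eval_var, Expr.eval_ofNat, ht₂, hv₁, hd₂]
        split_ifs with he
        · subst he; simp [h]
        · rw [hI₂]
          refine and_congr_right fun _ => ?_
          have : t' < t + 1 ↔ t' < t := by omega
          rw [this]
    · simp only [Expr.eval_var, hok₂, hsep, ite_eq_right_iff, one_ne_zero, imp_false] at h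
      rw [wp_skip]
      refine (finish _ hH₂ ?_ fun t' => ?_).mono fun k σ'' h => ⟨?_, h.2⟩
      rotate_right
      · have := h.1
        simp
        omega
      · simpa [htd₂] using hI₁
      · rw [hd₂, hI₂]
        refine and_congr_right fun _ => ?_
        constructor
        · intro h' hlt
          rcases Nat.lt_succ_iff_lt_or_eq.1 hlt with h'' | h''
          · exact h' h''
          · rwa [h'']
        · exact fun h' hlt => h' (by omega)
  · intro k σ' hF hv ⟨hI₁, hI₂⟩ hk
    refine ⟨?_, fun t ht => ?_, fun j hj => ?_⟩
    · simp at hk ⊢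
      have h1 : p.Q * (350 * X ^ 2 + 1 + 7) ≤ p.Q * (360 * X ^ 2) :=
        Nat.mul_le_mul_left _ (by omega)
      have h2 : 400 * (p.Q + 1) * X ^ 2 = 400 * (p.Q * X ^ 2) + 400 * X ^ 2 := by ring
      have h3 : p.Q * (360 * X ^ 2) = 360 * (p.Q * X ^ 2) := by ring
      omega
    · rw [hI₂]
      simp [ht]
    · rw [hI₁ j hj, dig_Q (by omega) hj]

end While

/-! ### The greedy loop and the decay of the number of unseparated tuples -/

namespace While

open While.Expr (var lt ne get cond)

/-- Collect polynomials, until every tuple of distinct field elements is separated by one of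
them. -/
def greedy : Cmd :=
  (.M ≔ 0) ;; (.fb ≔ 0) ;; (.go ≔ 1) ;; .loop (var .go) (findBest ;; .ite (var .best)
    (.for .y (var .q) (.store .ft (var .fb + var .y) (get .bg (var .y)) ;;
        .store .g (var .y) (get .bg (var .y))) ;;
      (.fb ≔ var .fb + var .q) ;; (.M ≔ var .M + 1) ;; kill)
    (.go ≔ 0))

open Classical in
/-- The tuples of distinct elements outside `dead`. -/
noncomputable def alive (p : Params) (dead : ℕ → ℕ) : Finset ℕ :=
  (Finset.range p.Q).filter fun t => dead t = 0 ∧ Separates id p.b (dig p.q t)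

theorem separates_id {g y : ℕ → ℕ} {b : ℕ} (h : Separates g b y) : Separates id b y :=
  fun i hi j hj e => h i hi j hj (congrArg g e)

/-- Some polynomial separates at least the expected number of tuples. -/
theorem alive_mul_le {p : Params} (hp : p.Good) {dead : ℕ → ℕ} {m : ℕ}
    (hm : ∀ z < p.Q, numSep p dead (p.row z) ≤ m) :
    (alive p dead).card * numSeparating p.q p.b ≤ m * p.Q := by
  classical
  have h1 : ∑ z ∈ Finset.range p.Q, numSep p dead (p.row z) ≤ m * p.Q := by
    refine (Finset.sum_le_card_nsmul _ _ m fun z hz => hm z (Finset.mem_range.1 hz)).trans ?_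
    rw [Finset.card_range, smul_eq_mul, mul_comm]
  refine le_trans ?_ h1
  have h2 : ∀ z ∈ Finset.range p.Q, numSep p dead (p.row z) =
      ((alive p dead).filter fun t => Separates (p.row z) p.b (dig p.q t)).card := by
    intro z _
    rw [numSep, alive, Finset.filter_filter]
    congr 1
    refine Finset.filter_congr fun t _ => ?_
    exact ⟨fun h => ⟨⟨h.1, separates_id h.2⟩, h.2⟩, fun h => ⟨h.1.1, h.2⟩⟩
  rw [Finset.sum_congr rfl h2]
  simp only [Finset.card_filter]
  rw [Finset.sum_comm, ← smul_eq_mul]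
  refine Finset.card_nsmul_le_sum _ _ _ fun t ht => ?_
  rw [← Finset.card_filter]
  have ht := (Finset.mem_filter.1 ht).2.2
  exact numSeparating_le hp.field.1 (fun i _ => dig_lt hp.field.1.pos _ _) ht

theorem alive_card_eq {p : Params} {dead dead' g : ℕ → ℕ}
    (h : ∀ t < p.Q, dead' t = 0 ↔ dead t = 0 ∧ ¬ Separates g p.b (dig p.q t)) :
    (alive p dead).card = (alive p dead').card + numSep p dead g := by
  classical
  rw [alive, alive, numSep, ← Finset.card_union_of_disjoint]
  · congr 1
    ext t
    simp only [Finset.mem_filter, Finset.mem_union, Finset.mem_range]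
    constructor
    · rintro ⟨h1, h2, h3⟩
      by_cases h4 : Separates g p.b (dig p.q t)
      · exact .inr ⟨h1, h2, h4⟩
      · exact .inl ⟨h1, (h t h1).2 ⟨h2, h4⟩, h3⟩
    · rintro (⟨h1, h2, h3⟩ | ⟨h1, h2, h3⟩)
      · exact ⟨h1, ((h t h1).1 h2).1, h3⟩
      · exact ⟨h1, h2, separates_id h3⟩
  · rw [Finset.disjoint_filter]
    intro t ht h1 h2
    exact ((h t (Finset.mem_range.1 ht)).1 h1.1).2 h2.2

/-- The state of the greedy construction. -/
structure GreedyInv (p : Params) (σ : St) : Prop where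
  holds : Holds p σ
  td : ∀ j < p.b, σ.a .td j = 0
  zd : ∀ j < p.b, σ.a .zd j = 0
  fb : σ.v .fb = σ.v .M * p.q
  rows : ∀ i < σ.v .M, ∃ z < p.Q, ∀ y < p.q, σ.a .ft (i * p.q + y) = p.row z y
  dead : ∀ t < p.Q, σ.a .dead t ≠ 0 → ∃ i < σ.v .M,
    Separates (fun y => σ.a .ft (i * p.q + y)) p.b (dig p.q t)
  card : σ.v .M + (alive p (σ.a .dead)).card ≤ p.Q
  decay : (alive p (σ.a .dead)).card * p.Q ^ σ.v .M ≤
    p.Q * (p.Q - numSeparating p.q p.b) ^ σ.v .M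
  size : σ.v .M = 0 ∨ p.Q ^ (σ.v .M - 1) ≤ p.Q * (p.Q - numSeparating p.q p.b) ^ (σ.v .M - 1)

/-- Either a row is added and strictly fewer tuples stay alive, or no polynomial separates any
living tuple, and then by averaging none is left. -/
theorem greedy_step {inp : ℕ → ℕ} {σ : St} {p : Params} (hp : p.Good) (hI : GreedyInv p σ) :
    wp inp (findBest ;; .ite (var .best)
      (.for .y (var .q) (.store .ft (var .fb + var .y) (get .bg (var .y)) ;;
        .store .g (var .y) (get .bg (var .y))) ;;
      (.fb ≔ var .fb + var .q) ;; (.M ≔ var .M + 1) ;; kill)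
    (.go ≔ 0)) σ fun k σ' => k ≤ 2000 * (p.Q + 1) ^ 2 * (p.q + 1) ^ 3 ∧ GreedyInv p σ' ∧
      ((σ'.v .go = σ.v .go ∧ (alive p (σ'.a .dead)).card < (alive p (σ.a .dead)).card) ∨
        (σ'.v .go = 0 ∧ alive p (σ'.a .dead) = ∅)) := by
  classical
  have hq := hp.field.1.two_le
  have hb : p.b ≤ p.q := p.b_le.trans hp.l_lt_q.le
  set X := p.q + 1 with hX
  have hX1 : X ≤ X ^ 3 := Nat.le_self_pow (by norm_num) _
  have hX2 : X ^ 2 ≤ X ^ 3 := Nat.pow_le_pow_right (by omega) (by norm_num)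
  have hQ1 : X ^ 3 ≤ (p.Q + 1) ^ 2 * X ^ 3 :=
    Nat.le_mul_of_pos_left _ (Nat.pow_pos (Nat.succ_pos _))
  have hkill : 400 * (p.Q + 1) * X ^ 2 ≤ 400 * ((p.Q + 1) ^ 2 * X ^ 3) := by
    rw [mul_assoc]
    exact Nat.mul_le_mul_left _ (Nat.mul_le_mul (Nat.le_self_pow (by norm_num) _) hX2)
  have hassoc : ∀ c, c * (p.Q + 1) ^ 2 * X ^ 3 = c * ((p.Q + 1) ^ 2 * X ^ 3) := fun c =>
    mul_assoc _ _ _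
  rw [wp_seq]
  refine (findBest_spec hp hI.holds hI.td hI.zd).frame.mono ?_
  rintro k₁ σ₁ ⟨⟨hk₁, htd₁, hzd₁, hmax, hbest⟩, hF₁⟩
  rw [← hX] at hk₁
  rw [hassoc] at hk₁ ⊢
  have hH₁ := hI.holds.frame hF₁ (by decide) (by decide)
  have hM₁ := hF₁.v .M (by decide)
  have hfb₁ := hF₁.v .fb (by decide)
  have hgo₁ := hF₁.v .go (by decide)
  have hft₁ := hF₁.a .ft (by decide)
  have hd₁ := hF₁.a .dead (by decide)
  have hexp := alive_mul_le hp hmax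
  rw [wp_ite]
  refine ⟨fun h => ?_, fun h => ?_⟩
  · obtain ⟨z, hz, hbz, hbg⟩ := hbest h
    rw [wp_seq]
    refine wp_for p.q 50 (fun y σ' => (∀ y' < y, σ'.a .g y' = p.row z y') ∧
        ∀ m, σ'.a .ft m = if σ.v .M * p.q ≤ m ∧ m < σ.v .M * p.q + y then
          p.row z (m - σ.v .M * p.q) else σ.a .ft m)
      (by decide) (by decide) (by decide) (by simp [hH₁.q]) ?_ ?_ ?_
    · refine ⟨by simp, fun m => ?_⟩
      rw [if_neg (by omega), St.setV_a, hft₁]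
    · intro y hy σ₂ hF₂ hv₂ ⟨hI1, hI2⟩
      have hbg₂ := hF₂.a .bg (by decide)
      have hfb₂ := hF₂.v .fb (by decide)
      rw [wp_seq, wp_store, wp_store]
      refine ⟨by simp, fun y' hy' => ?_, fun m => ?_⟩
      · simp [hv₂, hbg₂]
        split_ifs with he
        · rw [he, hbg y hy]
        · exact hI1 y' (by omega)
      · simp [hv₂, hbg₂, hfb₂, hfb₁, hI.fb]
        split_ifs with h1 h2 h2
        · rw [hbg y hy, h1, Nat.add_sub_cancel_left]
        · omega
        · rw [hI2, if_pos (by omega)]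
        · rw [hI2, if_neg (by omega)]
    · intro k₂ σ₂ hF₂ hv₂ ⟨hI1, hI2⟩ hk₂
      rw [wp_seq, wp_assign, wp_seq, wp_assign]
      have hH₂ := hH₁.frame hF₂ (by decide) (by decide)
      have hM₂ := (hF₂.v .M (by decide)).trans hM₁
      have hfb₂ := (hF₂.v .fb (by decide)).trans hfb₁
      have hgo₂ := (hF₂.v .go (by decide)).trans hgo₁
      have htd₂ := hF₂.a .td (by decide)
      have hzd₂ := hF₂.a .zd (by decide)
      have hd₂ := (hF₂.a .dead (by decide)).trans hd₁
      refine (kill_spec hp ((hH₂.setV (by decide) _).setV (by decide) _)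
        (by simpa [htd₂] using htd₁)).frame.mono ?_
      rintro k₃ σ₃ ⟨⟨hk₃, hdead, htd₃⟩, hF₃⟩
      have hH₃ := ((hH₂.setV (x := .fb) (by decide) ((var .fb + var .q : Expr).eval inp σ₂)).setV
        (x := .M) (by decide) _).frame hF₃ (by decide) (by decide)
      have hM₃ := hF₃.v .M (by decide)
      have hfb₃ := hF₃.v .fb (by decide)
      have hgo₃ := hF₃.v .go (by decide)
      have hzd₃ := hF₃.a .zd (by decide)
      have hft₃ := hF₃.a .ft (by decide)
      simp only [St.setV_a, St.setV_v, reduceCtorEq, if_false, if_true, Expr.eval_add,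
        Expr.eval_var, Expr.eval_ofNat, hM₂, hfb₂, hH₂.q, hd₂, hI.fb, hgo₂]
        at hM₃ hfb₃ hzd₃ hft₃ hdead hgo₃
      have hcard := alive_card_eq hdead
      have hns : numSep p (σ.a .dead) (σ₂.a .g) = σ₁.v .best := by
        rw [hbz]; exact numSep_congr (by omega) hI1
      rw [hns] at hcard
      have hpos : 0 < σ₁.v .best := Nat.pos_of_ne_zero h
      have hftold : ∀ i < σ.v .M, ∀ y < p.q, σ₃.a .ft (i * p.q + y) = σ.a .ft (i * p.q + y) := by
        intro i hi y hy
        have : (i + 1) * p.q ≤ σ.v .M * p.q := Nat.mul_le_mul_right _ hi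
        rw [add_mul, one_mul] at this
        rw [hft₃, hI2, if_neg (by omega)]
      have hftnew : ∀ y < p.q, σ₃.a .ft (σ.v .M * p.q + y) = p.row z y := by
        intro y hy
        rw [hft₃, hI2, if_pos (by omega), Nat.add_sub_cancel_left]
      refine ⟨?_, ⟨hH₃, htd₃, ?_, ?_, ?_, ?_, ?_, ?_, ?_⟩, .inl ⟨?_, ?_⟩⟩
      · rw [← hX] at hk₃
        simp at hk₂ ⊢
        omega
      · rw [hzd₃, hzd₂]; exact hzd₁
      · rw [hfb₃, hM₃]; ring
      · rw [hM₃]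
        intro i hi
        rcases Nat.lt_succ_iff_lt_or_eq.1 hi with hi | rfl
        · obtain ⟨z', hz', h'⟩ := hI.rows i hi
          exact ⟨z', hz', fun y hy => (hftold i hi y hy).trans (h' y hy)⟩
        · exact ⟨z, hz, hftnew⟩
      · rw [hM₃]
        intro t ht hne
        by_cases hold : σ.a .dead t = 0
        · have hsep : Separates (σ₂.a .g) p.b (dig p.q t) := by
            by_contra hns
            exact hne ((hdead t ht).2 ⟨hold, hns⟩)
          refine ⟨σ.v .M, Nat.lt_succ_self _, (separates_congr fun i _ => ?_).1 hsep⟩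
          rw [hI1 _ (dig_lt (by omega) _ _), hftnew _ (dig_lt (by omega) _ _)]
        · obtain ⟨i, hi, h'⟩ := hI.dead t ht hold
          refine ⟨i, Nat.lt_succ_of_lt hi, (separates_congr fun j _ => ?_).1 h'⟩
          rw [hftold i hi _ (dig_lt (by omega) _ _)]
      · rw [hM₃]
        have := hI.card
        omega
      -- The best polynomial separates at least the average number of living tuples, so their number
      -- shrinks by the factor `1 - numSeparating / Q`.
      · have h1 : (alive p (σ₃.a .dead)).card * p.Q ≤
            (alive p (σ.a .dead)).card * (p.Q - numSeparating p.q p.b) := by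
          rw [Nat.mul_sub]
          refine Nat.le_sub_of_add_le ((Nat.add_le_add_left hexp _).trans ?_)
          rw [← add_mul, ← hcard]
        rw [hM₃, pow_succ, pow_succ]
        calc (alive p (σ₃.a .dead)).card * (p.Q ^ σ.v .M * p.Q)
            = ((alive p (σ₃.a .dead)).card * p.Q) * p.Q ^ σ.v .M := by ring
          _ ≤ ((alive p (σ.a .dead)).card * (p.Q - numSeparating p.q p.b)) * p.Q ^ σ.v .M :=
              Nat.mul_le_mul_right _ h1
          _ = ((alive p (σ.a .dead)).card * p.Q ^ σ.v .M) * (p.Q - numSeparating p.q p.b) := by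
              ring
          _ ≤ (p.Q * (p.Q - numSeparating p.q p.b) ^ σ.v .M) * (p.Q - numSeparating p.q p.b) :=
              Nat.mul_le_mul_right _ hI.decay
          _ = _ := by ring
      -- Before this row was added some tuple was still alive, so the old decay bound holds with the
      -- number of living tuples replaced by 1. This is what limits the number of rows.
      · right
        rw [hM₃, Nat.add_sub_cancel]
        refine le_trans (Nat.le_mul_of_pos_left _ ?_) hI.decay
        omega
      · exact hgo₃
      · omega
  · rw [wp_assign]
    refine ⟨by simp; omega, ⟨hH₁.setV (by decide) _, htd₁, hzd₁, ?_, ?_, ?_, ?_, ?_, ?_⟩,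
      .inr ⟨by simp, ?_⟩⟩
    · simp [hfb₁, hM₁, hI.fb]
    · simpa [hft₁, hM₁] using hI.rows
    · simpa [hft₁, hM₁, hd₁] using hI.dead
    · simpa [hM₁, hd₁] using hI.card
    · simpa [hM₁, hd₁] using hI.decay
    · simpa [hM₁] using hI.size
    -- With maximum 0 the averaging bound says that the number of living tuples times a positive
    -- number is at most 0.
    · rw [St.setV_a, hd₁]
      simp only [Expr.eval_var] at h
      rw [h, zero_mul] at hexp
      have := numSeparating_pos hb
      rw [← Finset.card_eq_zero]
      rcases Nat.eq_zero_or_pos (alive p (σ.a .dead)).card with h0 | h0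
      · exact h0
      · have := Nat.mul_pos h0 this
        omega

/-- When no tuple is alive, every tuple of distinct elements is dead, and a tuple only dies by being
separated by a stored row. -/
theorem greedy_spec {inp : ℕ → ℕ} {σ : St} {p : Params} (hp : p.Good) (hH : Holds p σ)
    (htd : ∀ j, σ.a .td j = 0) (hzd : ∀ j, σ.a .zd j = 0) (hd : ∀ t, σ.a .dead t = 0) :
    wp inp greedy σ fun k σ' => k ≤ 3000 * (p.Q + 1) ^ 3 * (p.q + 1) ^ 3 ∧ Holds p σ' ∧
      p.IsPerfect (σ'.v .M) (fun i y => σ'.a .ft (i * p.q + y)) ∧ σ'.v .M ≤ p.Q ∧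
      (σ'.v .M = 0 ∨
        p.Q ^ (σ'.v .M - 1) ≤ p.Q * (p.Q - numSeparating p.q p.b) ^ (σ'.v .M - 1)) := by
  classical
  have hq := hp.field.1.two_le
  simp only [greedy, wp_seq, wp_assign]
  set X := p.q + 1 with hX
  set T := 2000 * (p.Q + 1) ^ 2 * X ^ 3 + 10 with hT
  have hcard0 : ∀ dead, (alive p dead).card ≤ p.Q := fun dead =>
    (Finset.card_filter_le _ _).trans (by simp)
  -- One iteration per living tuple, and one more for the final search that finds nothing.
  refine wp_loop (fun B σ' => GreedyInv p σ' ∧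
    ((σ'.v .go ≠ 0 ∧ B = ((alive p (σ'.a .dead)).card + 1) * T) ∨
      (σ'.v .go = 0 ∧ alive p (σ'.a .dead) = ∅))) (((alive p (σ.a .dead)).card + 1) * T) ?_ ?_ ?_
  · refine ⟨⟨((hH.setV (by decide) _).setV (by decide) _).setV (by decide) _, ?_, ?_, ?_, ?_, ?_,
      ?_, ?_, ?_⟩, .inl ⟨by simp, by simp⟩⟩
    · simp [htd]
    · simp [hzd]
    · simp
    · simp
    · simp [hd]
    · simpa using hcard0 _
    · simpa using hcard0 _
    · simp
  · rintro B σ' ⟨hI, h | h⟩ he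
    · refine (greedy_step hp hI).mono ?_
      rintro k σ'' ⟨hk, hI', h'⟩
      rw [← hX] at hk
      rcases h' with h' | h'
      · refine ⟨_, ?_, hI', .inl ⟨by rw [h'.1]; exact h.1, rfl⟩⟩
        have : ((alive p (σ''.a .dead)).card + 1 + 1) * T ≤
            ((alive p (σ'.a .dead)).card + 1) * T := Nat.mul_le_mul_right _ (by omega)
        rw [add_mul _ 1, one_mul] at this
        rw [h.2]
        simp
        omega
      · refine ⟨0, ?_, hI', .inr h'⟩
        rw [h.2, add_mul, one_mul]
        simp
        omega
    · exact absurd h.1 he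
  · rintro k B' σ' hk ⟨hI, h | h⟩ he
    · exact absurd he h.1
    · refine ⟨?_, hI.holds, ⟨?_, ?_⟩, ?_, hI.size⟩
      · have h1 : ((alive p (σ.a .dead)).card + 1) * T ≤ (p.Q + 1) * T :=
          Nat.mul_le_mul_right _ (Nat.add_le_add_right (hcard0 _) _)
        have h2 : (p.Q + 1) * T = 2000 * ((p.Q + 1) ^ 3 * X ^ 3) + 10 * (p.Q + 1) := by
          rw [hT]; ring
        have h3 : p.Q + 1 ≤ (p.Q + 1) ^ 3 * X ^ 3 :=
          (Nat.le_self_pow (by norm_num) _).trans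
            (Nat.le_mul_of_pos_right _ (Nat.pow_pos (by omega)))
        rw [mul_assoc]
        simp at hk ⊢
        omega
      · intro hb i hi y hy
        obtain ⟨z, -, hz⟩ := hI.rows i hi
        simp only [hz y hy]
        exact Nat.mod_lt _ hb
      · intro y hy hsep
        obtain ⟨t, ht, hdig⟩ := exists_dig_eq p.q p.b y hy
        have hsep' : Separates id p.b (dig p.q t) :=
          (separates_congr fun i hi => by rw [hdig i hi]).1 hsep
        have hdead : σ'.a .dead t ≠ 0 := by
          intro h0
          have : t ∈ alive p (σ'.a .dead) :=
            Finset.mem_filter.2 ⟨Finset.mem_range.2 ht, h0, hsep'⟩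
          rw [h.2] at this
          simp at this
        obtain ⟨i, hi, h'⟩ := hI.dead t ht hdead
        exact ⟨i, hi, (separates_congr fun j hj => by rw [hdig j hj]).1 h'⟩
      · have := hI.card
        omega

end While

namespace While

open While.Expr (var lt ne get cond)
open RAM (Prog State Exec)

/-! ### Simulation of a machine program

The registers and memory cells of the simulated machine carry stamps; a cell holds `0` unless its
stamp is the current one, so that a single assignment resets the machine. -/

/-- The content of register `r`. -/
def regExpr (r : ℕ) : Expr := cond (ne (get .rg (.lit r)) (var .gen)) 0 (get .rv (.lit r))

/-- The content of the memory cell whose address is `adr`. -/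
def memExpr : Expr := cond (ne (get .mg (var .adr)) (var .gen)) 0 (get .mv (var .adr))

/-- The content of the simulated input at the address `adr`. -/
def inpExpr : Expr :=
  cond (lt (var .adr) (var .n + 2)) (.inp (var .adr))
    (cond (lt (var .adr) (var .n + var .n + 2)) (get .col (var .adr - (var .n + 2)))
      (.inp (var .adr - (var .n + var .n + 2) + var .off)))

def setReg (r : ℕ) (e : Expr) : Cmd := .store .rv (.lit r) e ;; .store .rg (.lit r) (var .gen)

def simulate : Prog → Cmd
  | .skip => .skip
  | .const r c => setReg r (.lit c)
  | .copy r a => setReg r (regExpr a)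
  | .add r a b => setReg r (regExpr a + regExpr b)
  | .sub r a b => setReg r (regExpr a - regExpr b)
  | .read r a => (.adr ≔ regExpr a) ;; setReg r inpExpr
  | .load r a => (.adr ≔ regExpr a) ;; setReg r memExpr
  | .store a b => (.adr ≔ regExpr a) ;; .store .mv (var .adr) (regExpr b) ;;
      .store .mg (var .adr) (var .gen)
  | .seq P Q => simulate P ;; simulate Q
  | .ite a P Q => .ite (regExpr a) (simulate P) (simulate Q)
  | .loop a P => .loop (regExpr a) (simulate P)

theorem simulate_modV (P : Prog) : (simulate P).modV ⊆ [.adr] := by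
  induction P <;> simp_all [simulate, Cmd.modV, setReg]

theorem simulate_modA (P : Prog) : (simulate P).modA ⊆ [.rv, .rg, .mv, .mg] := by
  induction P <;> simp_all [simulate, Cmd.modA, setReg]

/-- The input that the simulated machine sees. -/
def simInput (inp : ℕ → ℕ) (σ : St) (i : ℕ) : ℕ :=
  if i < σ.v .n + 2 then inp i else
  if i < σ.v .n + σ.v .n + 2 then σ.a .col (i - (σ.v .n + 2)) else
  inp (i - (σ.v .n + σ.v .n + 2) + σ.v .off)

/-- No stamp is later than the current one. -/
def Stamped (σ : St) : Prop := ∀ i, σ.a .rg i ≤ σ.v .gen ∧ σ.a .mg i ≤ σ.v .gen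

/-- The state `σ` holds the simulated machine in the state `s`. -/
structure Simulates (σ : St) (s : State) : Prop where
  reg : ∀ r, (if σ.a .rg r = σ.v .gen then σ.a .rv r else 0) = s.reg r
  mem : ∀ i, (if σ.a .mg i = σ.v .gen then σ.a .mv i else 0) = s.mem i
  stamped : Stamped σ

section

variable {inp : ℕ → ℕ} {σ : St} {s : State}

theorem Simulates.eval_regExpr (h : Simulates σ s) (r : ℕ) : (regExpr r).eval inp σ = s.reg r := by
  rw [← h.reg r]
  by_cases hr : σ.a .rg r = σ.v .gen <;> simp [regExpr, hr]

theorem cost_regExpr (r : ℕ) : (regExpr r).cost = 34 := by simp [regExpr]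

theorem Simulates.eval_memExpr (h : Simulates σ s) : memExpr.eval inp σ = s.mem (σ.v .adr) := by
  rw [← h.mem (σ.v .adr)]
  by_cases hr : σ.a .mg (σ.v .adr) = σ.v .gen <;> simp [memExpr, hr]

theorem eval_inpExpr : inpExpr.eval inp σ = simInput inp σ (σ.v .adr) := by
  simp only [inpExpr, simInput, Expr.eval_cond, ne_eq, Expr.eval_lt, Expr.eval_var, Expr.eval_add,
    Expr.eval_ofNat, Expr.eval_inp, Expr.eval_get, Expr.eval_sub, not_le]

theorem Simulates.setReg (h : Simulates σ s) (r x : ℕ) :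
    Simulates ((σ.setA .rv r x).setA .rg r (σ.v .gen)) (s.setReg r x) := by
  refine ⟨fun r' => ?_, fun i => ?_, fun i => ?_⟩
  · by_cases hr : r' = r
    · simp [State.setReg, hr]
    · simp [State.setReg, hr, ← h.reg r']
  · simp [State.setReg, ← h.mem i]
  · have := h.stamped i
    simp only [St.setA_v, St.setA_a_same, St.setA_a_ne _ _ _ _ _ (show Arr.rg ≠ Arr.rv by decide),
      St.setA_a_ne _ _ _ _ _ (show Arr.mg ≠ Arr.rg by decide),
      St.setA_a_ne _ _ _ _ _ (show Arr.mg ≠ Arr.rv by decide)]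
    split_ifs <;> omega

theorem Simulates.setMem (h : Simulates σ s) (i x : ℕ) :
    Simulates ((σ.setA .mv i x).setA .mg i (σ.v .gen)) (s.setMem i x) := by
  refine ⟨fun r => ?_, fun i' => ?_, fun j => ?_⟩
  · simp [State.setMem, ← h.reg r]
  · by_cases hr : i' = i
    · simp [State.setMem, hr]
    · simp [State.setMem, hr, ← h.mem i']
  · have := h.stamped j
    simp only [St.setA_v, St.setA_a_same, St.setA_a_ne _ _ _ _ _ (show Arr.mg ≠ Arr.mv by decide),
      St.setA_a_ne _ _ _ _ _ (show Arr.rg ≠ Arr.mg by decide),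
      St.setA_a_ne _ _ _ _ _ (show Arr.rg ≠ Arr.mv by decide)]
    split_ifs <;> omega

theorem Simulates.setV_adr (h : Simulates σ s) (x : ℕ) : Simulates (σ.setV .adr x) s :=
  ⟨by simpa using h.reg, by simpa using h.mem, by simpa [Stamped] using h.stamped⟩

theorem simulate_setReg (h : Simulates σ s) {r : ℕ} {e : Expr} {x : ℕ} (he : e.eval inp σ = x) :
    ∃ σ', CExec inp (setReg r e) σ (e.cost + 19) σ' ∧ Simulates σ' (s.setReg r x) := by
  refine ⟨_, ?_, h.setReg r x⟩
  have := (CExec.store .rv (.lit r) e σ (inp := inp)).seq (.store .rg (.lit r) (var .gen) _)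
  simp only [he, Expr.eval_lit, Expr.eval_var, St.setA_v, Expr.cost_lit, Expr.cost_var] at this
  rwa [show 1 + e.cost + 8 + (1 + 1 + 8) = e.cost + 19 by omega] at this

/-- Each machine step becomes boundedly many expression evaluations; the factor 200 covers the most
expensive one. The interpreter writes only to `adr` and to its own four arrays, so the input that it
presents does not change during the run. -/
theorem simulate_exec {inp' : ℕ → ℕ} {P : Prog} {s' : State} {k : ℕ} (h : Exec inp' P s k s')
    (hsim : Simulates σ s) (hinp : simInput inp σ = inp') :
    ∃ k' σ', CExec inp (simulate P) σ k' σ' ∧ k' ≤ 200 * k ∧ Simulates σ' s' := by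
  have frame : ∀ {P : Prog} {k' : ℕ} {σ σ' : St}, CExec inp (simulate P) σ k' σ' →
      simInput inp σ = inp' → simInput inp σ' = inp' := by
    intro P k' σ σ' h h'
    have hF := h.frame.mono (simulate_modV P) (simulate_modA P)
    rw [← h']
    funext i
    simp only [simInput, hF.v .n (by decide), hF.v .off (by decide), hF.a .col (by decide)]
  induction h generalizing σ with
  | skip s => exact ⟨1, σ, .skip _, by omega, hsim⟩
  | const r c s =>
    obtain ⟨σ', h1, h2⟩ := simulate_setReg hsim (r := r) (e := .lit c) (inp := inp) rfl
    exact ⟨_, _, h1, by simp, h2⟩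
  | copy r a s =>
    obtain ⟨σ', h1, h2⟩ := simulate_setReg hsim (r := r) (hsim.eval_regExpr (inp := inp) a)
    exact ⟨_, _, h1, by simp [cost_regExpr], h2⟩
  | add r a b s =>
    obtain ⟨σ', h1, h2⟩ := simulate_setReg hsim (r := r) (inp := inp)
      (e := regExpr a + regExpr b) (x := s.reg a + s.reg b)
      (by simp [hsim.eval_regExpr])
    exact ⟨_, _, h1, by simp [cost_regExpr], h2⟩
  | sub r a b s =>
    obtain ⟨σ', h1, h2⟩ := simulate_setReg hsim (r := r) (inp := inp)
      (e := regExpr a - regExpr b) (x := s.reg a - s.reg b)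
      (by simp [hsim.eval_regExpr])
    exact ⟨_, _, h1, by simp [cost_regExpr], h2⟩
  | read r a s =>
    have he := hsim.eval_regExpr (inp := inp) a
    have h1 := CExec.assign (inp := inp) .adr (regExpr a) σ
    rw [he] at h1
    obtain ⟨σ', h2, h3⟩ := simulate_setReg (hsim.setV_adr (s.reg a)) (r := r) (inp := inp)
      (e := inpExpr) (x := inp' (s.reg a)) (by
        rw [eval_inpExpr, ← hinp]
        simp [simInput])
    exact ⟨_, _, h1.seq h2, by simp [cost_regExpr, inpExpr], h3⟩
  | load r a s =>
    have he := hsim.eval_regExpr (inp := inp) a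
    have h1 := CExec.assign (inp := inp) .adr (regExpr a) σ
    rw [he] at h1
    obtain ⟨σ', h2, h3⟩ := simulate_setReg (hsim.setV_adr (s.reg a)) (r := r) (inp := inp)
      (e := memExpr) (x := s.mem (s.reg a)) (by
        rw [(hsim.setV_adr (s.reg a)).eval_memExpr]; simp)
    exact ⟨_, _, h1.seq h2, by simp [cost_regExpr, memExpr], h3⟩
  | store a b s =>
    have he := hsim.eval_regExpr (inp := inp) a
    have h1 := CExec.assign (inp := inp) .adr (regExpr a) σ
    rw [he] at h1
    have h2 := (hsim.setV_adr (s.reg a)).setMem (s.reg a) (s.reg b)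
    refine ⟨_, _, h1.seq ((CExec.store ..).seq (.store ..)), ?_, ?_⟩
    · simp [cost_regExpr]
    · simpa [(hsim.setV_adr (s.reg a)).eval_regExpr] using h2
  | seq _ _ ih1 ih2 =>
    obtain ⟨k₁, σ₁, h1, h2, h3⟩ := ih1 hsim hinp
    obtain ⟨k₂, σ₂, g1, g2, g3⟩ := ih2 h3 (frame h1 hinp)
    exact ⟨_, _, h1.seq g1, by omega, g3⟩
  | ite_true ha _ ih =>
    obtain ⟨k₁, σ₁, h1, h2, h3⟩ := ih hsim hinp
    exact ⟨_, _, .ite_true (by rwa [hsim.eval_regExpr]) h1, by rw [cost_regExpr]; omega, h3⟩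
  | ite_false ha _ ih =>
    obtain ⟨k₁, σ₁, h1, h2, h3⟩ := ih hsim hinp
    exact ⟨_, _, .ite_false (by rwa [hsim.eval_regExpr]) h1, by rw [cost_regExpr]; omega, h3⟩
  | loop_done ha =>
    exact ⟨_, _, .loop_done (by rwa [hsim.eval_regExpr]), by rw [cost_regExpr]; omega, hsim⟩
  | loop_step ha _ _ ih1 ih2 =>
    obtain ⟨k₁, σ₁, h1, h2, h3⟩ := ih1 hsim hinp
    obtain ⟨k₂, σ₂, g1, g2, g3⟩ := ih2 h3 (frame h1 hinp)
    exact ⟨_, _, .loop_step (by rwa [hsim.eval_regExpr]) h1 g1, by rw [cost_regExpr]; omega, g3⟩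

/-- Reset the simulated machine and run `P`. -/
def run (P : Prog) : Cmd := (.gen ≔ var .gen + 1) ;; simulate P

/-- No stamp exceeds `gen`, so increasing `gen` makes all stamps stale at once, and every register
and cell reads as 0 again without being cleared. -/
theorem run_spec {inp' : ℕ → ℕ} {P : Prog} {s' : State} {k : ℕ}
    (h : Exec inp' P State.init k s') (hst : Stamped σ) (hinp : simInput inp σ = inp') :
    wp inp (run P) σ fun k' σ' => k' ≤ 200 * k + 4 ∧ Simulates σ' s' := by
  rw [run, wp_seq, wp_assign]
  have hsim : Simulates (σ.setV .gen ((var .gen + 1 : Expr).eval inp σ)) State.init := by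
    refine ⟨fun i => ?_, fun i => ?_, fun i => ?_⟩ <;>
    · have := hst i
      simp [State.init]
      omega
  obtain ⟨k', σ', h1, h2, h3⟩ := simulate_exec (inp := inp) h hsim
    (by rw [← hinp]; funext i; simp [simInput])
  exact ⟨k', σ', h1, by simp; omega, h3⟩

theorem run_modV (P : Prog) : (run P).modV ⊆ [.gen, .adr] := by
  simp only [run, Cmd.modV, List.cons_append, List.nil_append]
  exact List.cons_subset_cons _ (simulate_modV P)

theorem run_modA (P : Prog) : (run P).modA ⊆ [.rv, .rg, .mv, .mg] := by
  simpa [run, Cmd.modA] using simulate_modA P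

end

end While

namespace While

open While.Expr (var lt ne get cond)

/-! ### Tables of hash values and colors -/

/-- Row `a` of the multiplication table of the field. -/
def mulRow : Cmd :=
  (.z ≔ 0) ;; .for .y (var .q) (.store .mr (var .y) (var .z) ;; (.z ≔ var .z + var .a) ;; reduce .z)

/-- A multiplication by repeated addition would cost up to `q` steps for each number. With the row
of products with `a` tabulated, the whole hash table costs time linear in `n`, which the running
time of the given program can pay for. -/
theorem mulRow_spec {inp : ℕ → ℕ} {σ : St} (ha : σ.v .a < σ.v .q) :
    wp inp mulRow σ fun k σ' => k ≤ 50 * (σ.v .q + 1) ∧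
      ∀ y < σ.v .q, σ'.a .mr y = σ.v .a * y % σ.v .q := by
  set q := σ.v .q with hq
  set a := σ.v .a with ha'
  rw [mulRow, wp_seq, wp_assign]
  refine wp_for q 30 (fun y σ' => σ'.v .z = a * y % q ∧ ∀ y' < y, σ'.a .mr y' = a * y' % q)
    (by decide) (by decide) (by decide) (by simp [hq]) (by simp) ?_ ?_
  · intro y hy σ₁ hF₁ hv₁ ⟨hz, hI⟩
    have hq₁ := hF₁.v .q (by decide)
    have ha₁ := hF₁.v .a (by decide)
    simp only [St.setV_v, reduceCtorEq, if_false, ← hq, ← ha'] at hq₁ ha₁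
    rw [wp_seq, wp_store, wp_seq, wp_assign]
    have hzq : σ₁.v .z < q := by rw [hz]; exact Nat.mod_lt _ (by omega)
    refine (reduce_spec (m := a * (y + 1) % q) ?_ ?_).frame.mono ?_
    · simp [hq₁, ha₁]; omega
    · simp [hq₁, ha₁, hz, mul_add]
    · rintro k σ₂ ⟨⟨hk, hz₂⟩, hF₂⟩
      have hmr := hF₂.a .mr (by decide)
      simp only [St.setV_v, St.setV_a, reduceCtorEq, if_false, hz₂, hmr, true_and]
      refine ⟨by simp; omega, fun y' hy' => ?_⟩
      simp only [St.setA_a_same, Expr.eval_var, hv₁, hz]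
      split_ifs with h
      · rw [h]
      · exact hI y' (by omega)
  · intro k σ' hF hv ⟨_, hI⟩ hk
    simp at hk ⊢
    exact ⟨by omega, hI⟩

/-- The hash values of the numbers up to `n`. -/
def hashTable : Cmd :=
  (.hi ≔ 0) ;; (.lo ≔ 0) ;; .for .x (var .n + 1) (
    (.acc ≔ cond (var .x) (var .lo + get .mr (get .hx (var .hi))) 0) ;; reduce .acc ;;
    .store .hx (var .x) (var .acc) ;; (.lo ≔ var .lo + 1) ;;
    .ite (lt (var .lo) (var .q)) .skip ((.lo ≔ 0) ;; (.hi ≔ var .hi + 1)))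

/-- The hash value of `x` is `x % q` plus `a` times the hash value of `x / q`, which is already in
the table; `lo` and `hi` follow `x % q` and `x / q` without any division. -/
theorem hashTable_spec {inp : ℕ → ℕ} {σ : St} {q a : ℕ} (hq : σ.v .q = q) (h2 : 2 ≤ q)
    (hmr : ∀ y < q, σ.a .mr y = a * y % q) :
    wp inp hashTable σ fun k σ' => k ≤ 200 * (σ.v .n + 1) ∧
      ∀ x ≤ σ.v .n, σ'.a .hx x = polyHash q a x := by
  simp only [hashTable, wp_seq, wp_assign]
  refine wp_for (σ.v .n + 1) 100 (fun x σ' => σ'.v .lo = x % q ∧ σ'.v .hi = x / q ∧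
      ∀ x' < x, σ'.a .hx x' = polyHash q a x')
    (by decide) (by decide) (by decide) (by simp) (by simp) ?_ ?_
  · intro x hx σ₁ hF₁ hv₁ ⟨hlo, hhi, hI⟩
    have hq₁ := hF₁.v .q (by decide)
    have hmr₁ := hF₁.a .mr (by decide)
    simp only [St.setV_v, St.setV_a, reduceCtorEq, if_false, hq] at hq₁ hmr₁
    have hmod := Nat.mod_lt x (by omega : 0 < q)
    have hacc : (cond (var .x) (var .lo + get .mr (get .hx (var .hi))) 0).eval inp σ₁ < 2 * q ∧
        (cond (var .x) (var .lo + get .mr (get .hx (var .hi))) 0).eval inp σ₁ % q =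
          polyHash q a x := by
      -- The quotient `x / q` is smaller than `x` only for `x > 0`, hence the separate treatment of
      -- 0.
      rcases Nat.eq_zero_or_pos x with rfl | hx0
      · simp [hv₁]; omega
      · have hlt : x / q < x := Nat.div_lt_self hx0 (by omega)
        simp only [Expr.eval_cond, Expr.eval_var, hv₁, hx0.ne', ne_eq, not_false_eq_true, if_true,
          Expr.eval_add, Expr.eval_get, hlo, hhi, hI _ hlt, hmr₁,
          hmr _ (polyHash_lt (by omega) _ _)]
        have := Nat.mod_lt (a * polyHash q a (x / q)) (by omega : 0 < q)
        refine ⟨by omega, ?_⟩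
        rw [polyHash_rec h2 a x, Nat.add_mod_mod]
    rw [wp_seq, wp_assign, wp_seq]
    refine (reduce_spec (m := polyHash q a x) ?_ ?_).frame.mono ?_
    · simpa [hq₁] using hacc.1
    · simpa [hq₁] using hacc.2
    · rintro k σ₂ ⟨⟨hk, hacc₂⟩, hF₂⟩
      have hq₂ := hF₂.v .q (by decide)
      have hlo₂ := hF₂.v .lo (by decide)
      have hhi₂ := hF₂.v .hi (by decide)
      have hv₂ := hF₂.v .x (by decide)
      have hx₂ := hF₂.a .hx (by decide)
      simp only [St.setV_v, St.setV_a, reduceCtorEq, if_false, hq₁, hlo, hhi, hv₁]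
        at hq₂ hlo₂ hhi₂ hv₂ hx₂
      have htab : ∀ x' < x + 1, (σ₂.setA .hx x (polyHash q a x)).a .hx x' = polyHash q a x' := by
        intro x' hx'
        rw [St.setA_a_same, hx₂]
        split_ifs with h
        · rw [h]
        · exact hI x' (by omega)
      have hdm := Nat.div_add_mod x q
      rw [wp_seq, wp_store, wp_seq, wp_assign, wp_ite]
      simp only [Expr.eval_var, hacc₂, hv₂]
      refine ⟨fun h => ?_, fun h => ?_⟩
      · simp [hlo₂, hq₂] at h
        obtain ⟨h1, h3⟩ := (Nat.div_mod_unique (a := x + 1) (by omega : 0 < q)).2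
          ⟨(by omega : x % q + 1 + q * (x / q) = x + 1), h⟩
        rw [wp_skip]
        refine ⟨by simp; omega, ?_, ?_, htab⟩
        · simp [hlo₂, h3]
        · simp [hhi₂, h1]
      · simp [hlo₂, hq₂] at h
        obtain ⟨h1, h3⟩ := (Nat.div_mod_unique (a := x + 1) (by omega : 0 < q)).2
          ⟨(by rw [mul_add]; omega : 0 + q * (x / q + 1) = x + 1), by omega⟩
        rw [wp_seq, wp_assign, wp_assign]
        refine ⟨by simp; omega, ?_, ?_, htab⟩
        · simp [h3]
        · simp [hhi₂, h1]
  · intro k σ' hF hv ⟨_, _, hI⟩ hk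
    simp at hk ⊢
    exact ⟨by omega, fun x hx => hI x (by omega)⟩

theorem Params.color_congr {p : Params} {F F' : ℕ → ℕ → ℕ} {th th' ix ix' : ℕ → ℕ} {y : ℕ}
    (hth : ∀ j < p.J, th j = th' j) (hF : ∀ i < p.s, F (ix i) y = F' (ix' i) y) :
    p.color F th ix y = p.color F' th' ix' y := by
  have : blockOf p.J th y = blockOf p.J th' y := by
    rw [blockOf, blockOf, Finset.filter_congr fun j hj => by rw [hth j (Finset.mem_range.1 hj)]]
  simp only [Params.color, this]
  split_ifs with h1 <;> simp_all

/-- The colors of the field elements. -/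
def colorTable : Cmd :=
  .for .y (var .q) (
    (.k ≔ 0) ;; (.w ≔ 0) ;;
    .for .j (var .J) (.ite (lt (var .y) (get .th (var .j))) .skip
      ((.k ≔ var .k + 1) ;; (.w ≔ var .w + var .b))) ;;
    .ite (lt (var .k) (var .s))
      ((.x ≔ get .ix (var .k)) ;; mul .z .i .x .q ;; (.w ≔ var .w + get .ft (var .z + var .y)))
      ((.z ≔ var .k - var .s) ;; mul .w .i .s .b ;; (.w ≔ var .w + var .z)) ;;
    .store .ycol (var .y) (cond (lt (var .w) (var .l)) (var .w) 0))

/-- The color of a vertex depends only on its hash value, so the thresholds and rows are evaluated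
`q` times and not `n` times. While `k` counts the thresholds up to `y`, `w` holds `k * b`. -/
theorem colorTable_spec {inp : ℕ → ℕ} {σ : St} {p : Params} (hH : Holds p σ) (hbq : p.b ≤ p.q) :
    wp inp colorTable σ fun k σ' => k ≤ 300 * (p.q + 1) * (p.q + p.J + 1) ∧
      ∀ y < p.q, σ'.a .ycol y =
        p.color (fun i y => σ.a .ft (i * p.q + y)) (σ.a .th) (σ.a .ix) y := by
  refine wp_for p.q (50 * p.J + 20 * p.q + 150) (fun y σ' => ∀ y' < y, σ'.a .ycol y' =
      p.color (fun i y => σ.a .ft (i * p.q + y)) (σ.a .th) (σ.a .ix) y')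
    (by decide) (by decide) (by decide) (by simp [hH.q]) (by simp) ?_ ?_
  · intro y hy σ₁ hF₁ hv₁ hI
    have hH₁ := hH.frame hF₁ (by decide) (by decide)
    have hth₁ := hF₁.a .th (by decide)
    have hix₁ := hF₁.a .ix (by decide)
    have hft₁ := hF₁.a .ft (by decide)
    simp only [wp_seq, wp_assign]
    refine wp_for p.J 40 (fun j σ' => σ'.v .k = blockOf j (σ.a .th) y ∧
        σ'.v .w = blockOf j (σ.a .th) y * p.b)
      (by decide) (by decide) (by decide) (by simp [hH₁.J]) (by simp [blockOf]) ?_ ?_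
    · intro j hj σ₂ hF₂ hv₂ ⟨hk₂, hw₂⟩
      have hH₂ := ((hH₁.setV (by decide) _).setV (by decide) _).frame hF₂ (by decide) (by decide)
      have hth₂ := hF₂.a .th (by decide)
      have hy₂ := hF₂.v .y (by decide)
      simp only [St.setV_v, St.setV_a, reduceCtorEq, if_false, hv₁, hth₁] at hth₂ hy₂
      have hb : blockOf (j + 1) (σ.a .th) y = blockOf j (σ.a .th) y + if σ.a .th j ≤ y then 1 else 0 := by
        rw [blockOf, Finset.range_add_one, Finset.filter_insert]
        split_ifs
        · rw [Finset.card_insert_of_notMem (by simp)]; rfl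
        · rfl
      rw [hb, wp_ite]
      simp only [ne_eq, Expr.eval_lt, Expr.eval_var, Expr.eval_get, hy₂, hv₂, hth₂, not_le]
      refine ⟨fun h => ?_, fun h => ?_⟩
      · rw [wp_skip, if_neg (by omega)]
        simp [hk₂, hw₂]
      · rw [wp_seq, wp_assign, wp_assign, if_pos h]
        simp [hk₂, hw₂, hH₂.b, add_mul]
    · intro k₂ σ₂ hF₂ hv₂ ⟨hk₂, hw₂⟩ hk₂'
      have hH₂ := ((hH₁.setV (by decide) _).setV (by decide) _).frame hF₂ (by decide) (by decide)
      have hy₂ := hF₂.v .y (by decide)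
      have hix₂ := hF₂.a .ix (by decide)
      have hft₂ := hF₂.a .ft (by decide)
      have hyc₂ := hF₂.a .ycol (by decide)
      simp only [St.setV_v, St.setV_a, reduceCtorEq, if_false, hv₁, hix₁, hft₁]
        at hix₂ hft₂ hy₂ hyc₂
      set κ := blockOf p.J (σ.a .th) y with hκ
      have finish : ∀ (σ₃ : St) (c : ℕ), σ₃.v .y = y → σ₃.v .l = p.l → σ₃.a .ycol = σ₂.a .ycol →
          σ₃.v .w = c → (c = if κ < p.s then κ * p.b + σ.a .ft (σ.a .ix κ * p.q + y) else
            p.s * p.b + (κ - p.s)) →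
          wp inp (.store .ycol (var .y) (cond (lt (var .w) (var .l)) (var .w) 0)) σ₃
            fun k σ' => k ≤ 20 ∧ ∀ y' < y + 1, σ'.a .ycol y' =
              p.color (fun i y => σ.a .ft (i * p.q + y)) (σ.a .th) (σ.a .ix) y' := by
        intro σ₃ c hy₃ hl₃ hyc₃ hw₃ hc
        rw [wp_store]
        refine ⟨by simp, fun y' hy' => ?_⟩
        rw [St.setA_a_same, Expr.eval_var, hy₃, hyc₃, hyc₂]
        split_ifs with h
        · subst h
          simp only [Params.color, ← hκ, ← hc]
          simp only [Expr.eval_cond, ne_eq, Expr.eval_lt, Expr.eval_var, hw₃, hl₃, not_le,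
            Expr.eval_ofNat]
        · exact hI y' (by omega)
      rw [wp_ite]
      simp only [ne_eq, Expr.eval_lt, Expr.eval_var, hk₂, hH₂.s, not_le]
      refine ⟨fun h => ?_, fun h => ?_⟩
      · simp only [wp_seq, wp_assign]
        refine (mul_spec (by decide)).frame.mono ?_
        rintro k₃ σ₃ ⟨⟨hk₃, hz₃⟩, hF₃⟩
        have hy₃ := hF₃.v .y (by decide)
        have hl₃ := hF₃.v .l (by decide)
        have hw₃ := hF₃.v .w (by decide)
        have hft₃ := hF₃.a .ft (by decide)
        have hyc₃ := hF₃.a .ycol (by decide)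
        simp [hy₂, hw₂, hH₂.l, hft₂, hH₂.q, hix₂, hk₂] at hk₃ hy₃ hw₃ hl₃ hft₃ hz₃ hyc₃
        refine (finish _ _ (by simpa) (by simpa) (by simpa) rfl ?_).mono
          fun k σ'' h => ⟨?_, ?_⟩
        · simp [hw₃, hy₃, hz₃, hft₃, h]
        · have := h.1
          simp at hk₂' ⊢
          omega
        · simpa using h.2
      · simp only [wp_seq, wp_assign]
        refine (mul_spec (by decide)).frame.mono ?_
        rintro k₃ σ₃ ⟨⟨hk₃, hw₃⟩, hF₃⟩
        have hy₃ := hF₃.v .y (by decide)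
        have hl₃ := hF₃.v .l (by decide)
        have hz₃ := hF₃.v .z (by decide)
        have hyc₃ := hF₃.a .ycol (by decide)
        simp [hy₂, hw₂, hH₂.l, hH₂.s, hH₂.b, hk₂] at hk₃ hy₃ hw₃ hl₃ hz₃ hyc₃
        refine (finish _ _ (by simpa) (by simpa) (by simpa) rfl ?_).mono
          fun k σ'' h => ⟨?_, ?_⟩
        · simp [hw₃, hz₃, not_lt.2 h]
        · have := h.1
          simp at hk₂' ⊢
          omega
        · simpa using h.2
  · intro k σ' hF hv hI hk
    refine ⟨hk.trans ?_, hI⟩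
    simp
    nlinarith [Nat.zero_le (p.q * p.J), Nat.zero_le (p.q * p.q)]

/-- The colors of the vertices. -/
def colorVertices : Cmd :=
  .for .v (var .n) (.store .col (var .v) (get .ycol (get .hx (get .cid (var .v)))))

theorem colorVertices_spec {inp : ℕ → ℕ} {σ : St} :
    wp inp colorVertices σ fun k σ' => k ≤ 50 * (σ.v .n + 1) ∧
      ∀ v < σ.v .n, σ'.a .col v = σ.a .ycol (σ.a .hx (σ.a .cid v)) := by
  refine wp_for (σ.v .n) 40 (fun v σ' => ∀ u < v, σ'.a .col u = σ.a .ycol (σ.a .hx (σ.a .cid u)))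
    (by decide) (by decide) (by decide) (by simp) (by simp) ?_ ?_
  · intro v hv σ₁ hF₁ hv₁ hI
    have h1 := hF₁.a .ycol (by decide)
    have h2 := hF₁.a .hx (by decide)
    have h3 := hF₁.a .cid (by decide)
    rw [wp_store]
    refine ⟨by simp, fun u hu => ?_⟩
    simp [hv₁, h1, h2, h3]
    split_ifs with h
    · rw [h]
    · exact hI u (by omega)
  · intro k σ' hF hv hI hk
    simp at hk ⊢
    exact ⟨by omega, hI⟩

end While

/-- As many cells as `S` has elements contain all of them, so no element is listed twice and a sum
over the cells is a sum over `S`. -/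
theorem RAM.HoldsSet.sum_eq {n : ℕ} {mem : ℕ → ℕ} {S : Finset (Fin n)} (h : RAM.HoldsSet mem S)
    (f : ℕ → ℕ) : ∑ i ∈ Finset.range S.card, f (mem (i + 1)) = ∑ v ∈ S, f v := by
  classical
  set T := Finset.range S.card with hT
  set g : ℕ → ℕ := fun i => mem (i + 1) with hg
  have hsub : S.map Fin.valEmbedding ⊆ T.image g := by
    intro x hx
    obtain ⟨v, hv, rfl⟩ := Finset.mem_map.1 hx
    obtain ⟨i, hi, hi'⟩ := (h.2 v).1 hv
    exact Finset.mem_image.2 ⟨i, Finset.mem_range.2 hi, hi'⟩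
  have hcT : (T.image g).card ≤ T.card := Finset.card_image_le
  have hTS : T.card = (S.map Fin.valEmbedding).card := by simp [hT]
  have heq := Finset.eq_of_subset_of_card_le hsub (hcT.trans hTS.le)
  have hinj : Set.InjOn g T := Finset.card_image_iff.1 (by rw [← heq, hTS])
  rw [← Finset.sum_image (f := f) (g := g) (fun x hx y hy => hinj hx hy), ← heq, Finset.sum_map]
  rfl

namespace While

open While.Expr (var lt ne get cond)
open RAM (Prog State Exec HoldsSet)

/-! ### The search for the best set -/

/-- The state stores the set `S` and its weight. -/
structure Stores {n : ℕ} (w : Fin n → ℕ) (S : Finset (Fin n)) (σ : St) : Prop where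
  weight : σ.v .bestW = weight w S
  card : σ.v .bestC = S.card
  mem : ∀ v, v ∈ S ↔ ∃ i < S.card, σ.a .out i = (v : ℕ)

theorem Stores.frame {n : ℕ} {w : Fin n → ℕ} {S : Finset (Fin n)} {σ σ' : St} (h : Stores w S σ)
    {V : List Var} {A : List Arr} (hF : Frame V A σ σ') (h1 : Var.bestW ∉ V) (h2 : Var.bestC ∉ V)
    (h3 : Arr.out ∉ A) : Stores w S σ' :=
  ⟨(hF.v _ h1).trans h.weight, (hF.v _ h2).trans h.card, by rw [hF.a _ h3]; exact h.mem⟩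

theorem Simulates.frame {σ σ' : St} {s : State} (h : Simulates σ s) {V : List Var} {A : List Arr}
    (hF : Frame V A σ σ') (hV : Var.gen ∉ V) (hA : ∀ B ∈ [Arr.rv, .rg, .mv, .mg], B ∉ A) :
    Simulates σ' s := by
  simp only [List.forall_mem_cons, List.not_mem_nil, false_imp_iff, implies_true, and_true] at hA
  obtain ⟨h1, h2, h3, h4⟩ := hA
  refine ⟨?_, ?_, ?_⟩
  · rw [hF.v _ hV, hF.a _ h1, hF.a _ h2]; exact h.reg
  · rw [hF.v _ hV, hF.a _ h3, hF.a _ h4]; exact h.mem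
  · rw [Stamped, hF.v _ hV, hF.a _ h2, hF.a _ h4]; exact h.stamped

theorem cost_memExpr : memExpr.cost = 34 := by simp [memExpr]

/-- Compare the output of the simulated machine with the best set so far. -/
def evaluate : Cmd :=
  (.adr ≔ 0) ;; (.cnt ≔ memExpr) ;; (.w ≔ 0) ;;
  .for .i (var .cnt) ((.adr ≔ var .i + 1) ;; (.w ≔ var .w + .inp (memExpr + 2))) ;;
  .ite (lt (var .bestW) (var .w))
    ((.bestW ≔ var .w) ;; (.bestC ≔ var .cnt) ;;
      .for .i (var .cnt) ((.adr ≔ var .i + 1) ;; .store .out (var .i) memExpr)) .skip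

theorem evaluate_spec {inp : ℕ → ℕ} {σ : St} {s : State} {n : ℕ} {w : Fin n → ℕ}
    {S S₀ : Finset (Fin n)} (hsim : Simulates σ s) (hS : HoldsSet s.mem S)
    (hw : ∀ v : Fin n, inp (v + 2) = w v) (hS₀ : Stores w S₀ σ) :
    wp inp evaluate σ fun k σ' => k ≤ 200 * (n + 1) ∧
      Stores w (if weight w S₀ < weight w S then S else S₀) σ' := by
  have hn : S.card ≤ n := (Finset.card_le_univ S).trans (by simp)
  have hW : ∑ i ∈ Finset.range S.card, inp (s.mem (i + 1) + 2) = weight w S := by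
    rw [hS.sum_eq fun x => inp (x + 2)]
    exact Finset.sum_congr rfl fun v _ => hw v
  simp only [evaluate, wp_seq, wp_assign, Expr.eval_ofNat]
  rw [(hsim.setV_adr 0).eval_memExpr, St.setV_v, if_pos rfl, hS.1]
  set σ₁ := ((σ.setV .adr 0).setV .cnt S.card).setV .w 0 with hσ₁
  have hF₁ : Frame [.adr, .cnt, .w] [] σ σ₁ :=
    (((Frame.refl _ _ _).setV (by decide) _).setV (by decide) _).setV (by decide) _
  refine wp_for S.card 60
    (fun i σ' => σ'.v .w = ∑ i ∈ Finset.range i, inp (s.mem (i + 1) + 2))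
    (by decide) (by decide) (by decide) (by simp [hσ₁]) (by simp [hσ₁]) ?_ ?_
  · intro i hi σ₂ hF₂ hv₂ hI
    have hsim₂ := (hsim.frame hF₁ (by decide) (by decide)).frame hF₂ (by decide) (by decide)
    rw [wp_seq, wp_assign, wp_assign]
    simp only [Expr.eval_add, Expr.eval_inp, Expr.eval_var, Expr.eval_ofNat, hv₂]
    rw [(hsim₂.setV_adr (i + 1)).eval_memExpr]
    refine ⟨by simp [cost_memExpr], ?_⟩
    simp [hI, Finset.sum_range_succ]
  · intro k₂ σ₂ hF₂ hv₂ hI hk₂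
    have hF₁₂ := (hF₁.mono (V' := [.adr, .cnt, .w, .i]) (A' := []) (by decide) (by decide)).trans
      (hF₂.mono (V' := [.adr, .cnt, .w, .i]) (A' := []) (by decide) (by decide))
    have hsim₂ := hsim.frame hF₁₂ (by decide) (by decide)
    have hst₂ := hS₀.frame hF₁₂ (by decide) (by decide) (by decide)
    have hcnt₂ := hF₂.v .cnt (by decide)
    simp only [hσ₁, St.setV_v, reduceCtorEq, if_false, if_true] at hcnt₂
    rw [hW] at hI
    rw [wp_ite]
    simp only [ne_eq, Expr.eval_lt, Expr.eval_var, hI, hst₂.weight, not_le]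
    refine ⟨fun h => ?_, fun h => ?_⟩
    · rw [if_pos h, wp_seq, wp_assign, wp_seq, wp_assign]
      have hF₃ : Frame [.bestW, .bestC] [] σ₂ ((σ₂.setV .bestW ((var .w).eval inp σ₂)).setV .bestC
          ((var .cnt).eval inp (σ₂.setV .bestW ((var .w).eval inp σ₂)))) :=
        ((Frame.refl _ _ _).setV (by decide) _).setV (by decide) _
      refine wp_for S.card 60 (fun i σ' => ∀ j < i, σ'.a .out j = s.mem (j + 1))
        (by decide) (by decide) (by decide) (by simp [hcnt₂]) (by simp) ?_ ?_
      · intro i hi σ₃ hF₄ hv₃ hI₃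
        have hsim₃ := (hsim₂.frame hF₃ (by decide) (by decide)).frame hF₄ (by decide) (by decide)
        rw [wp_seq, wp_assign, wp_store]
        simp only [Expr.eval_add, Expr.eval_var, Expr.eval_ofNat, hv₃]
        rw [(hsim₃.setV_adr (i + 1)).eval_memExpr]
        refine ⟨by simp [cost_memExpr], fun j hj => ?_⟩
        simp [hv₃]
        split_ifs with h'
        · rw [h']
        · exact hI₃ j (by omega)
      · intro k₃ σ₃ hF₄ hv₃ hI₃ hk₃
        have e1 := hF₄.v .bestW (by decide)
        have e2 := hF₄.v .bestC (by decide)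
        simp [hI, hcnt₂] at e1 e2
        refine ⟨?_, e1, e2, fun v => ?_⟩
        · simp [cost_memExpr] at hk₂ hk₃ ⊢
          omega
        · rw [hS.2 v]
          exact exists_congr fun i => and_congr_right fun hi => by rw [hI₃ i hi]
    · rw [if_neg (by omega), wp_skip]
      refine ⟨?_, hst₂⟩
      simp [cost_memExpr] at hk₂ ⊢
      omega

/-- A graph with vertex weights, a list of numbers, a program and a bound for its running time such
that the program computes the best colorful sets for all colorings that depend on the numbers of
the vertices only. -/
structure Task (inp : ℕ → ℕ) (p : Params) where
  G : SimpleGraph (Fin p.n)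
  w : Fin p.n → ℕ
  off : ℕ
  cid : Fin p.n → ℕ
  P : Prog
  T : ℕ
  weight_eq : ∀ v : Fin p.n, inp (v + 2) = w v
  cid_le : ∀ v, cid v ≤ p.n
  cid_ne : ∀ S : Finset (Fin p.n), G.IsIndepSet (S : Set (Fin p.n)) →
    Set.InjOn cid (S : Set (Fin p.n))
  solve : ∀ f : ℕ → ℕ, (∀ x, f x < p.l) → ∀ inp' : ℕ → ℕ, (∀ i < p.n + 2, inp' i = inp i) →
    (∀ v : Fin p.n, inp' (p.n + 2 + v) = f (cid v)) → (∀ i, inp' (p.n + p.n + 2 + i) = inp (i + off)) →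
    ∃ (k : ℕ) (s : State) (S : Finset (Fin p.n)), Exec inp' P State.init k s ∧ k ≤ T ∧
      HoldsSet s.mem S ∧ G.IsIndepSet (S : Set (Fin p.n)) ∧ S.card ≤ p.l ∧
      ∀ S' : Finset (Fin p.n), G.IsIndepSet (S' : Set (Fin p.n)) →
        Set.InjOn (fun v => f (cid v)) (S' : Set (Fin p.n)) → weight w S' ≤ weight w S

variable {inp : ℕ → ℕ} {p : Params}

namespace Task

variable (X : Task inp p)

/-- The state stores an independent set of at most `l` vertices whose weight is at least that of
every independent set on which a function in `D` is injective. -/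
def Best (D : Set (Fin p.n → ℕ)) (σ : St) : Prop :=
  ∃ S : Finset (Fin p.n), Stores X.w S σ ∧ X.G.IsIndepSet (S : Set (Fin p.n)) ∧ S.card ≤ p.l ∧
    ∀ f ∈ D, ∀ S' : Finset (Fin p.n), X.G.IsIndepSet (S' : Set (Fin p.n)) →
      Set.InjOn f (S' : Set (Fin p.n)) → weight X.w S' ≤ weight X.w S

variable {X}

theorem Best.mono {D D' : Set (Fin p.n → ℕ)} {σ : St} (h : X.Best D σ) (hD : D' ⊆ D) :
    X.Best D' σ := by
  obtain ⟨S, h1, h2, h3, h4⟩ := h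
  exact ⟨S, h1, h2, h3, fun f hf => h4 f (hD hf)⟩

theorem Best.frame {D : Set (Fin p.n → ℕ)} {σ σ' : St} (h : X.Best D σ)
    {V : List Var} {A : List Arr} (hF : Frame V A σ σ') (h1 : Var.bestW ∉ V) (h2 : Var.bestC ∉ V)
    (h3 : Arr.out ∉ A) : X.Best D σ' := by
  obtain ⟨S, h5, h6⟩ := h
  exact ⟨S, h5.frame hF h1 h2 h3, h6⟩

end Task

/-- The state is prepared for the search. -/
structure Ready (X : Task inp p) (M : ℕ) (ft : ℕ → ℕ) (σ : St) : Prop where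
  holds : Holds p σ
  off : σ.v .off = X.off
  M_eq : σ.v .M = M
  N1 : σ.v .N1 = p.q ^ p.J
  N2 : σ.v .N2 = M ^ p.s
  cid : ∀ v : Fin p.n, σ.a .cid v = X.cid v
  ft : σ.a .ft = ft

theorem Ready.frame {X : Task inp p} {M : ℕ} {ft : ℕ → ℕ} {σ σ' : St} (h : Ready X M ft σ)
    {V : List Var} {A : List Arr} (hF : Frame V A σ σ')
    (hV : ∀ x ∈ [Var.n, .l, .q, .s, .b, .r, .J, .Q, .off, .M, .N1, .N2], x ∉ V)
    (hA : ∀ B ∈ [Arr.red, .cid, .ft], B ∉ A) : Ready X M ft σ' := by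
  have h1 := h.holds.frame hF (fun x hx => hV x (by revert hx; revert x; decide))
    (hA _ (by decide))
  refine ⟨h1, (hF.v _ (hV _ (by decide))).trans h.off, (hF.v _ (hV _ (by decide))).trans h.M_eq,
    (hF.v _ (hV _ (by decide))).trans h.N1, (hF.v _ (hV _ (by decide))).trans h.N2, ?_,
    (hF.a _ (hA _ (by decide))).trans h.ft⟩
  rw [hF.a _ (hA _ (by decide))]
  exact h.cid

/-- The color of the number `x`. -/
def Params.colorOf (p : Params) (M : ℕ) (ft : ℕ → ℕ) (a e₁ e₂ x : ℕ) : ℕ :=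
  p.color (fun i y => ft (i * p.q + y)) (dig p.q e₁) (dig M e₂) (polyHash p.q a x)

/-- The coloring of the vertices. -/
def Task.coloring (X : Task inp p) (M : ℕ) (ft : ℕ → ℕ) (a e₁ e₂ : ℕ) (v : Fin p.n) : ℕ :=
  p.colorOf M ft a e₁ e₂ (X.cid v)

/-- Solve the task for the current coloring. -/
def tryColoring (P : Prog) : Cmd := colorTable ;; colorVertices ;; run P ;; evaluate

/-- The variables that the search for one coloring changes. -/
def tryV : List Var :=
  [.v, .y, .z, .x, .k, .w, .j, .i, .acc, .cnt, .lo, .hi, .adr, .gen, .bestW, .bestC, .carry]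

/-- The arrays that the search for one coloring changes. -/
def tryA : List Arr := [.ycol, .col, .rv, .rg, .mv, .mg, .out]

theorem tryColoring_modV (P : Prog) : (tryColoring P).modV ⊆ tryV := by
  simp only [tryColoring, Cmd.modV, List.append_subset]
  exact ⟨by decide, by decide, List.Subset.trans (run_modV P) (by decide), by decide⟩

theorem tryColoring_modA (P : Prog) : (tryColoring P).modA ⊆ tryA := by
  simp only [tryColoring, Cmd.modA, List.append_subset]
  exact ⟨by decide, by decide, List.Subset.trans (run_modA P) (by decide), by decide⟩

theorem Stamped.frame {σ σ' : St} (h : Stamped σ) {V : List Var} {A : List Arr}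
    (hF : Frame V A σ σ') (hV : Var.gen ∉ V) (h1 : Arr.rg ∉ A) (h2 : Arr.mg ∉ A) :
    Stamped σ' := by
  rw [Stamped, hF.v _ hV, hF.a _ h1, hF.a _ h2]; exact h

/-- The output for the new coloring is independent in the union and has at most `l` vertices, so it
may replace the stored set; keeping the heavier one preserves the bounds for all earlier colorings
in `D`. -/
theorem tryColoring_spec {X : Task inp p} (hp : p.Good) {M a e₁ e₂ : ℕ} {ft : ℕ → ℕ} {σ : St}
    (hR : Ready X M ft σ) (hst : Stamped σ) (hhx : ∀ x ≤ p.n, σ.a .hx x = polyHash p.q a x)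
    (hth : ∀ j < p.J, σ.a .th j = dig p.q e₁ j) (hix : ∀ j < p.s, σ.a .ix j = dig M e₂ j)
    {D : Set (Fin p.n → ℕ)} (hB : X.Best D σ) :
    wp inp (tryColoring X.P) σ fun k σ' =>
      k ≤ 300 * (p.q + 1) * (p.q + p.J + 1) + 250 * (p.n + 1) + 200 * X.T + 4 ∧
      Stamped σ' ∧ X.Best (insert (X.coloring M ft a e₁ e₂) D) σ' := by
  have hq := hp.field.1.two_le
  rw [tryColoring, wp_seq]
  refine (colorTable_spec hR.holds (p.b_le.trans hp.l_lt_q.le)).frame.mono ?_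
  rintro k₁ σ₁ ⟨⟨hk₁, hyc⟩, hF₁⟩
  rw [wp_seq]
  refine colorVertices_spec.frame.mono ?_
  rintro k₂ σ₂ ⟨⟨hk₂, hcol⟩, hF₂⟩
  have hF₁₂ := (hF₁.mono (V' := [.v, .y, .z, .x, .k, .w, .j, .i]) (A' := [.ycol, .col])
    (by decide) (by decide)).trans (hF₂.mono (by decide) (by decide))
  have hR₂ := hR.frame hF₁₂ (by decide) (by decide)
  have hst₂ := hst.frame hF₁₂ (by decide) (by decide) (by decide)
  obtain ⟨S₀, hS₀, hi₀, hc₀, hD₀⟩ := hB.frame hF₁₂ (by decide) (by decide) (by decide)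
  have hn₁ : σ₁.v .n = p.n := (hF₁.v .n (by decide)).trans hR.holds.n
  rw [hn₁] at hk₂ hcol
  have hcol' : ∀ v : Fin p.n, σ₂.a .col v = X.coloring M ft a e₁ e₂ v := by
    intro v
    rw [hcol v v.2, hF₁.a .hx (by decide), hF₁.a .cid (by decide), hR.cid, hhx _ (X.cid_le v),
      hyc _ (polyHash_lt (by omega) _ _)]
    rw [Task.coloring, Params.colorOf]
    exact Params.color_congr hth fun i hi => by rw [hix i hi, hR.ft]
  obtain ⟨kP, s', S, hexec, hkP, hS, hi, hc, hmax⟩ := X.solve (p.colorOf M ft a e₁ e₂)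
    (fun x => Params.color_lt hp.l_pos ..) (simInput inp σ₂)
    (fun i hi => by rw [simInput, hR₂.holds.n, if_pos hi])
    (fun v => by
      rw [simInput, hR₂.holds.n, if_neg (by omega), if_pos (by have := v.2; omega),
        Nat.add_sub_cancel_left]
      exact hcol' v)
    (fun i => by
      rw [simInput, hR₂.holds.n, if_neg (by omega), if_neg (by omega), Nat.add_sub_cancel_left,
        hR₂.off])
  rw [wp_seq]
  refine (run_spec (inp := inp) hexec hst₂ rfl).frame.mono ?_
  rintro k₃ σ₃ ⟨⟨hk₃, hsim⟩, hF₃⟩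
  have hF₃' := hF₃.mono (run_modV _) (run_modA _)
  refine (evaluate_spec hsim hS X.weight_eq
    (hS₀.frame hF₃' (by decide) (by decide) (by decide))).frame.mono ?_
  rintro k₄ σ₄ ⟨⟨hk₄, hS₄⟩, hF₄⟩
  refine ⟨by omega, hsim.stamped.frame hF₄ (by decide) (by decide) (by decide), _, hS₄, ?_⟩
  have hS₀S : weight X.w S₀ ≤ weight X.w (if weight X.w S₀ < weight X.w S then S else S₀) := by
    split_ifs <;> omega
  have hSS : weight X.w S ≤ weight X.w (if weight X.w S₀ < weight X.w S then S else S₀) := by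
    split_ifs <;> omega
  refine ⟨by split_ifs <;> assumption, by split_ifs <;> assumption, ?_⟩
  rintro f (rfl | hf) S' hS' hinj
  · exact (hmax S' hS' hinj).trans hSS
  · exact (hD₀ f hf S' hS' hinj).trans hS₀S

/-! ### Enumeration of all colorings of the family -/

/-- Try all choices of rows. -/
def tryRows (P : Prog) : Cmd := .for .e2 (var .N2) (tryColoring P ;; inc .ix .M .s)

/-- Try all choices of thresholds. -/
def tryThresholds (P : Prog) : Cmd := .for .e1 (var .N1) (tryRows P ;; inc .th .q .J)

/-- Try all choices of the hash function into the field. -/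
def tryHashes (P : Prog) : Cmd := .for .a (var .q) (mulRow ;; hashTable ;; tryThresholds P)

theorem tryRows_modV (P : Prog) : (tryRows P).modV ⊆ .e2 :: tryV := by
  simp only [tryRows, Cmd.for, Cmd.modV, List.append_subset]
  exact ⟨by decide, ⟨List.Subset.trans (tryColoring_modV P) (by decide), by decide⟩, by decide⟩

theorem tryRows_modA (P : Prog) : (tryRows P).modA ⊆ .ix :: tryA := by
  simp only [tryRows, Cmd.for, Cmd.modA, List.append_subset]
  exact ⟨by decide, ⟨List.Subset.trans (tryColoring_modA P) (by decide), by decide⟩, by decide⟩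

theorem tryThresholds_modV (P : Prog) : (tryThresholds P).modV ⊆ .e1 :: .e2 :: tryV := by
  simp only [tryThresholds, Cmd.for, Cmd.modV, List.append_subset]
  exact ⟨by decide, ⟨List.Subset.trans (tryRows_modV P) (by decide), by decide⟩, by decide⟩

theorem tryThresholds_modA (P : Prog) : (tryThresholds P).modA ⊆ .th :: .ix :: tryA := by
  simp only [tryThresholds, Cmd.for, Cmd.modA, List.append_subset]
  exact ⟨by decide, ⟨List.Subset.trans (tryRows_modA P) (by decide), by decide⟩, by decide⟩

theorem dig_pow_self (R k : ℕ) {j : ℕ} (hj : j < k) : dig R (R ^ k) j = 0 := by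
  rcases Nat.eq_zero_or_pos R with rfl | hR
  · rw [zero_pow (by omega), dig_zero_left]
  · rw [dig, Nat.pow_div hj.le hR]
    exact Nat.mod_eq_zero_of_dvd (dvd_pow_self _ (by omega))

/-- The time for one coloring. -/
def Task.time (X : Task inp p) : ℕ :=
  (p.q + 1) * (p.q + p.J + p.s + 1) + (p.n + 1) + X.T

theorem tryRows_spec {X : Task inp p} (hp : p.Good) {M a e₁ : ℕ} {ft : ℕ → ℕ} {σ : St}
    (hR : Ready X M ft σ) (hst : Stamped σ) (hhx : ∀ x ≤ p.n, σ.a .hx x = polyHash p.q a x)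
    (hth : ∀ j < p.J, σ.a .th j = dig p.q e₁ j) (hix : ∀ j < p.s, σ.a .ix j = 0)
    {D : Set (Fin p.n → ℕ)} (hB : X.Best D σ) :
    wp inp (tryRows X.P) σ fun k σ' => k ≤ 400 * (M ^ p.s + 1) * X.time ∧ Stamped σ' ∧
      (∀ j < p.s, σ'.a .ix j = 0) ∧
      X.Best (D ∪ {f | ∃ e₂ < M ^ p.s, f = X.coloring M ft a e₁ e₂}) σ' := by
  have hq := hp.field.1.two_le
  refine wp_for_frame (M ^ p.s) tryV (.ix :: tryA) (380 * X.time) (fun e₂ σ' => Stamped σ' ∧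
      (∀ j < p.s, σ'.a .ix j = dig M e₂ j) ∧
      X.Best (D ∪ {f | ∃ e < e₂, f = X.coloring M ft a e₁ e}) σ') ?_ ?_ ?_ (by decide) (by decide)
      (by simp [hR.N2]) ?_ ?_ ?_
  · simp only [Cmd.modV, List.append_subset]
    exact ⟨List.Subset.trans (tryColoring_modV _) (by decide), by decide⟩
  · simp only [Cmd.modA, List.append_subset]
    exact ⟨List.Subset.trans (tryColoring_modA _) (by decide), by decide⟩
  · simp only [Cmd.modV, List.mem_append, not_or]
    exact ⟨fun h => absurd (tryColoring_modV _ h) (by decide), by decide⟩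
  · have hF : Frame [.e2] [] σ (σ.setV .e2 0) := (Frame.refl _ _ _).setV (by decide) _
    refine ⟨hst.frame hF (by decide) (by decide) (by decide), fun j hj => ?_,
      (hB.frame hF (by decide) (by decide) (by decide)).mono (by simp)⟩
    rw [St.setV_a, hix j hj, dig_zero_left]
  · rintro e₂ he₂ σ₁ hF₁ hv₁ ⟨hst₁, hix₁, hB₁⟩
    have hR₁ := hR.frame hF₁ (by decide) (by decide)
    -- The counter in base `M` needs a positive base; for `M = 0` there are `0 ^ s = 0` choices and
    -- the body is never entered.
    have hM : 0 < M := by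
      rcases Nat.eq_zero_or_pos M with rfl | h
      · rw [zero_pow hp.s_pos.ne'] at he₂; omega
      · exact h
    rw [wp_seq]
    refine (tryColoring_spec hp hR₁ hst₁ (fun x hx => by rw [hF₁.a .hx (by decide)]; exact hhx x hx)
      (fun j hj => by rw [hF₁.a .th (by decide)]; exact hth j hj) hix₁ hB₁).frame.mono ?_
    rintro k₂ σ₂ ⟨⟨hk₂, hst₂, hB₂⟩, hF₂⟩
    have hF₂' := hF₂.mono (tryColoring_modV _) (tryColoring_modA _)
    have hR₂ := hR₁.frame hF₂' (by decide) (by decide)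
    refine (inc_spec (E := e₂) (by decide) (by rw [hR₂.M_eq]; exact hM) ?_).frame.mono ?_
    · intro j hj
      rw [hR₂.holds.s] at hj
      rw [hF₂'.a .ix (by decide), hR₂.M_eq, hix₁ j hj]
    · rintro k₃ σ₃ ⟨⟨hk₃, hix₃⟩, hF₃⟩
      rw [hR₂.holds.s, hR₂.M_eq] at hix₃
      rw [hR₂.holds.s] at hk₃
      have hF₃' := (hF₃.mono (V' := [.carry, .i, .e2]) (A' := [.ix])
        (by decide) (by decide)).setV (x := .e2) (by decide) (e₂ + 1)
      refine ⟨?_, hst₂.frame hF₃' (by decide) (by decide) (by decide), by simpa using hix₃,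
        (hB₂.frame hF₃' (by decide) (by decide) (by decide)).mono ?_⟩
      · have : (p.q + 1) * (p.q + p.J + p.s + 1) =
            (p.q + 1) * (p.q + p.J + 1) + p.q * p.s + p.s := by ring
        rw [mul_assoc] at hk₂
        rw [Task.time, this]
        omega
      · rintro f (hf | ⟨e, he, rfl⟩)
        · exact .inr (.inl hf)
        · rcases Nat.lt_succ_iff_lt_or_eq.1 he with he | rfl
          · exact .inr (.inr ⟨e, he, rfl⟩)
          · exact .inl rfl
  · rintro k σ₁ hF₁ hv₁ ⟨hst₁, hix₁, hB₁⟩ hk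
    refine ⟨hk.trans ?_, hst₁, fun j hj => by rw [hix₁ j hj, dig_pow_self _ _ hj], hB₁⟩
    have : 1 ≤ X.time := by rw [Task.time]; omega
    simp
    nlinarith

theorem tryThresholds_spec {X : Task inp p} (hp : p.Good) {M a : ℕ} {ft : ℕ → ℕ} {σ : St}
    (hR : Ready X M ft σ) (hst : Stamped σ) (hhx : ∀ x ≤ p.n, σ.a .hx x = polyHash p.q a x)
    (hth : ∀ j < p.J, σ.a .th j = 0) (hix : ∀ j < p.s, σ.a .ix j = 0)
    {D : Set (Fin p.n → ℕ)} (hB : X.Best D σ) :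
    wp inp (tryThresholds X.P) σ fun k σ' =>
      k ≤ 520 * p.q ^ p.J * (M ^ p.s + 1) * X.time ∧ Stamped σ' ∧
      (∀ j < p.J, σ'.a .th j = 0) ∧ (∀ j < p.s, σ'.a .ix j = 0) ∧
      X.Best (D ∪ {f | ∃ e₁ < p.q ^ p.J, ∃ e₂ < M ^ p.s, f = X.coloring M ft a e₁ e₂}) σ' := by
  have hq := hp.field.1.two_le
  have htime : p.J + 1 ≤ X.time := by
    rw [Task.time]
    nlinarith [Nat.zero_le (p.q * (p.q + p.J + p.s + 1))]
  refine wp_for_frame (p.q ^ p.J) (.e2 :: tryV) (.th :: .ix :: tryA)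
    (500 * (M ^ p.s + 1) * X.time) (fun e₁ σ' => Stamped σ' ∧
      (∀ j < p.J, σ'.a .th j = dig p.q e₁ j) ∧ (∀ j < p.s, σ'.a .ix j = 0) ∧
      X.Best (D ∪ {f | ∃ e < e₁, ∃ e₂ < M ^ p.s, f = X.coloring M ft a e e₂}) σ') ?_ ?_ ?_
      (by decide) (by decide) (by simp [hR.N1]) ?_ ?_ ?_
  · simp only [Cmd.modV, List.append_subset]
    exact ⟨List.Subset.trans (tryRows_modV _) (by decide), by decide⟩
  · simp only [Cmd.modA, List.append_subset]
    exact ⟨List.Subset.trans (tryRows_modA _) (by decide), by decide⟩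
  · simp only [Cmd.modV, List.mem_append, not_or]
    exact ⟨fun h => absurd (tryRows_modV _ h) (by decide), by decide⟩
  · have hF : Frame [.e1] [] σ (σ.setV .e1 0) := (Frame.refl _ _ _).setV (by decide) _
    refine ⟨hst.frame hF (by decide) (by decide) (by decide), fun j hj => ?_, by simpa using hix,
      (hB.frame hF (by decide) (by decide) (by decide)).mono (by simp)⟩
    rw [St.setV_a, hth j hj, dig_zero_left]
  · rintro e₁ he₁ σ₁ hF₁ hv₁ ⟨hst₁, hth₁, hix₁, hB₁⟩
    have hR₁ := hR.frame hF₁ (by decide) (by decide)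
    rw [wp_seq]
    refine (tryRows_spec hp hR₁ hst₁ (fun x hx => by rw [hF₁.a .hx (by decide)]; exact hhx x hx)
      hth₁ hix₁ hB₁).frame.mono ?_
    rintro k₂ σ₂ ⟨⟨hk₂, hst₂, hix₂, hB₂⟩, hF₂⟩
    have hF₂' := hF₂.mono (tryRows_modV _) (tryRows_modA _)
    have hR₂ := hR₁.frame hF₂' (by decide) (by decide)
    refine (inc_spec (E := e₁) (by decide) (by rw [hR₂.holds.q]; omega) ?_).frame.mono ?_
    · intro j hj
      rw [hR₂.holds.J] at hj
      rw [hF₂'.a .th (by decide), hR₂.holds.q, hth₁ j hj]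
    · rintro k₃ σ₃ ⟨⟨hk₃, hth₃⟩, hF₃⟩
      rw [hR₂.holds.J, hR₂.holds.q] at hth₃
      rw [hR₂.holds.J] at hk₃
      have hF₃' := (hF₃.mono (V' := [.carry, .i, .e1]) (A' := [.th])
        (by decide) (by decide)).setV (x := .e1) (by decide) (e₁ + 1)
      refine ⟨?_, hst₂.frame hF₃' (by decide) (by decide) (by decide), by simpa using hth₃,
        by rw [hF₃'.a .ix (by decide)]; exact hix₂,
        (hB₂.frame hF₃' (by decide) (by decide) (by decide)).mono ?_⟩
      · have : X.time ≤ (M ^ p.s + 1) * X.time := Nat.le_mul_of_pos_left _ (by omega)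
        rw [mul_assoc] at hk₂ ⊢
        omega
      · rintro f (hf | ⟨e, he, h⟩)
        · exact .inl (.inl hf)
        · rcases Nat.lt_succ_iff_lt_or_eq.1 he with he | rfl
          · exact .inl (.inr ⟨e, he, h⟩)
          · exact .inr h
  · rintro k σ₁ hF₁ hv₁ ⟨hst₁, hth₁, hix₁, hB₁⟩ hk
    refine ⟨hk.trans ?_, hst₁, fun j hj => by rw [hth₁ j hj, dig_pow_self _ _ hj], hix₁, hB₁⟩
    have h1 : 1 ≤ (M ^ p.s + 1) * X.time := Nat.mul_pos (by omega) (by omega)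
    have h2 : 1 ≤ p.q ^ p.J := Nat.pow_pos (by omega)
    simp
    rw [mul_assoc 500, mul_assoc _ (M ^ p.s + 1)]
    generalize (M ^ p.s + 1) * X.time = Y at h1 ⊢
    generalize p.q ^ p.J = Z at h2 ⊢
    nlinarith

theorem tryHashes_spec {X : Task inp p} (hp : p.Good) {M : ℕ} {ft : ℕ → ℕ} {σ : St}
    (hR : Ready X M ft σ) (hst : Stamped σ)
    (hth : ∀ j < p.J, σ.a .th j = 0) (hix : ∀ j < p.s, σ.a .ix j = 0)
    {D : Set (Fin p.n → ℕ)} (hB : X.Best D σ) :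
    wp inp (tryHashes X.P) σ fun k σ' =>
      k ≤ 1000 * p.q * p.q ^ p.J * (M ^ p.s + 1) * X.time ∧
      X.Best {f | ∃ a < p.q, ∃ e₁ < p.q ^ p.J, ∃ e₂ < M ^ p.s, f = X.coloring M ft a e₁ e₂} σ' := by
  have hq := hp.field.1.two_le
  have htime : p.q + p.n + 1 ≤ X.time := by
    rw [Task.time]
    nlinarith [Nat.zero_le (p.q * (p.q + p.J + p.s + 1))]
  have hYY : X.time ≤ p.q ^ p.J * (M ^ p.s + 1) * X.time :=
    Nat.le_mul_of_pos_left _ (Nat.mul_pos (Nat.pow_pos (by omega)) (by omega))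
  refine wp_for_frame p.q (.e1 :: .e2 :: tryV) (.mr :: .hx :: .th :: .ix :: tryA)
    (800 * (p.q ^ p.J * (M ^ p.s + 1) * X.time)) (fun a σ' => Stamped σ' ∧
      (∀ j < p.J, σ'.a .th j = 0) ∧ (∀ j < p.s, σ'.a .ix j = 0) ∧
      X.Best {f | ∃ a' < a, ∃ e₁ < p.q ^ p.J, ∃ e₂ < M ^ p.s, f = X.coloring M ft a' e₁ e₂} σ')
      ?_ ?_ ?_ (by decide) (by decide) (by simp [hR.holds.q]) ?_ ?_ ?_
  · simp only [Cmd.modV, List.append_subset]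
    exact ⟨by decide, by decide, List.Subset.trans (tryThresholds_modV _) (by decide)⟩
  · simp only [Cmd.modA, List.append_subset]
    exact ⟨by decide, by decide, List.Subset.trans (tryThresholds_modA _) (by decide)⟩
  · simp only [Cmd.modV, List.mem_append, not_or]
    exact ⟨by decide, by decide, fun h => absurd (tryThresholds_modV _ h) (by decide)⟩
  · have hF : Frame [.a] [] σ (σ.setV .a 0) := (Frame.refl _ _ _).setV (by decide) _
    exact ⟨hst.frame hF (by decide) (by decide) (by decide), by simpa using hth, by simpa using hix,
      (hB.frame hF (by decide) (by decide) (by decide)).mono (by simp)⟩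
  · rintro a ha σ₁ hF₁ hv₁ ⟨hst₁, hth₁, hix₁, hB₁⟩
    have hR₁ := hR.frame hF₁ (by decide) (by decide)
    rw [wp_seq]
    refine (mulRow_spec (by rw [hv₁, hR₁.holds.q]; exact ha)).frame.mono ?_
    rintro k₂ σ₂ ⟨⟨hk₂, hmr⟩, hF₂⟩
    have hR₂ := hR₁.frame hF₂ (by decide) (by decide)
    rw [hR₁.holds.q] at hk₂ hmr
    rw [hv₁] at hmr
    rw [wp_seq]
    refine (hashTable_spec hR₂.holds.q hq hmr).frame.mono ?_
    rintro k₃ σ₃ ⟨⟨hk₃, hhx⟩, hF₃⟩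
    rw [hR₂.holds.n] at hk₃ hhx
    have hF₁₃ := (hF₂.mono (V' := tryV) (A' := [.mr, .hx]) (by decide) (by decide)).trans
      (hF₃.mono (by decide) (by decide))
    have hF' := (hF₂.mono (V' := [.y, .z, .x, .acc, .lo, .hi]) (A' := [.mr, .hx])
      (by decide) (by decide)).trans (hF₃.mono (by decide) (by decide))
    refine (tryThresholds_spec hp (hR₁.frame hF' (by decide) (by decide))
      (hst₁.frame hF' (by decide) (by decide) (by decide)) hhx
      (by rw [hF'.a .th (by decide)]; exact hth₁) (by rw [hF'.a .ix (by decide)]; exact hix₁)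
      (hB₁.frame hF' (by decide) (by decide) (by decide))).mono ?_
    rintro k₄ σ₄ ⟨hk₄, hst₄, hth₄, hix₄, hB₄⟩
    have hF₄ : Frame [.a] [] σ₄ (σ₄.setV .a (a + 1)) := (Frame.refl _ _ _).setV (by decide) _
    refine ⟨?_, hst₄.frame hF₄ (by decide) (by decide) (by decide), by simpa using hth₄,
      by simpa using hix₄, (hB₄.frame hF₄ (by decide) (by decide) (by decide)).mono ?_⟩
    · rw [mul_assoc 520, mul_assoc 520] at hk₄
      omega
    · rintro f ⟨e, he, h⟩
      rcases Nat.lt_succ_iff_lt_or_eq.1 he with he | rfl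
      · exact .inl ⟨e, he, h⟩
      · exact .inr h
  · rintro k σ₁ hF₁ hv₁ ⟨hst₁, hth₁, hix₁, hB₁⟩ hk
    refine ⟨hk.trans ?_, hB₁⟩
    simp
    rw [mul_assoc (1000 * p.q), mul_assoc (1000 * p.q)]
    generalize p.q ^ p.J * (M ^ p.s + 1) * X.time = Y at hYY ⊢
    nlinarith

/-- An independent set meets each cluster at most once, and some coloring of the family is injective
on its at most `l` cluster numbers, hence on the set; so the stored weight is at least its weight.
-/
theorem Task.Best.isMax {X : Task inp p} (hp : p.Good) {M : ℕ} {ft : ℕ → ℕ} {σ : St}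
    (hF : p.IsPerfect M fun i y => ft (i * p.q + y))
    (h : X.Best {f | ∃ a < p.q, ∃ e₁ < p.q ^ p.J, ∃ e₂ < M ^ p.s, f = X.coloring M ft a e₁ e₂} σ) :
    ∃ S, Stores X.w S σ ∧ IsMaxWeightIndepSetOfSizeLE X.G X.w p.l S := by
  classical
  obtain ⟨S, h1, h2, h3, h4⟩ := h
  refine ⟨S, h1, ⟨h2, h3⟩, fun S' ⟨hS', hc⟩ => ?_⟩
  have hinj := X.cid_ne S' hS'
  obtain ⟨a, ha, e₁, he₁, e₂, he₂, hi⟩ := hp.exists_color_injOn hF (S'.image X.cid)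
    (by simp [X.cid_le]) (Finset.card_image_le.trans hc)
  refine h4 _ ⟨a, ha, e₁, he₁, e₂, he₂, rfl⟩ S' hS' fun u hu v hv huv => ?_
  exact hinj hu hv (hi (by simpa using ⟨u, hu, rfl⟩) (by simpa using ⟨v, hv, rfl⟩) huv)

end While

namespace While

open While.Expr (var lt ne get cond)
open RAM (Prog State Exec HoldsSet)

/-! ### The whole algorithm -/

/-- Read the input and compute the clusters, the parameters and the table of rows. -/
def prepare : Cmd :=
  (.n ≔ .inp 0) ;; (.l ≔ .inp 1) ;; (.off ≔ var .n + var .n + 3 + .inp (var .n + var .n + 2)) ;;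
  clusters ;; (.x ≔ var .l) ;; mul .ll .k .l .x ;; (.ll ≔ var .ll + var .ll) ;; findField ;;
  findBlocks ;; findParams ;; greedy ;; pow .N1 .q .J ;; pow .N2 .M .s

theorem Params.numBlocks_pos (n l q : ℕ) : 0 < numBlocks n l q := by
  rw [numBlocks]; split_ifs <;> omega

theorem prepare_spec {inp : ℕ → ℕ} {p : Params} {G : SimpleGraph (Fin p.n)} (L : AdjLists G)
    (hG : G ∈ clusterGraphs p.n) (h0 : inp 0 = p.n) (h1 : inp 1 = p.l) (hp : p.Good)
    (hs : p.s = Params.numBlocks p.n p.l p.q)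
    (hmin : ∀ q, GoodField p.n (2 * (p.l * p.l)) q → p.q ≤ q)
    (hlen : ∀ v : Fin p.n, inp (p.n + 2 + v + 1) - inp (p.n + 2 + v) = (L.nbrs v).length)
    (hnbr : ∀ v : Fin p.n, ∀ j (h : j < (L.nbrs v).length),
      inp (inp (p.n + 2 + v) + p.n + p.n + 3 + j) = (L.nbrs v)[j]) :
    wp inp prepare St.init fun k σ =>
      k ≤ 300 * (p.n + 1) + 4800 * (p.Q + 1) ^ 3 * (p.q + 1) ^ 4 + p.J * (12 * p.q + 20) +
        p.s * (12 * σ.v .M + 20) ∧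
      Holds p σ ∧ σ.v .off = p.n + p.n + 3 + inp (p.n + p.n + 2) ∧
      σ.v .N1 = p.q ^ p.J ∧ σ.v .N2 = σ.v .M ^ p.s ∧
      (∀ v : Fin p.n, σ.a .cid v = (clusterRep G v : ℕ) + 1) ∧
      p.IsPerfect (σ.v .M) (fun i y => σ.a .ft (i * p.q + y)) ∧ σ.v .M ≤ p.Q ∧
      (σ.v .M = 0 ∨
        p.Q ^ (σ.v .M - 1) ≤ p.Q * (p.Q - numSeparating p.q p.b) ^ (σ.v .M - 1)) := by
  have hl := hp.l_pos
  have hlq := hp.l_lt_q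
  simp only [prepare, wp_seq, wp_assign]
  set σ₀ := ((St.init.setV .n ((Expr.inp 0).eval inp St.init)).setV .l
    ((Expr.inp 1).eval inp (St.init.setV .n ((Expr.inp 0).eval inp St.init)))) with hσ₀
  have hn₀ : σ₀.v .n = p.n := by simp [hσ₀, h0]
  have hl₀ : σ₀.v .l = p.l := by simp [hσ₀, h1]
  have ha₀ : σ₀.a = fun _ _ => 0 := rfl
  refine (clusters_spec L hG (by simpa using hn₀) (by simp [ha₀]) hlen hnbr).frame.mono ?_
  rintro k₁ σ₁ ⟨⟨hk₁, hcid₁⟩, hF₁⟩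
  have hn₁ := hF₁.v .n (by decide)
  have hl₁ := hF₁.v .l (by decide)
  have hoff₁ := hF₁.v .off (by decide)
  simp [hn₀, hl₀] at hn₁ hl₁ hoff₁
  refine (mul_spec (by decide)).frame.mono ?_
  rintro k₂ σ₂ ⟨⟨hk₂, hll₂⟩, hF₂⟩
  have hn₂ := hF₂.v .n (by decide)
  have hl₂ := hF₂.v .l (by decide)
  simp [hn₁, hl₁] at hn₂ hl₂ hk₂ hll₂
  have hll : ((σ₂.setV .ll ((var .ll + var .ll : Expr).eval inp σ₂)).v .ll) = 2 * (p.l * p.l) := by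
    simp [hll₂]; ring
  have hn₂' : ((σ₂.setV .ll ((var .ll + var .ll : Expr).eval inp σ₂)).v .n) = p.n := by simp [hn₂]
  refine (findField_spec (q₀ := p.q) (by rw [hll]; positivity) (by rw [hll, hn₂']; exact hp.field)
    (by rw [hll, hn₂']; exact hmin)).frame.mono ?_
  rintro k₃ σ₃ ⟨⟨hk₃, hq₃⟩, hF₃⟩
  have hn₃ := hF₃.v .n (by decide)
  have hl₃ := hF₃.v .l (by decide)
  simp [hn₂, hl₂] at hn₃ hl₃
  refine (findBlocks_spec (by omega)).frame.mono ?_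
  rintro k₄ σ₄ ⟨⟨hk₄, hs₄⟩, hF₄⟩
  have hn₄ := (hF₄.v .n (by decide)).trans hn₃
  have hl₄ := (hF₄.v .l (by decide)).trans hl₃
  have hq₄ := (hF₄.v .q (by decide)).trans hq₃
  rw [hn₃, hl₃, hq₃, ← hs] at hs₄
  rw [hl₃, hq₃] at hk₄
  refine (findParams_spec hn₄ hl₄ hq₄ hs₄ hp.s_pos).frame.mono ?_
  rintro k₅ σ₅ ⟨⟨hk₅, hH₅⟩, hF₅⟩
  have ha₅ : ∀ A ∈ [Arr.td, .zd, .dead], ∀ i, σ₅.a A i = 0 := by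
    intro A hA i
    simp only [List.mem_cons, List.not_mem_nil, or_false] at hA
    rcases hA with rfl | rfl | rfl <;>
    · rw [hF₅.a _ (by decide), hF₄.a _ (by decide), hF₃.a _ (by decide), St.setV_a,
        hF₂.a _ (by decide), St.setV_a, hF₁.a _ (by decide)]
      rfl
  refine (greedy_spec hp hH₅ (ha₅ _ (by decide)) (ha₅ _ (by decide))
    (ha₅ _ (by decide))).frame.mono ?_
  rintro k₆ σ₆ ⟨⟨hk₆, hH₆, hperf, hM, hdecay⟩, hF₆⟩
  refine (pow_spec (by decide)).frame.mono ?_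
  rintro k₇ σ₇ ⟨⟨hk₇, hN₁⟩, hF₇⟩
  rw [hH₆.q, hH₆.J] at hk₇ hN₁
  have hM₇ := hF₇.v .M (by decide)
  refine (pow_spec (by decide)).frame.mono ?_
  rintro k₈ σ₈ ⟨⟨hk₈, hN₂⟩, hF₈⟩
  have hH₇ := hH₆.frame hF₇ (by decide) (by decide)
  have hM₈ := hF₈.v .M (by decide)
  rw [hH₇.s, ← hM₈] at hk₈ hN₂
  rw [← hM₇, ← hM₈] at hM hdecay hperf
  refine ⟨?_, hH₇.frame hF₈ (by decide) (by decide), ?_, ?_, hN₂, fun v => ?_, ?_, hM, hdecay⟩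
  · have e1 : 1200 * (p.l + 1) * (p.q + 1) ≤ 1200 * (p.q + 1) ^ 4 := by
      rw [mul_assoc]
      refine Nat.mul_le_mul_left _ ?_
      calc (p.l + 1) * (p.q + 1) ≤ (p.q + 1) * (p.q + 1) := Nat.mul_le_mul_right _ (by omega)
        _ = (p.q + 1) ^ 2 := by ring
        _ ≤ _ := Nat.pow_le_pow_right (by omega) (by norm_num)
    have e2 : (p.Q + 1) ^ 3 * (p.q + 1) ^ 3 ≤ (p.Q + 1) ^ 3 * (p.q + 1) ^ 4 :=
      Nat.mul_le_mul_left _ (Nat.pow_le_pow_right (by omega) (by norm_num))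
    have e3 : (p.q + 1) ^ 4 ≤ (p.Q + 1) ^ 3 * (p.q + 1) ^ 4 :=
      Nat.le_mul_of_pos_left _ (Nat.pow_pos (by omega))
    have e4 : p.q + 1 ≤ (p.q + 1) ^ 4 := Nat.le_self_pow (by norm_num) _
    rw [mul_assoc] at e1 hk₄ hk₅ hk₆
    rw [mul_assoc 4800]
    simp
    omega
  · rw [hF₈.v .off (by decide), hF₇.v .off (by decide), hF₆.v .off (by decide),
      hF₅.v .off (by decide), hF₄.v .off (by decide), hF₃.v .off (by decide), St.setV_v,
      if_neg (by decide), hF₂.v .off (by decide), St.setV_v, if_neg (by decide), hoff₁]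
  · rw [hF₈.v .N1 (by decide), hN₁]
  · rw [hF₈.a .cid (by decide), hF₇.a .cid (by decide), hF₆.a .cid (by decide),
      hF₅.a .cid (by decide), hF₄.a .cid (by decide), hF₃.a .cid (by decide), St.setV_a,
      hF₂.a .cid (by decide), St.setV_a, hcid₁]
  · rw [hF₈.a .ft (by decide), hF₇.a .ft (by decide)]
    exact hperf

theorem prepare_modV : ∀ x ∈ [Var.gen, .bestW, .bestC], x ∉ prepare.modV := by decide

theorem prepare_modA : ∀ A ∈ [Arr.rg, .mg, .th, .ix], A ∉ prepare.modA := by decide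

/-- Apart from the greedy search, which is the term `A`, the preparation is absorbed by doubling the
bound for the search over the colorings. -/
theorem prepare_add_search_le {k₁ k₂ n q J s M A T : ℕ} (hs : 0 < s) (hq : 2 ≤ q)
    (h₁ : k₁ ≤ 300 * (n + 1) + A + J * (12 * q + 20) + s * (12 * M + 20))
    (h₂ : k₂ ≤ 1000 * q * q ^ J * (M ^ s + 1) * ((q + 1) * (q + J + s + 1) + (n + 1) + T)) :
    k₁ + k₂ ≤ A + 2000 * q * q ^ J * (M ^ s + 1) * ((q + 1) * (q + J + s + 1) + (n + 1) + T) := by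
  have ht : (q + 1) * (q + J + s + 1) = q * q + 2 * q + q * J + J + q * s + s + 1 := by ring
  generalize htime : (q + 1) * (q + J + s + 1) + (n + 1) + T = t at *
  have h3 : J * (12 * q + 20) = 12 * (q * J) + 20 * J := by ring
  have h4 : M ≤ M ^ s := Nat.le_self_pow hs.ne' _
  have h5 : s * (12 * M + 20) ≤ 20 * ((M ^ s + 1) * t) :=
    calc s * (12 * M + 20) ≤ t * (20 * (M ^ s + 1)) := Nat.mul_le_mul (by omega) (by omega)
      _ = _ := by ring
  have h6 : t ≤ (M ^ s + 1) * t := Nat.le_mul_of_pos_left _ (by omega)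
  have h7 : 2 ≤ q * q ^ J := hq.trans (Nat.le_mul_of_pos_right _ (Nat.pow_pos (by omega)))
  have h8 : 2 * ((M ^ s + 1) * t) ≤ q * q ^ J * ((M ^ s + 1) * t) := Nat.mul_le_mul_right _ h7
  have e : ∀ c, c * q * q ^ J * (M ^ s + 1) * t = c * (q * q ^ J * ((M ^ s + 1) * t)) :=
    fun c => by ring
  rw [e] at h₂ ⊢
  omega

/-- The algorithm that calls the program `P` for colorful sets. -/
def solver (P : Prog) : Cmd := prepare ;; tryHashes P

/-- `M` is the number of rows found by the greedy construction, read off the state after the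
preparation; the time bound is stated in terms of it and estimated later. -/
theorem solver_spec {inp : ℕ → ℕ} {p : Params} {G : SimpleGraph (Fin p.n)} (L : AdjLists G)
    (hG : G ∈ clusterGraphs p.n) (h0 : inp 0 = p.n) (h1 : inp 1 = p.l) (hp : p.Good)
    (hs : p.s = Params.numBlocks p.n p.l p.q)
    (hmin : ∀ q, GoodField p.n (2 * (p.l * p.l)) q → p.q ≤ q)
    (hlen : ∀ v : Fin p.n, inp (p.n + 2 + v + 1) - inp (p.n + 2 + v) = (L.nbrs v).length)
    (hnbr : ∀ v : Fin p.n, ∀ j (h : j < (L.nbrs v).length),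
      inp (inp (p.n + 2 + v) + p.n + p.n + 3 + j) = (L.nbrs v)[j]) (X : Task inp p)
    (hoff : X.off = p.n + p.n + 3 + inp (p.n + p.n + 2))
    (hcid : ∀ v, X.cid v = (clusterRep G v : ℕ) + 1) :
    ∃ M, M ≤ p.Q ∧
      (M = 0 ∨ p.Q ^ (M - 1) ≤ p.Q * (p.Q - numSeparating p.q p.b) ^ (M - 1)) ∧
      wp inp (solver X.P) St.init fun k σ =>
        k ≤ 4800 * (p.Q + 1) ^ 3 * (p.q + 1) ^ 4 +
          2000 * p.q * p.q ^ p.J * (M ^ p.s + 1) * X.time ∧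
        ∃ S, Stores X.w S σ ∧ IsMaxWeightIndepSetOfSizeLE X.G X.w p.l S := by
  have hq := hp.field.1.two_le
  obtain ⟨k₁, σ₁, hexec, ⟨hk₁, hH, hoff₁, hN1, hN2, hcid₁, hperf, hM, hdecay⟩, hF⟩ :=
    (prepare_spec L hG h0 h1 hp hs hmin hlen hnbr).frame
  refine ⟨σ₁.v .M, hM, hdecay, ?_⟩
  rw [solver, wp_seq]
  refine ⟨k₁, σ₁, hexec, ?_⟩
  have hR : Ready X (σ₁.v .M) (σ₁.a .ft) σ₁ :=
    ⟨hH, by rw [hoff₁, hoff], rfl, hN1, hN2, fun v => by rw [hcid₁, hcid], rfl⟩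
  have hst : Stamped σ₁ := by
    intro i
    rw [hF.v _ (prepare_modV _ (by decide)), hF.a .rg (prepare_modA _ (by decide)),
      hF.a .mg (prepare_modA _ (by decide))]
    exact ⟨le_rfl, le_rfl⟩
  have hB : X.Best ∅ σ₁ := by
    refine ⟨∅, ⟨?_, ?_, ?_⟩, by simp, by simp, by simp⟩
    · rw [hF.v _ (prepare_modV _ (by decide))]; simp [weight, St.init]
    · rw [hF.v _ (prepare_modV _ (by decide))]; rfl
    · simp
  refine (tryHashes_spec hp hR hst (fun j _ => by rw [hF.a _ (prepare_modA _ (by decide))]; rfl)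
    (fun j _ => by rw [hF.a _ (prepare_modA _ (by decide))]; rfl) hB).mono ?_
  rintro k₂ σ₂ ⟨hk₂, hB₂⟩
  refine ⟨?_, hB₂.isMax hp hperf⟩
  exact prepare_add_search_le hp.s_pos hq hk₁ hk₂

end While

/-! ### Facts about the machine -/

namespace RAM

theorem Exec.deterministic {inp : ℕ → ℕ} {p : Prog} {s s₁ s₂ : State} {k₁ k₂ : ℕ}
    (h₁ : Exec inp p s k₁ s₁) (h₂ : Exec inp p s k₂ s₂) : k₁ = k₂ ∧ s₁ = s₂ := by
  induction h₁ generalizing k₂ s₂ with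
  | skip | const | copy | add | sub | read | load | store => cases h₂; exact ⟨rfl, rfl⟩
  | seq _ _ ih1 ih2 =>
    cases h₂ with
    | seq g1 g2 =>
      obtain ⟨rfl, rfl⟩ := ih1 g1
      obtain ⟨rfl, rfl⟩ := ih2 g2
      exact ⟨rfl, rfl⟩
  | ite_true ha _ ih =>
    cases h₂ with
    | ite_true _ g => obtain ⟨rfl, rfl⟩ := ih g; exact ⟨rfl, rfl⟩
    | ite_false ha' _ => exact absurd ha' ha
  | ite_false ha _ ih =>
    cases h₂ with
    | ite_true ha' _ => exact absurd ha ha'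
    | ite_false _ g => obtain ⟨rfl, rfl⟩ := ih g; exact ⟨rfl, rfl⟩
  | loop_done ha =>
    cases h₂ with
    | loop_done => exact ⟨rfl, rfl⟩
    | loop_step ha' => exact absurd ha ha'
  | loop_step ha _ _ ih1 ih2 =>
    cases h₂ with
    | loop_done ha' => exact absurd ha' ha
    | loop_step _ g1 g2 =>
      obtain ⟨rfl, rfl⟩ := ih1 g1
      obtain ⟨rfl, rfl⟩ := ih2 g2
      exact ⟨rfl, rfl⟩

/-- A run of `k` steps reads at most `k` input cells, and changing any other cell leaves the run as
it is. This serves the adversary argument in `le_time_of_computes`. -/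
theorem Exec.exists_cells {inp : ℕ → ℕ} {p : Prog} {s s' : State} {k : ℕ}
    (h : Exec inp p s k s') :
    ∃ R : Finset ℕ, R.card ≤ k ∧ ∀ inp' : ℕ → ℕ, (∀ i ∈ R, inp' i = inp i) →
      Exec inp' p s k s' := by
  classical
  induction h with
  | skip s => exact ⟨∅, by simp, fun _ _ => .skip s⟩
  | const r c s => exact ⟨∅, by simp, fun _ _ => .const r c s⟩
  | copy r a s => exact ⟨∅, by simp, fun _ _ => .copy r a s⟩
  | add r a b s => exact ⟨∅, by simp, fun _ _ => .add r a b s⟩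
  | sub r a b s => exact ⟨∅, by simp, fun _ _ => .sub r a b s⟩
  | read r a s =>
    refine ⟨{s.reg a}, by simp, fun inp' h => ?_⟩
    rw [← h (s.reg a) (by simp)]
    exact .read r a s
  | load r a s => exact ⟨∅, by simp, fun _ _ => .load r a s⟩
  | store a b s => exact ⟨∅, by simp, fun _ _ => .store a b s⟩
  | seq _ _ ih1 ih2 =>
    obtain ⟨R₁, h1, h2⟩ := ih1
    obtain ⟨R₂, g1, g2⟩ := ih2
    refine ⟨R₁ ∪ R₂, (Finset.card_union_le _ _).trans (by omega), fun inp' h => ?_⟩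
    exact .seq (h2 _ fun i hi => h i (Finset.mem_union_left _ hi))
      (g2 _ fun i hi => h i (Finset.mem_union_right _ hi))
  | ite_true ha _ ih =>
    obtain ⟨R₁, h1, h2⟩ := ih
    exact ⟨R₁, by omega, fun inp' h => .ite_true ha (h2 _ h)⟩
  | ite_false ha _ ih =>
    obtain ⟨R₁, h1, h2⟩ := ih
    exact ⟨R₁, by omega, fun inp' h => .ite_false ha (h2 _ h)⟩
  | loop_done ha => exact ⟨∅, by simp, fun _ _ => .loop_done ha⟩
  | loop_step ha _ _ ih1 ih2 =>
    obtain ⟨R₁, h1, h2⟩ := ih1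
    obtain ⟨R₂, g1, g2⟩ := ih2
    refine ⟨R₁ ∪ R₂, (Finset.card_union_le _ _).trans (by omega), fun inp' h => ?_⟩
    exact .loop_step ha (h2 _ fun i hi => h i (Finset.mem_union_left _ hi))
      (g2 _ fun i hi => h i (Finset.mem_union_right _ hi))

theorem Exec.pos {inp : ℕ → ℕ} {p : Prog} {s s' : State} {k : ℕ} (h : Exec inp p s k s') :
    1 ≤ k := by
  induction h <;> omega

theorem HoldsSet.eq {n : ℕ} {mem : ℕ → ℕ} {S S' : Finset (Fin n)} (h : HoldsSet mem S)
    (h' : HoldsSet mem S') : S = S' := by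
  ext v
  rw [h.2, h'.2, ← h.1, ← h'.1]

theorem inputOf_append (a b : List ℕ) (i : ℕ) :
    inputOf (a ++ b) i = if i < a.length then inputOf a i else inputOf b (i - a.length) := by
  simp only [inputOf, List.getD_eq_getElem?_getD]
  split_ifs with h
  · rw [List.getElem?_append_left h]
  · rw [List.getElem?_append_right (by omega)]

theorem inputOf_ofFn {n : ℕ} (f : Fin n → ℕ) (v : Fin n) : inputOf (List.ofFn f) v = f v := by
  simp [inputOf, List.getD_eq_getElem?_getD]

/-! ### Writing the output in the required layout -/

/-- Copy the list whose length is in the register `c` and whose entries are in the cells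
`1, 33, 65, …` to the cells `1, 2, 3, …`, and its length to the cell `0`. -/
def output (c : ℕ) : Prog :=
  .seq (.copy 5 c) <| .seq (.const 3 1) <| .seq (.const 7 1) <| .seq (.const 11 1) <|
  .seq (.const 13 32) <| .seq (.loop 5 (.seq (.load 9 3) <| .seq (.store 7 9) <|
    .seq (.add 3 3 13) <| .seq (.add 7 7 11) (.sub 5 5 11))) <|
  .seq (.const 15 0) (.store 15 c)

/-- Copying within one memory is safe: round `i` writes cell `i + 1`, and all later sources `32 * j
+ 1` with `j > i` lie beyond it. The loop changes only odd registers, so the even register with the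
length survives. -/
theorem output_loop (inp : ℕ → ℕ) (f : ℕ → ℕ) (d : ℕ) : ∀ (i : ℕ) (s : State), s.reg 5 = d →
    s.reg 3 = 32 * i + 1 → s.reg 7 = i + 1 → s.reg 11 = 1 → s.reg 13 = 32 →
    (∀ j, i ≤ j → s.mem (32 * j + 1) = f j) →
    ∃ s', Exec inp (.loop 5 (.seq (.load 9 3) <| .seq (.store 7 9) <|
      .seq (.add 3 3 13) <| .seq (.add 7 7 11) (.sub 5 5 11))) s (6 * d + 1) s' ∧
      (∀ j < d, s'.mem (i + j + 1) = f (i + j)) ∧ (∀ a ≤ i, s'.mem a = s.mem a) ∧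
      ∀ r, r % 2 = 0 → s'.reg r = s.reg r := by
  induction d with
  | zero =>
    intro i s h5 _ _ _ _ _
    exact ⟨s, .loop_done h5, by simp, fun _ _ => rfl, fun _ _ => rfl⟩
  | succ d ih =>
    intro i s h5 h3 h7 h11 h13 hf
    obtain ⟨s', h1, h2, h4, h6⟩ := ih (i + 1) (((((s.setReg 9 (f i)).setMem (i + 1) (f i)).setReg 3
      (32 * (i + 1) + 1)).setReg 7 (i + 1 + 1)).setReg 5 d)
      (by simp [State.setReg]) (by simp [State.setReg, State.setMem])
      (by simp [State.setReg, State.setMem]) (by simp [State.setReg, State.setMem, h11])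
      (by simp [State.setReg, State.setMem, h13])
      (fun j hj => by
        simp only [State.setReg, State.setMem]
        rw [Function.update_of_ne (by omega), hf j (by omega)])
    refine ⟨s', ?_, ?_, ?_, ?_⟩
    · rw [show 6 * (d + 1) + 1 = 1 + (1 + (1 + (1 + 1))) + (6 * d + 1) + 1 by omega]
      refine .loop_step (by omega) (.seq (.load ..) (.seq (.store ..) (.seq (.add ..)
        (.seq (.add ..) (.sub ..))))) ?_
      convert h1 using 1
      simp [State.setReg, State.setMem, h3, h7, h5, h11, h13, hf i le_rfl]
      ring_nf
    · intro j hj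
      rcases Nat.eq_zero_or_pos j with rfl | hj0
      · rw [Nat.add_zero, h4 _ le_rfl]
        simp [State.setReg, State.setMem]
      · have := h2 (j - 1) (by omega)
        rwa [show i + 1 + (j - 1) = i + j by omega] at this
    · intro a ha
      rw [h4 a (by omega)]
      simp only [State.setReg, State.setMem]
      rw [Function.update_of_ne (by omega)]
    · intro r hr
      rw [h6 r hr]
      simp only [State.setReg, State.setMem]
      rw [Function.update_of_ne (by omega), Function.update_of_ne (by omega),
        Function.update_of_ne (by omega), Function.update_of_ne (by omega)]

theorem output_exec (inp : ℕ → ℕ) {c : ℕ} (hc : c % 2 = 0) (s : State) :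
    ∃ s', Exec inp (output c) s (6 * s.reg c + 8) s' ∧ s'.mem 0 = s.reg c ∧
      ∀ j < s.reg c, s'.mem (j + 1) = s.mem (32 * j + 1) := by
  obtain ⟨s', h1, h2, -, h4⟩ := output_loop inp (fun j => s.mem (32 * j + 1)) (s.reg c) 0
    (((((s.setReg 5 (s.reg c)).setReg 3 1).setReg 7 1).setReg 11 1).setReg 13 32)
    (by simp [State.setReg]) (by simp [State.setReg]) (by simp [State.setReg])
    (by simp [State.setReg]) (by simp [State.setReg]) (fun j _ => rfl)
  have hc' : s'.reg c = s.reg c := by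
    rw [h4 c hc]
    simp only [State.setReg]
    rw [Function.update_of_ne (by omega), Function.update_of_ne (by omega),
        Function.update_of_ne (by omega), Function.update_of_ne (by omega),
        Function.update_of_ne (by omega)]
  refine ⟨(s'.setReg 15 0).setMem 0 (s.reg c), ?_, ?_, ?_⟩
  · rw [show 6 * s.reg c + 8 = 1 + (1 + (1 + (1 + (1 + (6 * s.reg c + 1 + (1 + 1)))))) by omega]
    refine .seq (.copy ..) (.seq (.const ..) (.seq (.const ..) (.seq (.const ..)
      (.seq (.const ..) (.seq h1 (.seq (.const ..) ?_))))))
    have := Exec.store (inp := inp) 15 c (s'.setReg 15 0)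
    have h15 : c ≠ 15 := by omega
    simpa [State.setReg, h15, hc'] using this
  · simp [State.setMem]
  · intro j hj
    have := h2 j hj
    simp only [Nat.zero_add] at this
    simpa [State.setMem, State.setReg] using this

end RAM

open RAM (Prog State Exec HoldsSet inputOf inputOf_append inputOf_ofFn)

/-! ### The encoding of the inputs -/

section

variable {n : ℕ} {G : SimpleGraph (Fin n)} (L : AdjLists G)

namespace AdjLists

/-- The total length of the lists before the `i`-th. -/
def offset (i : ℕ) : ℕ := ((List.ofFn L.nbrs).take i).flatten.length

theorem toWords_eq : L.toWords = (List.range (n + 1)).map L.offset ++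
    (List.ofFn L.nbrs).flatten.map Fin.val := by
  rw [toWords]
  congr 1
  simp only [bind_pure_comp, List.map_eq_map, List.map_id']

theorem inputOf_toWords_le {i : ℕ} (hi : i ≤ n) : inputOf L.toWords i = L.offset i := by
  rw [toWords_eq, inputOf_append, if_pos (by simp; omega), inputOf, List.getD_eq_getElem?_getD,
    List.getElem?_map, List.getElem?_range (by omega)]
  rfl

theorem length_toWords : L.toWords.length = n + 1 + L.offset n := by
  rw [toWords_eq, offset, List.take_of_length_le (by simp), List.length_append, List.length_map,
    List.length_map, List.length_range]

theorem offset_le (i : ℕ) : L.offset i ≤ L.offset n := by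
  rw [offset, offset, List.take_of_length_le (i := n) (by simp)]
  exact (List.take_sublist i _).flatten.length_le

theorem offset_succ (v : Fin n) : L.offset (v + 1) = L.offset v + (L.nbrs v).length := by
  rw [offset, offset, List.take_add_one, List.getElem?_ofFn]
  simp

theorem inputOf_toWords_nbrs (v : Fin n) (j : ℕ) (hj : j < (L.nbrs v).length) :
    inputOf L.toWords (n + 1 + L.offset v + j) = (L.nbrs v)[j] := by
  have hsplit : List.ofFn L.nbrs =
      (List.ofFn L.nbrs).take v ++ L.nbrs v :: (List.ofFn L.nbrs).drop (v + 1) := by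
    conv_lhs => rw [← List.take_append_drop v (List.ofFn L.nbrs)]
    rw [List.drop_eq_getElem_cons (by simp)]
    simp
  rw [toWords_eq, inputOf_append, if_neg (by simp; omega), hsplit, inputOf]
  simp only [List.length_map, List.length_range, List.flatten_append, List.flatten_cons,
    List.map_append, List.getD_eq_getElem?_getD]
  rw [List.getElem?_append_right (by rw [List.length_map, ← offset]; omega),
    List.getElem?_append_left (by rw [List.length_map, List.length_map, ← offset]; omega),
    List.length_map, ← offset, show n + 1 + L.offset v + j - (n + 1) - L.offset v = j by omega]
  simp [hj]

end AdjLists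

section

variable {G₁ G₂ : SimpleGraph (Fin n)} (L₁ : AdjLists G₁) (L₂ : AdjLists G₂) (w : Fin n → ℕ)
  (l : ℕ)

theorem inputOf_encodeDecomposed_weight (v : Fin n) :
    inputOf (encodeDecomposed L₁ L₂ w l) (v + 2) = w v := by
  have := v.2
  rw [encodeDecomposed, inputOf_append, if_pos (by simp; omega), inputOf_append,
    if_pos (by simp), inputOf_append, if_neg (by simp)]
  exact inputOf_ofFn w v

theorem inputOf_encodeDecomposed_left {i : ℕ} (hi : i < L₁.toWords.length) :
    inputOf (encodeDecomposed L₁ L₂ w l) (n + 2 + i) = inputOf L₁.toWords i := by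
  rw [encodeDecomposed, inputOf_append, if_pos (by simp; omega), inputOf_append,
    if_neg (by simp; omega)]
  congr 1
  simp

theorem inputOf_encodeDecomposed_right (i : ℕ) :
    inputOf (encodeDecomposed L₁ L₂ w l) (n + 2 + L₁.toWords.length + i) =
      inputOf L₂.toWords i := by
  rw [encodeDecomposed, inputOf_append, if_neg (by simp; omega)]
  congr 1
  simp
  omega

theorem inputOf_encodeColored_lt {c : ℕ} (col : Fin n → Fin c) {i : ℕ} (hi : i < n + 2) :
    inputOf (encodeColored L w col) i = inputOf ([n, c] ++ List.ofFn w) i := by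
  rw [encodeColored, inputOf_append, if_pos (by simp; omega), inputOf_append,
    if_pos (by simp; omega)]

theorem inputOf_encodeDecomposed_lt {i : ℕ} (hi : i < n + 2) :
    inputOf (encodeDecomposed L₁ L₂ w l) i = inputOf ([n, l] ++ List.ofFn w) i := by
  rw [encodeDecomposed, inputOf_append, if_pos (by simp; omega), inputOf_append,
    if_pos (by simp; omega)]

theorem inputOf_encodeColored_color {c : ℕ} (col : Fin n → Fin c) (v : Fin n) :
    inputOf (encodeColored L w col) (n + 2 + v) = col v := by
  have := v.2
  rw [encodeColored, inputOf_append, if_pos (by simp; omega), inputOf_append,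
    if_neg (by simp; omega)]
  rw [show n + 2 + (v : ℕ) - ([n, c] ++ List.ofFn w).length = v by simp]
  exact inputOf_ofFn (fun v => (col v : ℕ)) v

theorem inputOf_encodeColored_graph {c : ℕ} (col : Fin n → Fin c) (i : ℕ) :
    inputOf (encodeColored L w col) (n + n + 2 + i) = inputOf L.toWords i := by
  rw [encodeColored, inputOf_append, if_neg (by simp; omega)]
  congr 1
  simp

theorem eq_inputOf_encodeColored {c : ℕ} (col : Fin n → Fin c) {inp : ℕ → ℕ}
    (h1 : ∀ i < n + 2, inp i = inputOf ([n, c] ++ List.ofFn w) i)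
    (h2 : ∀ v : Fin n, inp (n + 2 + v) = col v)
    (h3 : ∀ i, inp (n + n + 2 + i) = inputOf L.toWords i) :
    inp = inputOf (encodeColored L w col) := by
  funext i
  rcases lt_or_ge i (n + 2) with hi | hi
  · rw [h1 i hi, inputOf_encodeColored_lt L w col hi]
  · rcases lt_or_ge i (n + n + 2) with hi' | hi'
    · have a := h2 ⟨i - (n + 2), by omega⟩
      have b := inputOf_encodeColored_color L w col ⟨i - (n + 2), by omega⟩
      simp only [Nat.add_sub_cancel' hi] at a b
      rw [a, b]
    · have a := h3 (i - (n + n + 2))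
      have b := inputOf_encodeColored_graph L w col (i - (n + n + 2))
      simp only [Nat.add_sub_cancel' hi'] at a b
      rw [a, b]

end

/-! ### The lower bound for the running time of the given algorithm -/

/-- Adversary argument. With a single color and unit weights the output has at most one vertex. If
`t + 1 < n`, some vertex is not in the output and its weight has not been read; raising that weight
to 2 does not change the run but makes its output wrong. -/
theorem le_time_of_computes {P : Prog} {c t : ℕ} (hc : 0 < c)
    (hP : ∀ (w : Fin n → ℕ) (col : Fin n → Fin c),
      RAM.ComputesWithin P (encodeColored L w col) (t : ℝ) (IsMaxWeightColorfulIndepSet G w col)) :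
    1 ≤ t ∧ n ≤ t + 1 := by
  classical
  set col : Fin n → Fin c := fun _ => ⟨0, hc⟩ with hcol
  obtain ⟨k, s, S, hexec, hk, hS, hmax⟩ := hP (fun _ => 1) col
  have hk' : k ≤ t := by exact_mod_cast hk
  refine ⟨hexec.pos.trans hk', ?_⟩
  by_contra hlt
  push Not at hlt
  obtain ⟨R, hR, hR'⟩ := hexec.exists_cells
  have hcard : S.card ≤ 1 := by
    refine Finset.card_le_one.2 fun u hu v hv => hmax.1.2 hu hv rfl
  -- At most one vertex is in the output and at most `t` weights are read, so fewer than `n`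
  -- vertices are excluded.
  obtain ⟨u, hu⟩ : ∃ u : Fin n, u ∉ S ∪ Finset.univ.filter fun v : Fin n => (v : ℕ) + 2 ∈ R := by
    by_contra hall
    push Not at hall
    have h1 : (Finset.univ : Finset (Fin n)) ⊆
        S ∪ Finset.univ.filter fun v : Fin n => (v : ℕ) + 2 ∈ R := fun u _ => hall u
    have h2 := (Finset.card_le_card h1).trans (Finset.card_union_le _ _)
    have h3 : (Finset.univ.filter fun v : Fin n => (v : ℕ) + 2 ∈ R).card ≤ R.card :=
      Finset.card_le_card_of_injOn (fun v => (v : ℕ) + 2) (by intro v hv; simpa using hv)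
        (fun v _ v' _ h => Fin.ext (by simpa using h))
    rw [Finset.card_univ, Fintype.card_fin] at h2
    omega
  simp only [Finset.mem_union, Finset.mem_filter, Finset.mem_univ, true_and, not_or] at hu
  set w' : Fin n → ℕ := Function.update (fun _ => 1) u 2 with hw'
  obtain ⟨k', s', S', hexec', -, hS', hmax'⟩ := hP w' col
  have hagree : ∀ i ∈ R, inputOf (encodeColored L w' col) i =
      inputOf (encodeColored L (fun _ => 1) col) i := by
    intro i hi
    have key : ∀ w : Fin n → ℕ, ∀ v : Fin n, inputOf ([n, c] ++ List.ofFn w) (v + 2) = w v := by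
      intro w v
      rw [inputOf_append, if_neg (by simp)]
      exact inputOf_ofFn w v
    rcases lt_or_ge i (n + 2) with hi' | hi'
    · rw [inputOf_encodeColored_lt _ _ _ hi', inputOf_encodeColored_lt _ _ _ hi']
      rcases lt_or_ge i 2 with hi2 | hi2
      · rw [inputOf_append, inputOf_append, if_pos (by simpa using hi2),
          if_pos (by simpa using hi2)]
      · have a := key w' ⟨i - 2, by omega⟩
        have b := key (fun _ => 1) ⟨i - 2, by omega⟩
        simp only [Nat.sub_add_cancel hi2] at a b
        rw [a, b, hw', Function.update_of_ne]
        rintro rfl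
        exact hu.2 (by simpa [Nat.sub_add_cancel hi2] using hi)
    · rcases lt_or_ge i (n + n + 2) with hi2 | hi2
      · have a := inputOf_encodeColored_color L w' col ⟨i - (n + 2), by omega⟩
        have b := inputOf_encodeColored_color L (fun _ => 1) col ⟨i - (n + 2), by omega⟩
        simp only [Nat.add_sub_cancel' hi'] at a b
        rw [a, b]
      · have a := inputOf_encodeColored_graph L w' col (i - (n + n + 2))
        have b := inputOf_encodeColored_graph L (fun _ => 1) col (i - (n + n + 2))
        simp only [Nat.add_sub_cancel' hi2] at a b
        rw [a, b]
  obtain ⟨rfl, rfl⟩ := (hR' _ hagree).deterministic hexec'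
  obtain rfl := hS.eq hS'
  have h1 := hmax'.2 {u} ⟨by simp, by simp⟩
  have h2 : weight w' S ≤ 1 := by
    rw [weight, Finset.sum_congr rfl fun v hv => show w' v = 1 by
      rw [hw', Function.update_of_ne]; rintro rfl; exact hu.1 hv]
    simpa using hcard
  have h3 : weight w' {u} = 2 := by simp [weight, hw']
  omega

end

/-! ### The task of a decomposition -/

namespace While

/-- The task that belongs to a decomposed graph. -/
noncomputable def Task.ofDecomposition {p : Params} {G₁ G₂ : SimpleGraph (Fin p.n)}
    (h₁ : G₁ ∈ clusterGraphs p.n) (L₁ : AdjLists G₁) (L₂ : AdjLists G₂) (w : Fin p.n → ℕ)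
    (P : Prog) (t : ℕ)
    (hP : ∀ col : Fin p.n → Fin p.l, RAM.ComputesWithin P (encodeColored L₂ w col) (t : ℝ)
      (IsMaxWeightColorfulIndepSet G₂ w col)) :
    Task (inputOf (encodeDecomposed L₁ L₂ w p.l)) p where
  G := G₁ ⊔ G₂
  w := w
  off := p.n + 2 + L₁.toWords.length
  cid v := (clusterRep G₁ v : ℕ) + 1
  P := P
  T := t
  weight_eq := inputOf_encodeDecomposed_weight L₁ L₂ w p.l
  cid_le v := (clusterRep G₁ v).2
  cid_ne S hS u hu v hv huv := by
    by_contra hne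
    refine hS hu hv hne (.inl ?_)
    exact ((clusterRep_eq_iff h₁).1 (Fin.ext (by simpa using huv))).resolve_left hne
  solve f hf inp' h1 h2 h3 := by
    set col : Fin p.n → Fin p.l := fun v => ⟨f ((clusterRep G₁ v : ℕ) + 1), hf _⟩ with hcol
    -- The two encodings agree in their first `n + 2` cells because the number of colors equals the
    -- size bound; behind them come the colors and the redirected lists of the second graph.
    have hinp : inp' = inputOf (encodeColored L₂ w col) := by
      refine eq_inputOf_encodeColored L₂ w col
        (fun i hi => (h1 i hi).trans (inputOf_encodeDecomposed_lt L₁ L₂ w p.l hi)) h2 fun i => ?_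
      rw [h3, add_comm i, inputOf_encodeDecomposed_right]
    obtain ⟨k, s, S, hexec, hk, hS, hmax⟩ := hP col
    have hinj : Set.InjOn col (S : Set (Fin p.n)) := hmax.1.2
    refine ⟨k, s, S, hinp ▸ hexec, by exact_mod_cast hk, hS, ?_, ?_, fun S' hS' hinj' => ?_⟩
    -- An edge of the first graph joins two vertices of the same cluster, which have the same color
    -- and hence cannot both be in a colorful set.
    · intro u hu v hv hne hadj
      rcases hadj with hadj | hadj
      · refine hne (hinj hu hv ?_)
        have : clusterRep G₁ u = clusterRep G₁ v := (clusterRep_eq_iff h₁).2 (.inr hadj)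
        simp [hcol, this]
      · exact hmax.1.1 hu hv hne hadj
    · have := Finset.card_le_card_of_injOn (t := Finset.univ) col (by simp) hinj
      simpa using this
    · refine hmax.2 S' ⟨fun u hu v hv hne hadj => hS' hu hv hne (.inr hadj), ?_⟩
      intro u hu v hv huv
      exact hinj' hu hv (by simpa [hcol] using huv)

/-- The machine program of the algorithm. -/
def program (P : Prog) : Prog := .seq (solver P).compile (RAM.output (vreg .bestC))

theorem program_spec {p : Params} {G₁ G₂ : SimpleGraph (Fin p.n)} (hp : p.Good)
    (hs : p.s = Params.numBlocks p.n p.l p.q)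
    (hmin : ∀ q, GoodField p.n (2 * (p.l * p.l)) q → p.q ≤ q)
    (h₁ : G₁ ∈ clusterGraphs p.n) (L₁ : AdjLists G₁) (L₂ : AdjLists G₂) (w : Fin p.n → ℕ)
    (P : Prog) (t : ℕ)
    (hP : ∀ col : Fin p.n → Fin p.l, RAM.ComputesWithin P (encodeColored L₂ w col) (t : ℝ)
      (IsMaxWeightColorfulIndepSet G₂ w col)) :
    ∃ M, M ≤ p.Q ∧
      (M = 0 ∨ p.Q ^ (M - 1) ≤ p.Q * (p.Q - numSeparating p.q p.b) ^ (M - 1)) ∧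
      ∃ k s S, Exec (inputOf (encodeDecomposed L₁ L₂ w p.l)) (program P) State.init k s ∧
        k ≤ 5000 * (p.Q + 1) ^ 3 * (p.q + 1) ^ 4 + 3000 * p.q * p.q ^ p.J * (M ^ p.s + 1) *
          ((p.q + 1) * (p.q + p.J + p.s + 1) + (p.n + 1) + t) ∧
        HoldsSet s.mem S ∧ IsMaxWeightIndepSetOfSizeLE (G₁ ⊔ G₂) w p.l S := by
  set inp := inputOf (encodeDecomposed L₁ L₂ w p.l) with hinp
  have hoff : ∀ i ≤ p.n, inp (p.n + 2 + i) = L₁.offset i := by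
    intro i hi
    rw [hinp, inputOf_encodeDecomposed_left L₁ L₂ w p.l (by rw [L₁.length_toWords]; omega),
      L₁.inputOf_toWords_le hi]
  have hmono : ∀ v : Fin p.n, L₁.offset v + (L₁.nbrs v).length ≤ L₁.offset p.n := by
    intro v
    rw [← L₁.offset_succ]
    exact L₁.offset_le _
  obtain ⟨M, hM, hdecay, k, σ, hexec, hk, S, hS, hmax⟩ := solver_spec (inp := inp) L₁ h₁
    (by rw [hinp, inputOf_encodeDecomposed_lt L₁ L₂ w p.l (by omega)]; rfl)
    (by rw [hinp, inputOf_encodeDecomposed_lt L₁ L₂ w p.l (by omega)]; rfl) hp hs hmin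
    (fun v => by
      have := v.2
      rw [add_assoc, hoff _ this, hoff _ this.le, L₁.offset_succ, Nat.add_sub_cancel_left])
    (fun v j hj => by
      have := hmono v
      rw [hoff _ v.2.le, show L₁.offset v + p.n + p.n + 3 + j =
        p.n + 2 + (p.n + 1 + L₁.offset v + j) by ring, hinp,
        inputOf_encodeDecomposed_left L₁ L₂ w p.l (by rw [L₁.length_toWords]; omega),
        L₁.inputOf_toWords_nbrs v j hj])
    (Task.ofDecomposition h₁ L₁ L₂ w P t hP)
    (by
      -- The last entry of the first offset table is the total length of its lists, which locates
      -- the encoding of the second graph.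
      change p.n + 2 + L₁.toWords.length = _
      rw [show p.n + p.n + 2 = p.n + 2 + p.n by ring, hoff _ le_rfl, L₁.length_toWords]
      ring)
    (fun v => rfl)
  refine ⟨M, hM, hdecay, ?_⟩
  obtain ⟨m, s, h1, h2, h3⟩ := Cmd.compile_spec hexec State.init ⟨fun _ => rfl, fun _ _ => rfl⟩
  obtain ⟨s', g1, g2, g3⟩ := RAM.output_exec inp (c := vreg .bestC) (by rw [vreg]; omega) s
  have hcard : s.reg (vreg .bestC) = S.card := (h3.1 _).trans hS.card
  rw [hcard] at g1 g2 g3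
  refine ⟨_, s', S, .seq h1 g1, ?_, ⟨g2, fun v => ?_⟩, hmax⟩
  · have hSn : S.card ≤ p.n := (Finset.card_le_univ S).trans (by simp)
    change k ≤ 4800 * (p.Q + 1) ^ 3 * (p.q + 1) ^ 4 + 2000 * p.q * p.q ^ p.J * (M ^ p.s + 1) *
      ((p.q + 1) * (p.q + p.J + p.s + 1) + (p.n + 1) + t) at hk
    have e : ∀ c, c * p.q * p.q ^ p.J * (M ^ p.s + 1) *
        ((p.q + 1) * (p.q + p.J + p.s + 1) + (p.n + 1) + t) = c * ((p.q * p.q ^ p.J * (M ^ p.s + 1)) *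
          ((p.q + 1) * (p.q + p.J + p.s + 1) + (p.n + 1) + t)) := fun c => by ring
    have hn : p.n ≤ (p.q * p.q ^ p.J * (M ^ p.s + 1)) *
        ((p.q + 1) * (p.q + p.J + p.s + 1) + (p.n + 1) + t) := by
      refine le_trans (by omega) (Nat.le_mul_of_pos_left _ ?_)
      have := hp.field.1.pos
      positivity
    have h8 : 1 ≤ (p.Q + 1) ^ 3 * (p.q + 1) ^ 4 := Nat.mul_pos (by positivity) (by positivity)
    rw [e, mul_assoc] at hk
    rw [e, mul_assoc]
    omega
  · rw [hS.mem]
    refine exists_congr fun i => and_congr_right fun hi => ?_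
    -- The array `out` has the code 1, so its entries lie in the cells `32 * i + 1` from which the
    -- output program reads.
    rw [g3 i hi, ← h3.2]
    rfl

end While

/-! ### Estimates of the running time -/

namespace While

open Real (exp log)

/-- A random function into `b` values is injective on `b` points with probability `b! / b ^ b ≥ e ^
(-b)`. Rounding `q / b` down costs at most the factor `(1 - b / q) ^ b ≥ 1 - b ^ 2 / q ≥ 1 / 2`, by
Bernoulli's inequality and `2 * b ^ 2 < q`. -/
theorem pow_le_exp_mul_numSeparating {q b : ℕ} (h : 2 * (b * b) < q) :
    (q : ℝ) ^ b ≤ 2 * exp b * numSeparating q b := by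
  rcases Nat.eq_zero_or_pos b with rfl | hb
  · simp [numSeparating]
  have hb' : (0 : ℝ) < b := by exact_mod_cast hb
  have hq : (2 : ℝ) * (b * b) < q := by exact_mod_cast h
  have hq0 : (0 : ℝ) < q := by nlinarith
  have h1 : ((q : ℝ) - b) / b ≤ (q / b : ℕ) := by
    rw [div_le_iff₀ hb']
    have := Nat.lt_div_mul_add (a := q) hb
    have : (q : ℝ) < (q / b : ℕ) * b + b := by exact_mod_cast this
    linarith
  have hbq : (b : ℝ) ≤ q := by nlinarith [show (1 : ℝ) ≤ b by exact_mod_cast hb]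
  have h2 : (b : ℝ) ^ b / b.factorial ≤ exp b := Real.pow_div_factorial_le_exp _ hb'.le _
  have h3 : (1 : ℝ) / 2 ≤ (1 - b / q) ^ b := by
    have := one_add_mul_le_pow (a := -((b : ℝ) / q)) (by
      have : (b : ℝ) / q ≤ 1 := (div_le_one hq0).2 hbq
      linarith) b
    have h4 : (b : ℝ) * (b / q) ≤ 1 / 2 := by
      rw [mul_div_assoc', div_le_iff₀ hq0]; linarith
    rw [← sub_eq_add_neg] at this
    linarith
  have h5 : (q : ℝ) ^ b * (1 - b / q) ^ b = (b : ℝ) ^ b * ((q - b) / b) ^ b := by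
    rw [← mul_pow, ← mul_pow]
    congr 1
    field_simp
  have h6 : (0 : ℝ) ≤ (q - b) / b := div_nonneg (by linarith) hb'.le
  have hfac : (0 : ℝ) < b.factorial := by exact_mod_cast Nat.factorial_pos b
  rw [div_le_iff₀ hfac] at h2
  calc (q : ℝ) ^ b ≤ 2 * ((q : ℝ) ^ b * (1 - b / q) ^ b) := by
        nlinarith [pow_pos hq0 b]
    _ = 2 * ((b : ℝ) ^ b * ((q - b) / b) ^ b) := by rw [h5]
    _ ≤ 2 * ((exp b * b.factorial) * ((q / b : ℕ) : ℝ) ^ b) := by gcongr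
    _ = _ := by rw [numSeparating]; push_cast; ring

/-- The number of rows that the greedy algorithm chooses. -/
theorem rows_le {q b M : ℕ} (hb : 2 * (b * b) < q)
    (h : M = 0 ∨ (q ^ b) ^ (M - 1) ≤ q ^ b * (q ^ b - numSeparating q b) ^ (M - 1)) :
    (M : ℝ) ≤ 2 * exp b * (b * log q) + 1 := by
  have hq0 : (0 : ℝ) < q := by exact_mod_cast (by omega : 0 < q)
  have hq1 : (1 : ℝ) ≤ q := by exact_mod_cast (by omega : 1 ≤ q)
  have hlog : 0 ≤ log q := Real.log_nonneg hq1
  have hnn : 0 ≤ 2 * exp b * (b * log q) := by positivity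
  rcases h with rfl | h
  · simp; linarith
  have hM : (M : ℝ) ≤ (M - 1 : ℕ) + 1 := by exact_mod_cast (by omega : M ≤ M - 1 + 1)
  refine hM.trans (add_le_add_left ?_ 1)
  set m := M - 1
  have hQ : (0 : ℝ) < (q : ℝ) ^ b := by positivity
  have hbq : b ≤ q := by nlinarith
  have hB : numSeparating q b ≤ q ^ b := by
    calc numSeparating q b ≤ b ^ b * (q / b) ^ b := Nat.mul_le_mul_right _ b.factorial_le_pow
      _ = (b * (q / b)) ^ b := (mul_pow ..).symm
      _ ≤ q ^ b := Nat.pow_le_pow_left (Nat.mul_div_le q b) _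
  set B := numSeparating q b with hBdef
  have h' : ((q : ℝ) ^ b) ^ m ≤ (q : ℝ) ^ b * ((q : ℝ) ^ b - B) ^ m := by
    have : (((q ^ b) ^ m : ℕ) : ℝ) ≤ ((q ^ b * (q ^ b - B) ^ m : ℕ) : ℝ) := by exact_mod_cast h
    push_cast [Nat.cast_sub hB] at this
    exact this
  have hB' : (B : ℝ) / (q : ℝ) ^ b ≤ 1 := (div_le_one hQ).2 (by exact_mod_cast hB)
  -- Divide the greedy bound by `Q ^ m`, where `Q = q ^ b`, and use `1 - x ≤ exp (-x)`; taking
  -- logarithms then bounds `m` by `Q / B` times `b * log q`.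
  have h1 : 1 ≤ (q : ℝ) ^ b * exp (-(m * (B / (q : ℝ) ^ b))) := by
    have h2 : (1 - B / (q : ℝ) ^ b) ^ m ≤ exp (-(m * (B / (q : ℝ) ^ b))) := by
      rw [← mul_neg, Real.exp_nat_mul]
      exact pow_le_pow_left₀ (by linarith) (Real.one_sub_le_exp_neg _) _
    have h3 : ((q : ℝ) ^ b - B) ^ m = ((q : ℝ) ^ b) ^ m * (1 - B / (q : ℝ) ^ b) ^ m := by
      rw [← mul_pow]; congr 1; field_simp
    rw [h3] at h'
    have hpos : (0 : ℝ) < ((q : ℝ) ^ b) ^ m := by positivity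
    have : 1 ≤ (q : ℝ) ^ b * (1 - B / (q : ℝ) ^ b) ^ m := by
      by_contra hc
      push Not at hc
      nlinarith
    exact this.trans (mul_le_mul_of_nonneg_left h2 hQ.le)
  have h2 : (m : ℝ) * (B / (q : ℝ) ^ b) ≤ b * log q := by
    have := Real.log_le_log one_pos h1
    rw [Real.log_one, Real.log_mul hQ.ne' (Real.exp_pos _).ne', Real.log_exp, Real.log_pow] at this
    linarith
  have h3 := pow_le_exp_mul_numSeparating hb
  rw [← hBdef] at h3
  have hBpos : (0 : ℝ) < B := by exact_mod_cast numSeparating_pos hbq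
  calc (m : ℝ) = (m * (B / (q : ℝ) ^ b)) * ((q : ℝ) ^ b / B) := by field_simp
    _ ≤ (b * log q) * (2 * exp b) := by
        gcongr
        rwa [div_le_iff₀ hBpos]
    _ = _ := by ring

/-- A field of moderate size is good. -/
theorem exists_goodField (n : ℕ) {l : ℕ} (hl : 0 < l) :
    ∃ q, GoodField n (2 * (l * l)) q ∧
      (q : ℝ) * log q ≤ 48 * (l : ℝ) ^ 4 * log ((n : ℝ) + 2) := by
  set m := 2 * (l * l) with hm
  have hm2 : 2 ≤ m := by nlinarith
  have hex : ∃ D, n + 2 ≤ (m * D) ^ D := by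
    refine ⟨n + 2, ?_⟩
    calc n + 2 ≤ m * (n + 2) := Nat.le_mul_of_pos_left _ (by omega)
      _ ≤ _ := Nat.le_self_pow (by omega) _
  classical
  obtain ⟨D, hD, hmin⟩ : ∃ D, n + 2 ≤ (m * D) ^ D ∧ ∀ D' < D, (m * D') ^ D' < n + 2 :=
    ⟨Nat.find hex, Nat.find_spec hex, fun D' h => not_le.1 (Nat.find_min hex h)⟩
  have hD1 : 1 ≤ D := by
    rcases Nat.eq_zero_or_pos D with rfl | h
    · simp at hD
    · exact h
  -- Bertrand's postulate gives a prime with `m * D < q ≤ 2 * m * D`. Then `(q - 1) / m ≥ D`, and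
  -- already `(m * D) ^ D` exceeds `n + 1`.
  obtain ⟨q, hq, hlt, hle⟩ := Nat.exists_prime_lt_and_le_two_mul (m * D)
    (Nat.mul_ne_zero (by omega) (by omega))
  refine ⟨q, ⟨hq, ?_⟩, ?_⟩
  · have h1 : D ≤ (q - 1) / m := (Nat.le_div_iff_mul_le (by omega)).2 (by rw [mul_comm]; omega)
    calc n + 1 < (m * D) ^ D := hD
      _ ≤ q ^ D := Nat.pow_le_pow_left hlt.le _
      _ ≤ _ := Nat.pow_le_pow_right hq.pos h1
  · have hl1 : (1 : ℝ) ≤ l := by exact_mod_cast hl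
    have hn : (0.6931471803 : ℝ) < log ((n : ℝ) + 2) :=
      Real.log_two_gt_d9.trans_le (Real.log_le_log (by norm_num) (by linarith [(Nat.cast_nonneg n : (0 : ℝ) ≤ n)]))
    have hqpos : (0 : ℝ) < q := by exact_mod_cast hq.pos
    have hmR : (m : ℝ) = 2 * l ^ 2 := by rw [hm]; push_cast; ring
    have hl24 : (l : ℝ) ^ 2 ≤ (l : ℝ) ^ 4 := pow_le_pow_right₀ hl1 (by norm_num)
    have hqle : (q : ℝ) ≤ 2 * (m * D) := by exact_mod_cast hle
    have hq0 : 0 ≤ log q := Real.log_nonneg (by exact_mod_cast hq.one_le)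
    -- The upper bound on `q` comes from the failure of `D - 1`, which says nothing useful for `D =
    -- 1`; in that case `q ≤ 4 * l ^ 2` suffices.
    rcases Nat.lt_or_ge D 2 with hD2 | hD2
    · obtain rfl : D = 1 := by omega
      rw [hmR] at hqle
      push_cast at hqle
      have h1 : (q : ℝ) ≤ 4 * l ^ 2 := by linarith
      have h2 : log q ≤ 4 * l ^ 2 := (Real.log_le_self hqpos.le).trans h1
      calc (q : ℝ) * log q ≤ (4 * l ^ 2) * (4 * l ^ 2) := by gcongr
        _ = 16 * l ^ 4 := by ring
        _ ≤ _ := by nlinarith [pow_pos (by linarith : (0 : ℝ) < l) 4]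
    · have hd := hmin (D - 1) (by omega)
      set d := D - 1 with hd'
      have hDd : (D : ℝ) ≤ 2 * d := by exact_mod_cast (by omega : D ≤ 2 * d)
      have hd1 : (1 : ℝ) ≤ d := by exact_mod_cast (by omega : 1 ≤ d)
      have hmd : (2 : ℝ) ≤ m * d := by
        have : (2 : ℝ) ≤ m := by exact_mod_cast hm2
        nlinarith
      have h1 : d * log (m * d) ≤ log ((n : ℝ) + 2) := by
        rw [← Real.log_pow]
        refine Real.log_le_log (by positivity) ?_
        exact_mod_cast hd.le
      have h2 : (q : ℝ) ≤ 4 * (m * d) := by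
        have : (0 : ℝ) ≤ m := Nat.cast_nonneg _
        nlinarith
      -- Since `m * d ≥ 2`, the bound `4 * (m * d)` for `q` is at most the cube of `m * d`.
      have h3 : log q ≤ 3 * log (m * d) := by
        rw [show (3 : ℝ) * log (m * d) = ((3 : ℕ) : ℝ) * log (m * d) by norm_num, ← Real.log_pow]
        refine Real.log_le_log hqpos (h2.trans ?_)
        nlinarith [mul_le_mul hmd hmd (by norm_num) (by linarith)]
      calc (q : ℝ) * log q ≤ (4 * (m * d)) * (3 * log (m * d)) := by gcongr
        _ = 12 * m * (d * log (m * d)) := by ring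
        _ ≤ 12 * m * log ((n : ℝ) + 2) := by gcongr
        _ = 24 * l ^ 2 * log ((n : ℝ) + 2) := by rw [hmR]; ring
        _ ≤ _ := by
          gcongr
          norm_num

end While

/-! ### The total time: one block for large `n`, many blocks for small `n` -/

namespace While

open Real (exp log)

theorem half_lt_log_add_two (n : ℕ) : (1 : ℝ) / 2 < log ((n : ℝ) + 2) := by
  have h1 := Real.log_two_gt_d9
  have h2 : log 2 ≤ log ((n : ℝ) + 2) :=
    Real.log_le_log (by norm_num) (by linarith [(Nat.cast_nonneg n : (0 : ℝ) ≤ n)])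
  linarith

theorem half_lt_log {q : ℕ} (hq : 2 ≤ q) : (1 : ℝ) / 2 < log q := by
  have h := half_lt_log_add_two (q - 2)
  rwa [Nat.cast_sub hq, show (q : ℝ) - (2 : ℕ) + 2 = q by push_cast; ring] at h

/-- The running time for few large blocks. -/
theorem time_le_of_pow_le {q l n t M : ℕ} (hl : 0 < l) (hq : 2 ≤ q) (h : q ^ (16 * l) ≤ n)
    (ht : 1 ≤ t) (hn : n ≤ t + 1) (hM : (M : ℝ) ≤ 2 * exp l * (l * log q) + 1)
    (hqlog : (q : ℝ) * log q ≤ 48 * (l : ℝ) ^ 4 * log ((n : ℝ) + 2)) :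
    ((5000 * (q ^ l + 1) ^ 3 * (q + 1) ^ 4 +
      3000 * q * (M + 1) * ((q + 1) * (q + 2) + (n + 1) + t) : ℕ) : ℝ) ≤
      10 ^ 8 * (exp l * (l : ℝ) ^ 5 * log ((n : ℝ) + 2) * t) := by
  -- The greedy phase costs at most `q ^ (6 * l + 8)`, and `6 * l + 8 ≤ 16 * l` because `l ≥ 1`; so
  -- it is covered by `n ≤ t + 1`.
  have h1 : (q ^ l + 1) ^ 3 * (q + 1) ^ 4 ≤ 2 * t := by
    have e1 : q ^ l + 1 ≤ q ^ (2 * l) :=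
      calc q ^ l + 1 ≤ q ^ l * 2 := by have := Nat.one_le_pow l q (by omega); omega
        _ ≤ q ^ l * q := Nat.mul_le_mul_left _ hq
        _ = q ^ (l + 1) := (pow_succ ..).symm
        _ ≤ _ := Nat.pow_le_pow_right (by omega) (by omega)
    have e2 : q + 1 ≤ q ^ 2 := by nlinarith
    calc (q ^ l + 1) ^ 3 * (q + 1) ^ 4 ≤ (q ^ (2 * l)) ^ 3 * (q ^ 2) ^ 4 :=
          Nat.mul_le_mul (Nat.pow_le_pow_left e1 _) (Nat.pow_le_pow_left e2 _)
      _ = q ^ (6 * l + 8) := by ring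
      _ ≤ q ^ (16 * l) := Nat.pow_le_pow_right (by omega) (by omega)
      _ ≤ 2 * t := by omega
  have h2 : (q + 1) * (q + 2) + (n + 1) + t ≤ 6 * t := by
    have : (q + 1) * (q + 2) ≤ n := by
      refine le_trans ?_ h
      calc (q + 1) * (q + 2) ≤ q ^ 2 * q ^ 2 := Nat.mul_le_mul (by nlinarith) (by nlinarith)
        _ = q ^ 4 := by ring
        _ ≤ _ := Nat.pow_le_pow_right (by omega) (by omega)
    omega
  have hln := half_lt_log_add_two n
  have hlq := half_lt_log hq
  have hl1 : (1 : ℝ) ≤ l := by exact_mod_cast hl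
  have he : 1 ≤ exp (l : ℝ) := Real.one_le_exp (by linarith)
  have ht1 : (1 : ℝ) ≤ t := by exact_mod_cast ht
  have hq0 : (0 : ℝ) < q := by exact_mod_cast (by omega : 0 < q)
  have hel : 1 ≤ exp (l : ℝ) * l := one_le_mul_of_one_le_of_one_le he hl1
  -- The number of rows contributes `log q` and the choice of the evaluation point contributes `q`.
  -- Their product is what the field bound controls, and here the factor `log n` of the theorem
  -- arises.
  have h3 : (q : ℝ) * (M + 1) ≤ 288 * (exp l * (l : ℝ) ^ 5 * log ((n : ℝ) + 2)) :=
    calc (q : ℝ) * (M + 1) ≤ q * (2 * exp l * (l * log q) + 4 * log q) := by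
          exact mul_le_mul_of_nonneg_left (by linarith) hq0.le
      _ = 2 * (exp l * l) * (q * log q) + 4 * (q * log q) := by ring
      _ ≤ 2 * (exp l * l) * (q * log q) + 4 * (exp l * l) * (q * log q) := by
          have : 0 ≤ (q : ℝ) * log q := by positivity
          nlinarith
      _ = 6 * (exp l * l) * (q * log q) := by ring
      _ ≤ 6 * (exp l * l) * (48 * (l : ℝ) ^ 4 * log ((n : ℝ) + 2)) := by gcongr
      _ = _ := by ring
  have h4 : 1 ≤ 2 * (exp l * (l : ℝ) ^ 5 * log ((n : ℝ) + 2)) := by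
    have : 1 ≤ exp l * (l : ℝ) ^ 5 :=
      one_le_mul_of_one_le_of_one_le he (one_le_pow₀ hl1)
    nlinarith
  have h5 : ((5000 * (q ^ l + 1) ^ 3 * (q + 1) ^ 4 +
      3000 * q * (M + 1) * ((q + 1) * (q + 2) + (n + 1) + t) : ℕ) : ℝ) ≤
      10000 * t + 18000 * (q * (M + 1)) * t := by
    have : 5000 * (q ^ l + 1) ^ 3 * (q + 1) ^ 4 +
        3000 * q * (M + 1) * ((q + 1) * (q + 2) + (n + 1) + t) ≤
        10000 * t + 18000 * (q * (M + 1)) * t := by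
      have := Nat.mul_le_mul_left (3000 * q * (M + 1)) h2
      have e : 3000 * q * (M + 1) * (6 * t) = 18000 * (q * (M + 1)) * t := by ring
      rw [mul_assoc 5000]
      omega
    exact_mod_cast this
  refine h5.trans ?_
  generalize exp l * (l : ℝ) ^ 5 * log ((n : ℝ) + 2) = Z at h3 h4 ⊢
  have h6 : 18000 * ((q : ℝ) * (M + 1)) * t ≤ 18000 * (288 * Z) * t := by gcongr
  have h7 : 10000 * (t : ℝ) ≤ 10000 * (2 * Z) * t := by nlinarith
  nlinarith

/-- The size of the field. -/
theorem log_field_le {q l n : ℕ} (hl : 0 < l) (hq : 2 ≤ q) (h : n < q ^ (16 * l))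
    (hqlog : (q : ℝ) * log q ≤ 48 * (l : ℝ) ^ 4 * log ((n : ℝ) + 2)) :
    log (q : ℝ) ≤ 7 + 5 * log l := by
  have hlq := half_lt_log hq
  have hl1 : (1 : ℝ) ≤ l := by exact_mod_cast hl
  have hq2 : (2 : ℝ) ≤ q := by exact_mod_cast hq
  have hqle : (q : ℝ) ≤ 816 * (l : ℝ) ^ 5 := by
    -- Now `log (n + 2)` is at most `17 * l * log q`, so `log q` cancels from the field bound and
    -- `q` is polynomial in `l`.
    have h1 : n + 2 ≤ q ^ (17 * l) :=
      calc n + 2 ≤ q ^ (16 * l) * 2 := by have := Nat.one_le_pow (16 * l) q (by omega); omega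
        _ ≤ q ^ (16 * l) * q := Nat.mul_le_mul_left _ hq
        _ = q ^ (16 * l + 1) := (pow_succ ..).symm
        _ ≤ _ := Nat.pow_le_pow_right (by omega) (by omega)
    have h2 : log ((n : ℝ) + 2) ≤ 17 * l * log q := by
      have : log ((n : ℝ) + 2) ≤ log ((q : ℝ) ^ (17 * l)) :=
        Real.log_le_log (by positivity) (by exact_mod_cast h1)
      rw [Real.log_pow] at this
      push_cast at this
      linarith
    have h3 : (q : ℝ) * log q ≤ 816 * (l : ℝ) ^ 5 * log q :=
      hqlog.trans ((mul_le_mul_of_nonneg_left h2 (by positivity)).trans (le_of_eq (by ring)))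
    exact le_of_mul_le_mul_right h3 (by linarith)
  have h1 : log (816 : ℝ) ≤ 7 := by
    rw [Real.log_le_iff_le_exp (by norm_num), show (7 : ℝ) = (7 : ℕ) * 1 by norm_num,
      Real.exp_nat_mul]
    refine le_trans (by norm_num) (pow_le_pow_left₀ (by norm_num : (0 : ℝ) ≤ 2.7)
      (by linarith [Real.exp_one_gt_d9]) 7)
  have h2 := Real.log_le_log (by linarith) hqle
  rw [Real.log_mul (by norm_num) (by positivity), Real.log_pow] at h2
  push_cast at h2
  linarith

/-- The number of large blocks. -/
theorem numBlocks_le {q l s : ℕ} (hl : 0 < l) (hq : 2 ≤ q) (hlogq : log (q : ℝ) ≤ 7 + 5 * log l)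
    (hs : s = 16 * (Nat.log 2 q + 1)) : (s : ℝ) ≤ 192 + 128 * log l := by
  have hL : 0 ≤ log (l : ℝ) := Real.log_nonneg (by exact_mod_cast hl)
  have h1 : (2 : ℝ) ^ Nat.log 2 q ≤ q := by exact_mod_cast Nat.pow_log_le_self 2 (by omega)
  have h2 := Real.log_le_log (by positivity) h1
  rw [Real.log_pow] at h2
  have h3 := Real.log_two_gt_d9
  have h4 : (s : ℝ) = 16 * (Nat.log 2 q + 1) := by rw [hs]; push_cast; ring
  have h5 : (Nat.log 2 q : ℝ) * 0.69 ≤ Nat.log 2 q * log 2 := by gcongr; linarith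
  rw [h4]
  linarith

/-- The reason for choosing `s` as a multiple of `log q`: then `q ^ b` is small enough for the cubic
greedy construction to cost at most `2 ^ l`, up to powers of `q`. -/
theorem pow_pow_le_two_pow {q l s b : ℕ} (hq : 2 ≤ q) (hs : s = 16 * (Nat.log 2 q + 1))
    (hbs : b * s ≤ l) : (q ^ b) ^ 3 ≤ 2 ^ l :=
  calc (q ^ b) ^ 3 ≤ (q ^ b) ^ 16 :=
        Nat.pow_le_pow_right (Nat.pow_pos (by omega)) (by norm_num)
    _ = q ^ (b * 16) := (pow_mul ..).symm
    _ ≤ (2 ^ (Nat.log 2 q + 1)) ^ (b * 16) :=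
        Nat.pow_le_pow_left (Nat.lt_pow_succ_log_self (by norm_num) q).le _
    _ = 2 ^ (b * s) := by rw [← pow_mul, hs]; congr 1; ring
    _ ≤ 2 ^ l := Nat.pow_le_pow_right (by norm_num) hbs

/-- The running time for many blocks. -/
theorem time_le_of_lt_pow {q l n t M s b J : ℕ} (hl : 0 < l) (hq : 2 ≤ q) (h : n < q ^ (16 * l))
    (hs : s = 16 * (Nat.log 2 q + 1)) (hb : b = l / s) (hJ : J = s + l % s - 1)
    (ht : 1 ≤ t) (hn : n ≤ t + 1) (hM : (M : ℝ) ≤ 2 * exp b * (b * log q) + 1)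
    (hqlog : (q : ℝ) * log q ≤ 48 * (l : ℝ) ^ 4 * log ((n : ℝ) + 2)) :
    ((5000 * (q ^ b + 1) ^ 3 * (q + 1) ^ 4 +
      3000 * q * q ^ J * (M ^ s + 1) * ((q + 1) * (q + J + s + 1) + (n + 1) + t) : ℕ) : ℝ) ≤
      10 ^ 8 * (exp l * exp (20736 + 9216 * log l ^ 2) * log ((n : ℝ) + 2) * t) := by
  have hln := half_lt_log_add_two n
  have hlq := half_lt_log hq
  have hl1 : (1 : ℝ) ≤ l := by exact_mod_cast hl
  have ht1 : (1 : ℝ) ≤ t := by exact_mod_cast ht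
  have hq2 : (2 : ℝ) ≤ q := by exact_mod_cast hq
  have hL : 0 ≤ log (l : ℝ) := Real.log_nonneg hl1
  have hbs : b * s ≤ l := by rw [hb]; exact Nat.div_mul_le_self _ _
  have hmod := Nat.mod_lt l (show 0 < s by omega)
  have hJs : J + 1 ≤ 2 * s := by omega
  have hbl : (b : ℝ) ≤ l := by rw [hb]; exact_mod_cast Nat.div_le_self _ _
  have hlogq : log (q : ℝ) ≤ 7 + 5 * log l := log_field_le hl hq h hqlog
  have hsle : (s : ℝ) ≤ 192 + 128 * log l := numBlocks_le hl hq hlogq hs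
  -- `A` dominates `q` and, up to `exp b`, the number of rows; the factor 3 absorbs the 2 and the 1
  -- in the bound on `M`.
  set A : ℝ := 3 * l * q with hA
  have hlq1 : (1 : ℝ) * 1 ≤ l * q := by gcongr; linarith
  have hA1 : 1 ≤ A := by rw [hA]; linarith
  have hqA : (q : ℝ) ≤ A := le_mul_of_one_le_left (by linarith) (by linarith)
  have hlogA : log A ≤ 9 + 6 * log l := by
    rw [hA, Real.log_mul (by positivity) (by positivity), Real.log_mul (by norm_num) (by positivity)]
    have := Real.log_le_sub_one_of_pos (show (0 : ℝ) < 3 by norm_num)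
    linarith
  -- Both `s` and `log A` are linear in `log l`, so the logarithm of `A ^ (6 * s)` is quadratic in
  -- `log l`. The constants are chosen so that the difference of the two sides is a square.
  have hApow : A ^ (6 * s) ≤ exp (20736 + 9216 * log l ^ 2) := by
    rw [← Real.log_le_iff_le_exp (by positivity), Real.log_pow]
    push_cast
    have : 6 * (s : ℝ) * log A ≤ 6 * (192 + 128 * log l) * (9 + 6 * log l) := by
      have := Real.log_nonneg hA1
      gcongr
    refine this.trans (sub_nonneg.1 ?_)
    rw [show 20736 + 9216 * log (l : ℝ) ^ 2 - 6 * (192 + 128 * log l) * (9 + 6 * log l) =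
      4608 * (log (l : ℝ) - 3 / 2) ^ 2 by ring]
    positivity
  have hpow : ∀ i ≤ 6 * s, A ^ i ≤ A ^ (6 * s) := fun i hi => pow_le_pow_right₀ hA1 hi
  have he : 1 ≤ exp (l : ℝ) := Real.one_le_exp (by linarith)
  have hprep : ((q : ℝ) ^ b + 1) ^ 3 * ((q : ℝ) + 1) ^ 4 ≤ 128 * (exp l * A ^ (6 * s)) := by
    have h1 : (q ^ b) ^ 3 ≤ 2 ^ l := pow_pow_le_two_pow hq hs hbs
    have h2 : ((q : ℝ) ^ b) ^ 3 ≤ exp l := by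
      have : ((q : ℝ) ^ b) ^ 3 ≤ 2 ^ l := by exact_mod_cast h1
      refine this.trans ?_
      rw [show exp (l : ℝ) = exp 1 ^ l by rw [← Real.exp_nat_mul, mul_one]]
      exact pow_le_pow_left₀ (by norm_num) (by linarith [Real.exp_one_gt_d9]) _
    have h3 : (1 : ℝ) ≤ (q : ℝ) ^ b := one_le_pow₀ (by linarith)
    calc ((q : ℝ) ^ b + 1) ^ 3 * ((q : ℝ) + 1) ^ 4 ≤ (2 * (q : ℝ) ^ b) ^ 3 * (2 * A) ^ 4 := by
          gcongr <;> linarith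
      _ = 128 * (((q : ℝ) ^ b) ^ 3 * A ^ 4) := by ring
      _ ≤ _ := by
          gcongr
          omega
  -- The factors `exp b` of the `s` blocks multiply to `exp (b * s) ≤ exp l`: the leading factor of
  -- the theorem arises here with base exactly `e`.
  have hMs : (M : ℝ) ^ s + 1 ≤ 2 * (exp l * A ^ s) := by
    have hlogq' : log (q : ℝ) ≤ q := Real.log_le_self (by linarith)
    have h1 : (M : ℝ) ≤ exp b * A := by
      have heb : 1 ≤ exp (b : ℝ) := Real.one_le_exp (Nat.cast_nonneg _)
      have h2 : (b : ℝ) * log q ≤ l * q := by gcongr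
      have h3 : (1 : ℝ) ≤ exp b * (l * q) := one_le_mul_of_one_le_of_one_le heb (by linarith)
      calc (M : ℝ) ≤ 2 * exp b * (l * q) + exp b * (l * q) := by
            refine hM.trans (add_le_add ?_ h3)
            gcongr
        _ = _ := by rw [hA]; ring
    have h2 : (M : ℝ) ^ s ≤ exp l * A ^ s :=
      calc (M : ℝ) ^ s ≤ (exp b * A) ^ s := by gcongr
        _ = exp b ^ s * A ^ s := mul_pow ..
        _ ≤ _ := by
          gcongr
          rw [← Real.exp_nat_mul, Real.exp_le_exp, mul_comm]
          exact_mod_cast hbs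
    have h3 : 1 ≤ exp l * A ^ s := one_le_mul_of_one_le_of_one_le he (one_le_pow₀ hA1)
    linarith
  have hcomb : ((q : ℝ) + 1) * (q + J + s + 1) + (n + 1) + t ≤ 102 * q ^ 2 * t := by
    -- `J + s + 1 ≤ 3 * s`, and `s` is 16 times `Nat.log 2 q + 1`, which is at most `q`.
    have h1 : q + J + s + 1 ≤ 49 * q := by
      have : Nat.log 2 q < q := Nat.log_lt_self 2 (by omega)
      omega
    have h1' : (q : ℝ) + J + s + 1 ≤ 49 * q := by exact_mod_cast h1
    have h2 : ((q : ℝ) + 1) * (q + J + s + 1) ≤ (2 * q) * (49 * q) := by gcongr; linarith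
    have h3 : (n : ℝ) ≤ t + 1 := by exact_mod_cast hn
    have h4 : (1 : ℝ) ≤ q ^ 2 := one_le_pow₀ (by linarith)
    have h5 : (98 : ℝ) * q ^ 2 ≤ 98 * q ^ 2 * t := le_mul_of_one_le_right (by positivity) ht1
    have h6 : (t : ℝ) ≤ q ^ 2 * t := le_mul_of_one_le_left (by positivity) h4
    linarith
  have hsearch : 3000 * (q : ℝ) * q ^ J * ((M : ℝ) ^ s + 1) *
      (((q : ℝ) + 1) * (q + J + s + 1) + (n + 1) + t) ≤ 612000 * (exp l * A ^ (6 * s)) * t :=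
    calc 3000 * (q : ℝ) * q ^ J * ((M : ℝ) ^ s + 1) *
        (((q : ℝ) + 1) * (q + J + s + 1) + (n + 1) + t)
        ≤ 3000 * A * A ^ J * (2 * (exp l * A ^ s)) * (102 * A ^ 2 * t) := by
          gcongr
          exact hcomb.trans (by gcongr)
      -- The exponent `J + 3 + s` is at most `6 * s`, because `J + 1 ≤ 2 * s` and `s ≥ 16`.
      _ = 612000 * (exp l * A ^ (J + 3 + s)) * t := by ring
      _ ≤ _ := by
          gcongr
          omega
  have hfinal : 0 < exp l * A ^ (6 * s) * t := by positivity
  calc ((5000 * (q ^ b + 1) ^ 3 * (q + 1) ^ 4 +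
      3000 * q * q ^ J * (M ^ s + 1) * ((q + 1) * (q + J + s + 1) + (n + 1) + t) : ℕ) : ℝ)
      = 5000 * (((q : ℝ) ^ b + 1) ^ 3 * ((q : ℝ) + 1) ^ 4) + 3000 * (q : ℝ) * q ^ J *
        ((M : ℝ) ^ s + 1) * (((q : ℝ) + 1) * (q + J + s + 1) + (n + 1) + t) := by
        push_cast; ring
    _ ≤ 5000 * (128 * (exp l * A ^ (6 * s))) * t + 612000 * (exp l * A ^ (6 * s)) * t := by
        have : 5000 * (128 * (exp l * A ^ (6 * s))) ≤ 5000 * (128 * (exp l * A ^ (6 * s))) * t :=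
          le_mul_of_one_le_right (by positivity) ht1
        linarith
    _ ≤ 10 ^ 8 * (exp l * A ^ (6 * s) * (1 / 2) * t) := by linarith
    _ ≤ _ := by gcongr

end While

/-! ### Conclusion -/

theorem mainTheorem10 :
    ∃ K : ℝ, 0 < K ∧ ∀ (C : GraphClass) (t : ℕ → ℕ → ℕ),
      ColorfulIndepSetComputableInTime C t →
        BoundedIndepSetComputableInTime clusterGraphs C
          (fun l n => K * (Real.exp (l : ℝ) * (l : ℝ) ^ (K * Real.log (l : ℝ)) *
            Real.log ((n : ℝ) + 2) * (t l n : ℝ))) := by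
  classical
  have hK : (10 : ℝ) ^ 8 ≤ 10 ^ 8 * Real.exp 20736 :=
    le_mul_of_one_le_right (by norm_num) (Real.one_le_exp (by norm_num))
  -- The same constant is used as a factor and in the exponent of `l`; as a factor it must absorb
  -- `exp 20736`, in the exponent it must only be at least 9216.
  refine ⟨10 ^ 8 * Real.exp 20736, by positivity, fun C t ⟨P, hP⟩ => ⟨While.program P, ?_⟩⟩
  rintro n l hl G - G₁ G₂ ⟨h₁, h₂, rfl⟩ L₁ L₂ w
  obtain ⟨ht, hn⟩ := le_time_of_computes L₂ hl fun w col => hP n l G₂ h₂ L₂ w col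
  obtain ⟨q', hq', hlog'⟩ := While.exists_goodField n hl
  obtain ⟨q, hq, hmin⟩ : ∃ q, While.GoodField n (2 * (l * l)) q ∧
      ∀ q', While.GoodField n (2 * (l * l)) q' → q ≤ q' :=
    ⟨Nat.find ⟨q', hq'⟩, Nat.find_spec _, fun _ h => Nat.find_min' _ h⟩
  have hq2 := hq.1.two_le
  have hlog : (q : ℝ) * Real.log q ≤ 48 * (l : ℝ) ^ 4 * Real.log ((n : ℝ) + 2) := by
    -- The algorithm uses the least good field and not the one from Bertrand's postulate; the bound
    -- carries over because `q * log q` is increasing.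
    refine le_trans ?_ hlog'
    have : (q : ℝ) ≤ q' := by exact_mod_cast hmin _ hq'
    have : (0 : ℝ) < q := by exact_mod_cast hq.1.pos
    have := While.half_lt_log hq2
    gcongr
  set p : While.Params := ⟨n, l, q, While.Params.numBlocks n l q⟩ with hp
  have hgood : p.Good := ⟨hl, While.Params.numBlocks_pos n l q, hq⟩
  obtain ⟨M, -, hM, k, s, S, hexec, hk, hS, hmax⟩ := While.program_spec (p := p) hgood rfl hmin
    h₁ L₁ L₂ w P (t l n) fun col => hP n l G₂ h₂ L₂ w col
  refine ⟨k, s, S, hexec, ?_, hS, hmax⟩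
  have hM' := While.rows_le (q := q) (b := p.b) (by
    have h1 : 2 * (l * l) < q := hgood.lt_q
    have h2 : p.b * p.b ≤ l * l := Nat.mul_le_mul While.Params.b_le While.Params.b_le
    omega) hM
  have hl1 : (1 : ℝ) ≤ l := by exact_mod_cast hl
  have hL := Real.log_nonneg hl1
  have hln := While.half_lt_log_add_two n
  have htime : (k : ℝ) ≤ 10 ^ 8 * (Real.exp l * Real.exp (20736 + 9216 * Real.log l ^ 2) *
      Real.log ((n : ℝ) + 2) * t l n) := by
    have hk' := (Nat.cast_le (α := ℝ)).2 hk
    refine hk'.trans ?_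
    -- This is the case distinction made by `Params.numBlocks`; with `s = 1` there is a single block
    -- of size `l` and no threshold.
    by_cases hcase : q ^ (16 * l) ≤ n
    · have hs : While.Params.numBlocks n l q = 1 := if_pos hcase
      have hb : p.b = l := by simp [hp, While.Params.b, hs]
      have hJ : p.J = 0 := by simp [hp, While.Params.J, While.Params.r, hs, Nat.mod_one]
      have hs' : p.s = 1 := hs
      rw [hb] at hM'
      have h5 : (l : ℝ) ^ 5 ≤ Real.exp (20736 + 9216 * Real.log l ^ 2) := by
        rw [← Real.log_le_iff_le_exp (by positivity), Real.log_pow]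
        push_cast
        nlinarith [sq_nonneg (Real.log (l : ℝ) - 3)]
      rw [While.Params.Q, hb, hJ, hs', pow_zero, pow_one, mul_one, Nat.add_zero]
      refine (While.time_le_of_pow_le hl hq2 hcase ht hn hM' hlog).trans ?_
      gcongr
    · have hs : p.s = 16 * (Nat.log 2 q + 1) := if_neg hcase
      rw [While.Params.Q]
      exact While.time_le_of_lt_pow hl hq2 (not_le.1 hcase) hs rfl rfl ht hn hM' hlog
  refine htime.trans ?_
  beta_reduce
  -- `l ^ (K * log l)` is `exp (K * log l ^ 2)`, so the quadratic exponent in `log l` is turned into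
  -- the stated power of `l`.
  rw [Real.rpow_def_of_pos (by linarith), Real.exp_add]
  have hexp : Real.exp (9216 * Real.log l ^ 2) ≤
      Real.exp (Real.log l * (10 ^ 8 * Real.exp 20736 * Real.log l)) := by
    rw [Real.exp_le_exp]
    nlinarith [mul_self_nonneg (Real.log (l : ℝ))]
  calc 10 ^ 8 * (Real.exp l * (Real.exp 20736 * Real.exp (9216 * Real.log l ^ 2)) *
      Real.log ((n : ℝ) + 2) * t l n) = 10 ^ 8 * Real.exp 20736 * (Real.exp l *
        Real.exp (9216 * Real.log l ^ 2) * Real.log ((n : ℝ) + 2) * t l n) := by ring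
    _ ≤ _ := by gcongr
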